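/- **Setting.** For an odd prime $p$ and an integer $d$ prime to $p$ let $\left(\frac dp\right)_+=\frac12\left(1-\left(\frac dp\right)\right)\in\mathbb F_2$ be the additive Legendre symbol; for odd $m>0$ prime to $d$ define $\left(\frac dm\right)_+$ in the same way from the Jacobi symbol. Let $D\ge 1$ be a product of distinct odd primes, $c$ the number of primes dividing $D$, and $n_0$ an odd integer coprime to $D$. Let $X_{n_0,D}$ be the set of squarefree integers $n$ coprime to $2D$ such that $n/n_0$ is positive and a quadratic residue modulo $8D$. Let $T_l=(d_{l,1},\dots,d_{l,t})$ and $Q_l$ ($l=1,2$) be finite sequences of (positive or negative) integer divisors of $2D$, where $T_1,T_2$ have the same length $t$; let $d_{diag}$ be an integer divisor of $2D$, and $B$ an alternating $t\times t$ matrix over $\mathbb F_2$. Let $b_l$ be the product of the terms of $Q_l$, and assume that none of $b_1$, $b_2$, $-b_1b_2$ is a square and that at least one of $b_1,b_2$ is not $-1$ times a square. For primes $p_1,\dots,p_r$ with $|n|=p_1\cdots p_r$, $n\in X_{n_0,D}$, let $$M^{alt}=\begin{pmatrix} B_1 & A^\top+D_{diag} & R_1^\top\\ A+D_{diag} & B_2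 & R_2^\top\\ R_1&R_2&B\end{pmatrix},$$ a $(2r+t)\times(2r+t)$ matrix over $\mathbb F_2$, where $(B_l)_{ij}=\sum_{d\in Q_l}\left(\frac d{p_i}\right)_+\left(\frac d{p_j}\right)_+$ for $i\ne j$ and $(B_l)_{ii}=0$; $(R_l)_{ij}=\left(\frac{d_{l,i}}{p_j}\right)_+$; $A_{ij}=\left(\frac{p_j}{p_i}\right)_+$ for $i\neq j$ and $A_{ii}=\sum_{j\ne i}A_{ij}$; and $D_{diag}$ is diagonal with entries $\left(\frac{d_{diag}}{p_i}\right)_+$. Let $\mathbf v$ be the sum of the first $r$ columns of $M^{alt}$, $\mathbf v'$ the sum of columns $r+1,\dots,2r$, and $\mathbf v_i$ column $2r+i$ ($1\le i\le t$). Let $\delta$ be the least integer such that $\{\mathbf v,\mathbf v',\mathbf v_1,\dots,\mathbf v_t\}$ has rank $t+2-\delta$ for some $n\in X_{n_0,D}$. By multiplicativity of the symbol in $d$ and quadratic reciprocity, $M^{alt}$ is a function of the following bits in $\mathbb F_2$: $\left(\frac{-1}{p_i}\right)_+$ and $\left(\frac{q}{p_i}\right)_+$ for $1\le i\le r$ and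 each prime $q\mid 2D$, and $\left(\frac{p_i}{p_j}\right)_+$ for $i<j$. A *bit assignment* (for a given $r$) is an arbitrary choice of values for these bits, subject only to the conditions imposed by the class of $n$ modulo $8D$, namely $\sum_i\left(\frac{g}{p_i}\right)_+=\left(\frac{g}{|n_0|}\right)_+$ for $g=-1$ and for every prime $g=q\mid 2D$. For $k\ge0$ put $$\alpha_k=2^{k+1}\prod_{j=1}^k(2^j-1)^{-1}\prod_{j=0}^\infty(1+2^{-j})^{-1}.$$ **Proposition.** For every $r\ge1$ there are exactly $2^{\frac12(r+2c+4)(r-1)}$ bit assignments, and for every integer $k$ $$\lim_{r\to\infty}\frac{\#\{\text{bit assignments with }\operatorname{corank}(M^{alt})=k+\delta\}}{2^{\frac12(r+2c+4)(r-1)}}=\begin{cases}\alpha_k&\text{if }k\ge0\text{ and }k\equiv t+\delta\pmod 2,\\0&\text{otherwise.}\end{cases}$$ -/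

import Mathlib

open Filter Topology

namespace AltMatrix

/-- The additive Legendre symbol `(d/m)₊ = (1 - (d/m))/2 ∈ 𝔽₂` (for a prime `m` the Jacobi symbol
is the Legendre symbol). It is only used for `d` coprime to `m`, where `(d/m) = ±1`. -/
def addSym (d : ℤ) (m : ℕ) : ZMod 2 := (((1 - jacobiSym d m) / 2 : ℤ) : ZMod 2)

/-- The input data from which the alternating matrices are built, with its standing assumptions. -/
structure Data where
  /-- a product of distinct odd primes -/
  D : ℕ
  n₀ : ℤ
  t : ℕ
  T₁ : Fin t → ℤ
  T₂ : Fin t → ℤ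
  Q₁ : List ℤ
  Q₂ : List ℤ
  dDiag : ℤ
  B : Matrix (Fin t) (Fin t) (ZMod 2)
  odd_D : Odd D
  squarefree_D : Squarefree D
  odd_n₀ : Odd n₀
  coprime_n₀ : IsCoprime n₀ (D : ℤ)
  dvd_T₁ : ∀ i, T₁ i ∣ 2 * (D : ℤ)
  dvd_T₂ : ∀ i, T₂ i ∣ 2 * (D : ℤ)
  dvd_Q₁ : ∀ d ∈ Q₁, d ∣ 2 * (D : ℤ)
  dvd_Q₂ : ∀ d ∈ Q₂, d ∣ 2 * (D : ℤ)
  dvd_dDiag : dDiag ∣ 2 * (D : ℤ)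
  /-- `B` is alternating -/
  symm_B : ∀ i j, B i j = B j i
  diag_B : ∀ i, B i i = 0
  /-- none of `b₁`, `b₂`, `-b₁b₂` is a square, where `b_l` is the product of the sequence `Q_l` -/
  b₁_not_sq : ¬ IsSquare Q₁.prod
  b₂_not_sq : ¬ IsSquare Q₂.prod
  neg_b₁b₂_not_sq : ¬ IsSquare (-(Q₁.prod * Q₂.prod))
  /-- one of `b₁`, `b₂` is not `-1` times a square -/
  not_both_neg_sq : ¬ IsSquare (-Q₁.prod) ∨ ¬ IsSquare (-Q₂.prod)

/-- The values of the additive Legendre symbols attached to `p₁, …, p_r`: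
`divisor d i` is `(d/p_i)₊` and `pair j i` is `(p_j/p_i)₊`. -/
structure Symbols (r : ℕ) where
  divisor : ℤ → Fin r → ZMod 2
  pair : Fin r → Fin r → ZMod 2

namespace Symbols

variable {r : ℕ} (σ : Symbols r)

/-- The alternating matrix `B_l` attached to the sequence `Q = Q_l`. -/
def matB (Q : List ℤ) : Matrix (Fin r) (Fin r) (ZMod 2) := fun i j =>
  if i = j then 0 else (Q.map fun d => σ.divisor d i * σ.divisor d j).sum

/-- The matrix `R_l` attached to the sequence `T = T_l`. -/
def matR {t : ℕ} (T : Fin t → ℤ) : Matrix (Fin t) (Fin r) (ZMod 2) := fun i j =>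
  σ.divisor (T i) j

/-- The matrix `A`, with `A_ij = (p_j/p_i)₊` off the diagonal and rows summing to zero. -/
def matA : Matrix (Fin r) (Fin r) (ZMod 2) := fun i j =>
  if i = j then ∑ l ∈ Finset.univ.erase i, σ.pair l i else σ.pair j i

/-- The diagonal matrix with entries `(d/p_i)₊`. -/
def matDiag (d : ℤ) : Matrix (Fin r) (Fin r) (ZMod 2) := Matrix.diagonal (σ.divisor d)

/-- The matrix `M^alt`. -/
def malt (S : Data) :
    Matrix ((Fin r ⊕ Fin r) ⊕ Fin S.t) ((Fin r ⊕ Fin r) ⊕ Fin S.t) (ZMod 2) :=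
  Matrix.fromBlocks
    (Matrix.fromBlocks
      (σ.matB S.Q₁) (σ.matA.transpose + σ.matDiag S.dDiag)
      (σ.matA + σ.matDiag S.dDiag) (σ.matB S.Q₂))
    (Matrix.fromRows (σ.matR S.T₁).transpose (σ.matR S.T₂).transpose)
    (Matrix.fromCols (σ.matR S.T₁) (σ.matR S.T₂))
    S.B

end Symbols

/-- The corank of a square matrix. -/
noncomputable def corank {m : Type*} [Fintype m] (M : Matrix m m (ZMod 2)) : ℕ :=
  Fintype.card m - M.rank

namespace Data

variable (S : Data)

/-- The number of prime divisors of `D`. -/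
def c : ℕ := S.D.primeFactors.card

/-- The set `X_{n₀, D}`: squarefree `n` coprime to `2D` with `n/n₀` positive and a square mod `8D`. -/
def X : Set ℤ :=
  {n | Squarefree n ∧ IsCoprime n (2 * (S.D : ℤ)) ∧ 0 < (n : ℚ) / (S.n₀ : ℚ) ∧
    ∃ x : ℤ, n ≡ S.n₀ * x ^ 2 [ZMOD 8 * (S.D : ℤ)]}

/-- `(p₁, …, p_r)` lists the prime factors of an element `n = ±p₁⋯p_r` of `X_{n₀, D}`
(all elements of `X_{n₀, D}` have the sign of `n₀`). -/
def IsPrimeTuple {r : ℕ} (p : Fin r → ℕ) : Prop :=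
  (∀ i, (p i).Prime) ∧ S.n₀.sign * ∏ i, (p i : ℤ) ∈ S.X

/-- The rank of `{v, v', v₁, …, v_t}`, where `v` is the sum of the first `r` columns of `M`, `v'` is
the sum of the next `r` columns, and `v₁, …, v_t` are the last `t` columns. -/
noncomputable def columnRank {r : ℕ}
    (M : Matrix ((Fin r ⊕ Fin r) ⊕ Fin S.t) ((Fin r ⊕ Fin r) ⊕ Fin S.t) (ZMod 2)) : ℕ :=
  Set.finrank (ZMod 2)
    ({(fun x => ∑ j, M x (.inl (.inl j))), (fun x => ∑ j, M x (.inl (.inr j)))} ∪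
      Set.range fun (i : Fin S.t) x => M x (.inr i))

end Data

/-- The Legendre symbols of an actual tuple of primes. -/
def primeSymbols {r : ℕ} (p : Fin r → ℕ) : Symbols r where
  divisor d i := addSym d (p i)
  pair j i := addSym (p j : ℤ) (p i)

/-- The corank correction: the least `δ` such that `{v, v', v₁, …, v_t}` has rank `t + 2 - δ` for
the matrix `M^alt(n)` of some `n ∈ X_{n₀, D}`. -/
noncomputable def Data.delta (S : Data) : ℕ :=
  sInf {δ : ℕ | ∃ (r : ℕ) (p : Fin r → ℕ), S.IsPrimeTuple p ∧
    S.columnRank ((primeSymbols p).malt S) + δ = S.t + 2}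

/-- An assignment of the bits determining `M^alt`: the bits `(-1/p_i)₊`, the bits `(q/p_i)₊` for the
primes `q ∣ 2D`, subject to the conditions imposed by the class of `n = ±p₁⋯p_r` modulo `8D`
(namely that they add up over `i` to the symbols `(-1/|n₀|)₊` and `(q/|n₀|)₊`), and the bits
`(p_i/p_j)₊` for `i < j`, which are unrestricted. -/
@[ext] structure BitAssignment (S : Data) (r : ℕ) where
  negOne : Fin r → ZMod 2
  prime : (2 * S.D).primeFactors → Fin r → ZMod 2
  upper : {ij : Fin r × Fin r // ij.1 < ij.2} → ZMod 2
  sum_negOne : ∑ i, negOne i = addSym (-1) S.n₀.natAbs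
  sum_prime : ∀ q, ∑ i, prime q i = addSym ((q : ℕ) : ℤ) S.n₀.natAbs

/-- All Legendre symbols entering `M^alt` in terms of the bits: `(d/p_i)₊` for `d ∣ 2D` by
multiplicativity, and `(p_j/p_i)₊ = (p_i/p_j)₊ + (-1/p_i)₊(-1/p_j)₊` for `i < j` by quadratic
reciprocity. -/
def BitAssignment.symbols {S : Data} {r : ℕ} (β : BitAssignment S r) : Symbols r where
  divisor d i := (if d < 0 then β.negOne i else 0) +
    ∑ q : (2 * S.D).primeFactors, if ((q : ℕ) : ℤ) ∣ d then β.prime q i else 0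
  pair j i :=
    if h : j < i then β.upper ⟨(j, i), h⟩
    else if h : i < j then β.upper ⟨(i, j), h⟩ + β.negOne i * β.negOne j
    else 0

/-- The matrix `M^alt` of a bit assignment. -/
def BitAssignment.malt {S : Data} {r : ℕ} (β : BitAssignment S r) :
    Matrix ((Fin r ⊕ Fin r) ⊕ Fin S.t) ((Fin r ⊕ Fin r) ⊕ Fin S.t) (ZMod 2) :=
  β.symbols.malt S

/-- The limiting probabilities
`α_k = 2^(k+1) ∏_{j=1}^k (2^j - 1)⁻¹ ∏_{j=0}^∞ (1 + 2^(-j))⁻¹`. -/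
noncomputable def alpha (k : ℕ) : ℝ :=
  2 ^ (k + 1) * (∏ j ∈ Finset.Icc 1 k, ((2 : ℝ) ^ j - 1)⁻¹) *
    ∏' j : ℕ, (1 + ((2 : ℝ) ^ j)⁻¹)⁻¹

/-! Checks of the definitions: the bits of an actual prime tuple form a bit assignment with the same
matrix, the corank correction is a minimum over a nonempty set, and the product in `alpha` converges. -/

theorem addSym_of_one {d : ℤ} {m : ℕ} (h : jacobiSym d m = 1) : addSym d m = 0 := by
  simp [addSym, h]

theorem addSym_of_neg_one {d : ℤ} {m : ℕ} (h : jacobiSym d m = -1) : addSym d m = 1 := by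
  simp [addSym, h]

theorem addSym_eq_of {a b e : ℤ} {m n l : ℕ} (ha : a.gcd m = 1) (hb : b.gcd n = 1)
    (h : jacobiSym e l = jacobiSym a m * jacobiSym b n) :
    addSym e l = addSym a m + addSym b n := by
  rcases jacobiSym.eq_one_or_neg_one ha with h1 | h1 <;>
  rcases jacobiSym.eq_one_or_neg_one hb with h2 | h2 <;>
  (simp [addSym, h, h1, h2]; try decide)

theorem addSym_prod_right {ι : Type*} (s : Finset ι) (p : ι → ℕ) (d : ℤ)
    (hp : ∀ i ∈ s, d.gcd (p i) = 1) (h0 : ∀ i ∈ s, p i ≠ 0) :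
    addSym d (∏ i ∈ s, p i) = ∑ i ∈ s, addSym d (p i) := by
  classical
  induction s using Finset.induction_on with
  | empty => simp [addSym]
  | insert a s ha ih =>
    simp only [Finset.forall_mem_insert] at hp h0
    rw [Finset.prod_insert ha, Finset.sum_insert ha, ← ih hp.2 h0.2]
    refine addSym_eq_of hp.1 ?_ (jacobiSym.mul_right' d h0.1 (Finset.prod_ne_zero_iff.2 h0.2))
    rw [← Int.isCoprime_iff_gcd_eq_one]
    push_cast
    exact IsCoprime.prod_right fun i hi => Int.isCoprime_iff_gcd_eq_one.2 (hp.2 i hi)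

theorem addSym_prod_left {ι : Type*} (s : Finset ι) (f : ι → ℤ) (m : ℕ)
    (hp : ∀ i ∈ s, (f i).gcd m = 1) :
    addSym (∏ i ∈ s, f i) m = ∑ i ∈ s, addSym (f i) m := by
  classical
  induction s using Finset.induction_on with
  | empty => simp [addSym, jacobiSym.one_left]
  | insert a s ha ih =>
    simp only [Finset.forall_mem_insert] at hp
    rw [Finset.prod_insert ha, Finset.sum_insert ha, ← ih hp.2]
    refine addSym_eq_of hp.1 ?_ (jacobiSym.mul_left _ _ _)
    rw [← Int.isCoprime_iff_gcd_eq_one]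
    exact IsCoprime.prod_left fun i hi => Int.isCoprime_iff_gcd_eq_one.2 (hp.2 i hi)

theorem Data.coprime_natAbs (S : Data) : IsCoprime S.n₀ (2 * (S.D : ℤ)) := by
  refine IsCoprime.mul_right ?_ S.coprime_n₀
  obtain ⟨k, hk⟩ := S.odd_n₀
  exact ⟨1, -k, by rw [hk]; ring⟩

/-- The sign and product conditions: the product of a prime tuple has the same symbols as `|n₀|`. -/
theorem Data.IsPrimeTuple.sum_addSym {S : Data} {r : ℕ} {p : Fin r → ℕ} (hp : S.IsPrimeTuple p)
    {g : ℤ} (hg : g ∣ 2 * (S.D : ℤ)) :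
    ∑ i, addSym g (p i) = addSym g S.n₀.natAbs := by
  obtain ⟨hpr, -, hco, hpos, x, hx⟩ := hp
  have h0 : S.n₀ ≠ 0 := by
    rintro h; have := S.odd_n₀; simp [h] at this
  have hD : (S.D : ℤ) ≠ 0 := by exact_mod_cast S.squarefree_D.ne_zero
  have hg0 : g ≠ 0 := by rintro rfl; simp at hg; omega
  set m : ℕ := ∏ i, p i with hm
  have hmZ : (∏ i, (p i : ℤ)) = (m : ℤ) := by simp [hm]
  rw [hmZ] at hx hco
  -- coprimality
  have hmco : IsCoprime (m : ℤ) (2 * (S.D : ℤ)) := (IsCoprime.of_mul_left_right hco)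
  have hpco : ∀ i, IsCoprime (p i : ℤ) (2 * (S.D : ℤ)) := fun i =>
    hmco.of_isCoprime_of_dvd_left (by
      exact_mod_cast Finset.dvd_prod_of_mem p (Finset.mem_univ i))
  have hgp : ∀ i, g.gcd (p i) = 1 := fun i =>
    Int.isCoprime_iff_gcd_eq_one.1 ((hpco i).of_isCoprime_of_dvd_right hg).symm
  rw [← addSym_prod_right _ _ _ (fun i _ => hgp i) (fun i _ => (hpr i).ne_zero), ← hm]
  -- reduce to a congruence of absolute values
  have hcong : (m : ℤ) ≡ (S.n₀.natAbs : ℤ) * x ^ 2 [ZMOD 8 * (S.D : ℤ)] := by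
    have h1 := hx.mul_left S.n₀.sign
    have hs : S.n₀.sign * S.n₀.sign = 1 := by
      rcases lt_or_gt_of_ne h0 with h | h
      · simp [Int.sign_eq_neg_one_of_neg h]
      · simp [Int.sign_eq_one_of_pos h]
    rw [← mul_assoc, hs, one_mul, ← mul_assoc, Int.sign_mul_self_eq_natAbs] at h1
    exact h1
  have hxco : IsCoprime x (2 * (S.D : ℤ)) := by
    obtain ⟨c, hc⟩ := hcong.symm.dvd
    have : IsCoprime ((S.n₀.natAbs : ℤ) * x ^ 2) (2 * (S.D : ℤ)) := by
      have : (S.n₀.natAbs : ℤ) * x ^ 2 = m + (2 * (S.D : ℤ)) * (-(4 * c)) := by linarith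
      rw [this]
      exact IsCoprime.add_mul_left_left hmco _
    have := IsCoprime.of_mul_left_right this
    rw [pow_two] at this
    exact IsCoprime.of_mul_left_right this
  have hodd : ∀ {y : ℤ}, IsCoprime y (2 * (S.D : ℤ)) → Odd y.natAbs := by
    intro y hy
    rw [Int.natAbs_odd, ← Int.not_even_iff_odd]
    rintro ⟨z, hz⟩
    have : IsUnit (2 : ℤ) := hy.isUnit_of_dvd' ⟨z, by omega⟩ ⟨_, rfl⟩
    simp [Int.isUnit_iff] at this
  have hJ : jacobiSym g m = jacobiSym g (S.n₀.natAbs * x.natAbs ^ 2) := by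
    have hb1 : Odd m := by simpa using hodd hmco
    have hb2 : Odd (S.n₀.natAbs * x.natAbs ^ 2) := (hodd S.coprime_natAbs).mul (hodd hxco).pow
    rw [jacobiSym.mod_right g hb1, jacobiSym.mod_right g hb2]
    congr 1
    have hdvd : ((4 * g.natAbs : ℕ) : ℤ) ∣ 8 * (S.D : ℤ) := by
      push_cast
      rw [show 8 * (S.D : ℤ) = 4 * (2 * S.D) by ring]
      exact mul_dvd_mul_left 4 ((abs_dvd _ _).2 hg)
    have := hcong.of_dvd hdvd
    have h2 : (x ^ 2 : ℤ) = ((x.natAbs ^ 2 : ℕ) : ℤ) := by simp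
    rw [h2] at this
    exact (Int.natCast_modEq_iff.1 (by push_cast at this ⊢; exact this))
  have hx0 : x.natAbs ≠ 0 := (hodd hxco).pos.ne'
  have hgx : jacobiSym g x.natAbs ^ 2 = 1 := by
    apply jacobiSym.sq_one
    have := (hxco.of_isCoprime_of_dvd_right hg).symm
    rw [Int.isCoprime_iff_gcd_eq_one] at this
    rwa [Int.gcd, Int.natAbs_natCast]
  rw [jacobiSym.mul_right' g (by simpa using h0) (pow_ne_zero _ hx0), jacobiSym.pow_right, hgx,
    mul_one] at hJ
  simp [addSym, hJ]

theorem Data.IsPrimeTuple.coprime {S : Data} {r : ℕ} {p : Fin r → ℕ} (hp : S.IsPrimeTuple p)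
    {g : ℤ} (hg : g ∣ 2 * (S.D : ℤ)) (i : Fin r) : g.gcd (p i) = 1 := by
  have hco := hp.2.2.1
  refine Int.isCoprime_iff_gcd_eq_one.1 (IsCoprime.of_isCoprime_of_dvd_right ?_ hg).symm
  exact hco.of_isCoprime_of_dvd_left
    ((Finset.dvd_prod_of_mem (fun i => (p i : ℤ)) (Finset.mem_univ i)).mul_left _)

/-- The bits of an actual tuple of primes. -/
def BitAssignment.ofPrimes {S : Data} {r : ℕ} (p : Fin r → ℕ) (hp : S.IsPrimeTuple p) :
    BitAssignment S r where
  negOne i := addSym (-1) (p i)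
  prime q i := addSym ((q : ℕ) : ℤ) (p i)
  upper ij := addSym (p ij.1.1 : ℤ) (p ij.1.2)
  sum_negOne := hp.sum_addSym (by simp)
  sum_prime q := hp.sum_addSym (by exact_mod_cast Nat.dvd_of_mem_primeFactors q.2)

theorem addSym_divisor {S : Data} {r : ℕ} {p : Fin r → ℕ} (hp : S.IsPrimeTuple p)
    {d : ℤ} (hd : d ∣ 2 * (S.D : ℤ)) (i : Fin r) :
    (BitAssignment.ofPrimes p hp).symbols.divisor d i = addSym d (p i) := by
  have hsq : Squarefree (2 * S.D) := by
    rw [Nat.squarefree_mul_iff]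
    exact ⟨(Nat.coprime_two_left).2 S.odd_D, Nat.prime_two.prime.squarefree, S.squarefree_D⟩
  have hdn : d.natAbs ∣ 2 * S.D := by
    have := Int.natAbs_dvd_natAbs.2 hd
    simpa [Int.natAbs_mul] using this
  have hd0 : d ≠ 0 := by
    rintro rfl; exact hsq.ne_zero (by simpa using hdn)
  have hfac : d.natAbs = ∏ q ∈ (2 * S.D).primeFactors with q ∣ d.natAbs, q := by
    conv_lhs => rw [← Nat.prod_primeFactors_of_squarefree (hsq.squarefree_of_dvd hdn)]
    refine Finset.prod_congr ?_ fun _ _ => rfl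
    ext q
    simp only [Finset.mem_filter, Nat.mem_primeFactors]
    constructor
    · rintro ⟨h1, h2, -⟩; exact ⟨⟨h1, h2.trans hdn, hsq.ne_zero⟩, h2⟩
    · rintro ⟨⟨h1, -, -⟩, h2⟩; exact ⟨h1, h2, by simpa using hd0⟩
  have habs : addSym (d.natAbs : ℤ) (p i) =
      ∑ q : (2 * S.D).primeFactors, if ((q : ℕ) : ℤ) ∣ d then addSym ((q : ℕ) : ℤ) (p i) else 0 := by
    conv_lhs => rw [hfac]
    push_cast
    rw [addSym_prod_left, Finset.sum_filter,
      ← Finset.sum_coe_sort (2 * S.D).primeFactors]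
    · simp only [Int.natCast_dvd]
    · intro q hq
      exact hp.coprime (by
        exact_mod_cast Nat.dvd_of_mem_primeFactors (Finset.mem_filter.1 hq).1) i
  simp only [BitAssignment.symbols, BitAssignment.ofPrimes]
  rw [← habs]
  have hc := hp.coprime hd i
  split_ifs with h
  · symm
    refine addSym_eq_of (hp.coprime (by simp) i) (by rwa [Int.gcd, Int.natAbs_natCast]) ?_
    rw [← jacobiSym.mul_left]
    congr 1
    omega
  · rw [zero_add]; congr 1; omega

/-- On actual primes, the matrix built from the bits is the matrix `M^alt(n)`. -/
theorem BitAssignment.malt_ofPrimes {S : Data} {r : ℕ} {p : Fin r → ℕ} (hp : S.IsPrimeTuple p) :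
    (BitAssignment.ofPrimes p hp).malt = (primeSymbols p).malt S := by
  have hodd : ∀ i, Odd (p i) := by
    intro i
    refine (hp.1 i).odd_of_ne_two fun h => ?_
    have := hp.coprime (dvd_mul_right 2 (S.D : ℤ)) i
    rw [h] at this
    simp at this
  have hinj : ∀ i j, i ≠ j → (p i).Coprime (p j) := by
    intro i j hij
    rw [Nat.coprime_primes (hp.1 i) (hp.1 j)]
    intro h
    have hs : Squarefree (∏ i, (p i : ℤ)) := hp.2.1.squarefree_of_dvd (dvd_mul_left _ _)
    have h2 : (p i : ℤ) * p i ∣ ∏ i, (p i : ℤ) := by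
      rw [← Finset.mul_prod_erase _ _ (Finset.mem_univ i)]
      refine mul_dvd_mul_left _ ?_
      rw [h]
      exact Finset.dvd_prod_of_mem (fun i => (p i : ℤ))
        (Finset.mem_erase.2 ⟨hij.symm, Finset.mem_univ j⟩)
    have := Int.isUnit_iff_natAbs_eq.1 (hs _ h2)
    exact (hp.1 i).one_lt.ne' (by simpa using this)
  have hpair : ∀ i j, i ≠ j → (BitAssignment.ofPrimes p hp).symbols.pair j i =
      (primeSymbols p).pair j i := by
    intro i j hij
    simp only [BitAssignment.symbols, BitAssignment.ofPrimes, primeSymbols]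
    rcases lt_or_gt_of_ne hij with h | h
    · rw [dif_neg h.not_gt, dif_pos h]
      have hci : (p i : ℤ).gcd (p j) = 1 := by simpa using hinj i j hij
      have hq := jacobiSym.quadratic_reciprocity_if (a := p i) (b := p j)
        (Nat.odd_iff.1 (hodd i)) (Nat.odd_iff.1 (hodd j))
      have e : ∀ k, addSym (-1) (p k) = if p k % 4 = 3 then 1 else 0 := by
        intro k
        have := Nat.odd_iff.1 (hodd k)
        split_ifs with h
        · exact addSym_of_neg_one (by
            rw [jacobiSym.at_neg_one (hodd k), ZMod.χ₄_nat_three_mod_four h])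
        · exact addSym_of_one (by
            rw [jacobiSym.at_neg_one (hodd k), ZMod.χ₄_nat_one_mod_four (by omega)])
      rw [e, e]
      have hcj : (p j : ℤ).gcd (p i) = 1 := by simpa using hinj j i hij.symm
      rcases jacobiSym.eq_one_or_neg_one hci with h1 | h1 <;>
      rcases jacobiSym.eq_one_or_neg_one hcj with h2 | h2 <;>
      by_cases h3 : p i % 4 = 3 <;> by_cases h4 : p j % 4 = 3 <;>
      simp [h1, h2, h3, h4] at hq <;>
      simp [addSym_of_one, addSym_of_neg_one, h1, h2, h3, h4] <;> decide
    · rw [dif_pos h]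
  have hB : ∀ Q : List ℤ, (∀ d ∈ Q, d ∣ 2 * (S.D : ℤ)) →
      (BitAssignment.ofPrimes p hp).symbols.matB Q = (primeSymbols p).matB Q := by
    intro Q hQ
    ext i j
    simp only [Symbols.matB]
    congr 2
    refine List.map_congr_left fun d hd => ?_
    rw [addSym_divisor hp (hQ d hd), addSym_divisor hp (hQ d hd)]
    rfl
  have hR : ∀ T : Fin S.t → ℤ, (∀ d, T d ∣ 2 * (S.D : ℤ)) →
      (BitAssignment.ofPrimes p hp).symbols.matR T = (primeSymbols p).matR T := by
    intro T hT
    ext i j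
    exact addSym_divisor hp (hT i) j
  have hd : (BitAssignment.ofPrimes p hp).symbols.matDiag S.dDiag =
      (primeSymbols p).matDiag S.dDiag := by
    simp only [Symbols.matDiag]
    congr 1
    ext i
    exact addSym_divisor hp S.dvd_dDiag i
  have hA : (BitAssignment.ofPrimes p hp).symbols.matA = (primeSymbols p).matA := by
    ext i j
    simp only [Symbols.matA]
    split_ifs with h
    · exact Finset.sum_congr rfl fun l hl => hpair i l (Finset.ne_of_mem_erase hl).symm
    · exact hpair i j h
  simp only [BitAssignment.malt, Symbols.malt, hB _ S.dvd_Q₁, hB _ S.dvd_Q₂, hR _ S.dvd_T₁,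
    hR _ S.dvd_T₂, hd, hA]

/-- The infinite product in `alpha` converges. -/
theorem multipliable_alpha : Multipliable fun j : ℕ => (1 + ((2 : ℝ) ^ j)⁻¹)⁻¹ := by
  have hs : Summable fun j : ℕ => ((2 : ℝ) ^ j)⁻¹ := by
    simpa using summable_geometric_two
  have hl : Summable fun j : ℕ => Real.log (1 + ((2 : ℝ) ^ j)⁻¹) :=
    Real.summable_log_one_add_of_summable hs
  refine Real.multipliable_of_summable_log (fun j => by positivity) ?_
  simpa [Real.log_inv] using hl.neg

theorem Data.columnRank_le (S : Data) {r : ℕ}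
    (M : Matrix ((Fin r ⊕ Fin r) ⊕ Fin S.t) ((Fin r ⊕ Fin r) ⊕ Fin S.t) (ZMod 2)) :
    S.columnRank M ≤ S.t + 2 := by
  classical
  set f : Fin S.t → _ → ZMod 2 := fun i x => M x (.inr i)
  set u : _ → ZMod 2 := fun x => ∑ j, M x (.inl (.inl j))
  set w : _ → ZMod 2 := fun x => ∑ j, M x (.inl (.inr j))
  have h : ({u, w} ∪ Set.range f : Set _) = (({u, w} ∪ Finset.univ.image f : Finset _) : Set _) := by
    simp [Set.insert_union]
  have h1 : S.columnRank M ≤ ({u, w} ∪ Finset.univ.image f : Finset _).card := by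
    unfold Data.columnRank
    rw [h]
    exact finrank_span_finset_le_card _
  refine h1.trans ((Finset.card_union_le _ _).trans ?_)
  have h2 : (Finset.univ.image f).card ≤ S.t := by
    simpa using Finset.card_image_le (s := Finset.univ) (f := f)
  have h3 := Finset.card_le_two (a := u) (b := w)
  omega

/-- The minimum defining the corank correction is over a nonempty set. -/
theorem Data.isLeast_delta (S : Data) :
    IsLeast {δ : ℕ | ∃ (r : ℕ) (p : Fin r → ℕ), S.IsPrimeTuple p ∧
      S.columnRank ((primeSymbols p).malt S) + δ = S.t + 2} S.delta := by
  have hD : S.D ≠ 0 := S.squarefree_D.ne_zero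
  have h0 : S.n₀ ≠ 0 := by
    rintro h; have := S.odd_n₀; simp [h] at this
  suffices h : ∃ (r : ℕ) (p : Fin r → ℕ), S.IsPrimeTuple p by
    obtain ⟨r, p, hp⟩ := h
    have hne : {δ : ℕ | ∃ (r : ℕ) (p : Fin r → ℕ), S.IsPrimeTuple p ∧
        S.columnRank ((primeSymbols p).malt S) + δ = S.t + 2}.Nonempty :=
      ⟨_, r, p, hp, Nat.add_sub_of_le (S.columnRank_le _)⟩
    exact ⟨Nat.sInf_mem hne, fun _ h => Nat.sInf_le h⟩
  have : NeZero (8 * S.D) := ⟨by omega⟩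
  have hco8 : IsCoprime S.n₀ (((8 * S.D : ℕ)) : ℤ) := by
    have h2 : IsCoprime S.n₀ 2 := IsCoprime.of_mul_right_left S.coprime_natAbs
    have := IsCoprime.mul_right (h2.pow_right (n := 3)) S.coprime_n₀
    push_cast
    norm_num at this
    exact this
  have hcop : S.n₀.natAbs.Coprime (8 * S.D) := by
    have := Int.isCoprime_iff_gcd_eq_one.1 hco8
    rwa [Int.gcd, Int.natAbs_natCast] at this
  have hu : IsUnit ((S.n₀.natAbs : ℕ) : ZMod (8 * S.D)) := (ZMod.isUnit_iff_coprime _ _).2 hcop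
  obtain ⟨q, hq, hqp, hqe⟩ := Nat.forall_exists_prime_gt_and_eq_mod hu (2 * S.D)
  have hmod : (q : ℤ) ≡ (S.n₀.natAbs : ℤ) [ZMOD 8 * (S.D : ℤ)] := by
    have := (ZMod.natCast_eq_natCast_iff _ _ _).1 hqe
    have := Int.natCast_modEq_iff.2 this
    push_cast at this ⊢
    exact this
  have hs : S.n₀.sign.natAbs = 1 := Int.natAbs_sign_of_ne_zero h0
  have hsu : IsUnit S.n₀.sign := Int.isUnit_iff_natAbs_eq.2 hs
  refine ⟨1, fun _ => q, fun _ => hqp, ?_, ?_, ?_, 1, ?_⟩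
  · simp only [Finset.univ_unique, Finset.prod_const, Finset.card_singleton, pow_one]
    rw [Int.squarefree_natAbs.symm, Int.natAbs_mul, hs, one_mul, Int.natAbs_natCast]
    exact hqp.prime.squarefree
  · simp only [Finset.univ_unique, Finset.prod_const, Finset.card_singleton, pow_one]
    rw [isCoprime_mul_unit_left_left hsu, Int.isCoprime_iff_gcd_eq_one]
    have : q.Coprime (2 * S.D) :=
      (Nat.Prime.coprime_iff_not_dvd hqp).2 fun h => absurd (Nat.le_of_dvd (by omega) h) (by omega)
    simpa [Int.gcd, Int.natAbs_mul] using this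
  · simp only [Finset.univ_unique, Finset.prod_const, Finset.card_singleton, pow_one]
    have hq0 : (0 : ℚ) < q := by exact_mod_cast hqp.pos
    rcases lt_or_gt_of_ne h0 with h | h
    · rw [Int.sign_eq_neg_one_of_neg h]
      have : (S.n₀ : ℚ) < 0 := by exact_mod_cast h
      exact div_pos_of_neg_of_neg (by push_cast; linarith) this
    · rw [Int.sign_eq_one_of_pos h]
      have : (0 : ℚ) < S.n₀ := by exact_mod_cast h
      push_cast
      exact div_pos (by linarith) this
  · simp only [Finset.univ_unique, Finset.prod_const, Finset.card_singleton, pow_one, one_pow,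
      mul_one]
    have := hmod.mul_left S.n₀.sign
    rwa [Int.sign_mul_natAbs] at this

end AltMatrix

/-! Adding one prime enlarges the alternating matrix by two rows and columns, so the corank moves by
-2, 0 or 2. Suppose that the two new functionals restrict to independent uniform functionals on a
radical of dimension k. The corank rises if both restrictions vanish and one further bit is right,
with probability 2^-(2k+1), and falls if they are linearly independent, with probability (1 -
2^-k)(1 - 2^(1-k)) (`frac_up`, `frac_down`). The weights `alpha k` are in detailed balance with
these rates, and an identity of Euler gives them mass 1 on each parity class
(`hasSum_alpha_even_odd`). The chain contracts tail probabilities in a weighted sup norm, so a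
process following it up to geometrically small errors converges (`tendsto_alphaTail`).

The main point is that equidistribution on the radical fails only for exponentially few
configurations (`FormData.negligible_not_good`). If it fails, there are radical vectors (u, v, z)
and (v, v', z'), not both zero, and adding their equations yields b₁u + χv + b₂v' = 0 at every
prime, where b₁, b₂, χ now denote the symbols of b₁, b₂ and -1 (`FormData.BadPair.relation`). A
random symmetric matrix sends ρ independent vectors to prescribed images with probability at most
2^(ρ² - ρm), which cancels the 2^(ρm) choices of the vectors up to a constant; a nontrivial relation
at each of the m primes saves a further factor (3/4)^m (`FormData.frac_config_le`). The hypotheses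
on b₁ and b₂ provide a nontrivial relation in every degenerate case.

To reach this setting, the basis vectors of the first prime are replaced by the two sums over all
primes. The conditions modulo 8D fix the sum of the symbol vectors and the rows of A sum to zero, so
what remains is an unconstrained random form on r - 1 primes with a border of dimension t + 2, whose
entries at a prime are linear in the symbols of that prime (`BitAssignment.configEquiv`,
`BitAssignment.mulForm_spaceEquiv`). Border vectors that pair to zero identically split off and
shift the corank. Dirichlet's theorem provides an n whose primes realise all symbol vectors, and
this identifies the shift with δ (`Data.delta_eq_finrank_borderKer`). -/

namespace AltMatrix
open Module

/-! ### The limiting distribution -/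

/-- The unnormalised weights `2^k ∏_{j=1}^k (2^j - 1)⁻¹`. -/
noncomputable def eulerTerm (k : ℕ) : ℝ :=
  2 ^ k * ∏ j ∈ Finset.Icc 1 k, ((2 : ℝ) ^ j - 1)⁻¹

theorem two_pow_succ_sub_one_pos (k : ℕ) : (0 : ℝ) < 2 ^ (k + 1) - 1 := by
  have := one_lt_pow₀ (one_lt_two (α := ℝ)) (Nat.succ_ne_zero k)
  simp only [Nat.succ_eq_add_one] at this
  linarith

theorem eulerTerm_zero : eulerTerm 0 = 1 := by simp [eulerTerm]

theorem eulerTerm_succ (k : ℕ) :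
    eulerTerm (k + 1) * (2 ^ (k + 1) - 1) = 2 * eulerTerm k := by
  have := (two_pow_succ_sub_one_pos k).ne'
  rw [eulerTerm, Finset.prod_Icc_succ_top (by omega), eulerTerm]
  field_simp
  ring

theorem eulerTerm_pos (k : ℕ) : 0 < eulerTerm k := by
  unfold eulerTerm
  refine mul_pos (by positivity) (Finset.prod_pos fun j hj => ?_)
  obtain ⟨i, rfl⟩ : ∃ i, j = i + 1 := ⟨j - 1, by have := Finset.mem_Icc.1 hj; omega⟩
  exact inv_pos.2 (two_pow_succ_sub_one_pos i)

theorem summable_eulerTerm : Summable eulerTerm := by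
  refine summable_of_ratio_norm_eventually_le (r := 2 / 3) (by norm_num) ?_
  -- The ratio of consecutive terms is `2 / (2 ^ (k + 1) - 1)`. It equals 2 at `k = 0` and is at
  -- most `2 / 3` from `k = 1` on.
  filter_upwards [eventually_ge_atTop 1] with k hk
  have h := eulerTerm_succ k
  have h4 : (4 : ℝ) ≤ 2 ^ (k + 1) := by
    calc (4 : ℝ) = 2 ^ 2 := by norm_num
      _ ≤ 2 ^ (k + 1) := pow_le_pow_right₀ (by norm_num) (by omega)
  have h0 := eulerTerm_pos k
  have h1 := eulerTerm_pos (k + 1)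
  rw [Real.norm_of_nonneg h0.le, Real.norm_of_nonneg h1.le]
  nlinarith

/-- Euler's generating function `∑ eulerTerm k * z^k`. -/
noncomputable def eulerSeries (z : ℝ) : ℝ := ∑' k, eulerTerm k * z ^ k

theorem summable_eulerSeries {z : ℝ} (hz : |z| ≤ 1) : Summable fun k => eulerTerm k * z ^ k := by
  refine Summable.of_norm_bounded summable_eulerTerm fun k => ?_
  rw [norm_mul, Real.norm_of_nonneg (eulerTerm_pos k).le, norm_pow, Real.norm_eq_abs]
  exact mul_le_of_le_one_right (eulerTerm_pos k).le (pow_le_one₀ (abs_nonneg z) hz)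

/-- The recursion `eulerTerm_succ` matches the coefficients of `E(z) - E(z/2)` with those of `z
E(z/2)`. Iterated from `z = 1` the equation produces the infinite product in `alpha`; at `z = -1`
its first factor vanishes. -/
theorem eulerSeries_eq {z : ℝ} (hz : |z| ≤ 1) :
    eulerSeries z = (1 + z) * eulerSeries (z / 2) := by
  have hz2 : |z / 2| ≤ 1 := by rw [abs_div, abs_two]; linarith [abs_nonneg z]
  have h1 := summable_eulerSeries hz
  have h2 := summable_eulerSeries hz2
  have key : eulerSeries z - eulerSeries (z / 2) = z * eulerSeries (z / 2) := by
    rw [eulerSeries, eulerSeries, ← h1.tsum_sub h2, (h1.sub h2).tsum_eq_zero_add, ← tsum_mul_left]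
    simp only [pow_zero, sub_self, zero_add]
    refine tsum_congr fun k => ?_
    have h := eulerTerm_succ k
    have h3 : eulerTerm (k + 1) * z ^ (k + 1) - eulerTerm (k + 1) * (z / 2) ^ (k + 1) =
        eulerTerm (k + 1) * (2 ^ (k + 1) - 1) * (z / 2) ^ (k + 1) := by
      rw [div_pow]; field_simp
    rw [h3, h, pow_succ]; ring
  linarith

theorem eulerSeries_one_eq_prod (n : ℕ) :
    eulerSeries 1 = (∏ j ∈ Finset.range n, (1 + ((2 : ℝ) ^ j)⁻¹)) * eulerSeries ((2 ^ n)⁻¹) := by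
  induction n with
  | zero => simp
  | succ n ih =>
    have h : |((2 : ℝ) ^ n)⁻¹| ≤ 1 := by
      rw [abs_of_nonneg (by positivity)]
      exact inv_le_one_of_one_le₀ (one_le_pow₀ (by norm_num))
    rw [ih, eulerSeries_eq h, Finset.prod_range_succ, pow_succ, mul_inv, mul_assoc]
    rfl

theorem tendsto_eulerSeries : Tendsto (fun n : ℕ => eulerSeries ((2 ^ n)⁻¹)) atTop (𝓝 1) := by
  have hz : Tendsto (fun n : ℕ => ((2 : ℝ) ^ n)⁻¹) atTop (𝓝 0) := by
    simpa using tendsto_pow_atTop_nhds_zero_of_lt_one (r := (2 : ℝ)⁻¹) (by norm_num) (by norm_num)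
  have hb : ∀ n : ℕ, |eulerSeries ((2 ^ n)⁻¹) - 1| ≤ ((2 : ℝ) ^ n)⁻¹ * ∑' k, eulerTerm (k + 1) := by
    intro n
    set z : ℝ := ((2 : ℝ) ^ n)⁻¹ with hzdef
    have hz0 : 0 ≤ z := by positivity
    have hz1 : z ≤ 1 := inv_le_one_of_one_le₀ (one_le_pow₀ (by norm_num))
    have hs := summable_eulerSeries (z := z) (by rwa [abs_of_nonneg hz0])
    have hs1 := (summable_nat_add_iff 1).2 summable_eulerTerm
    rw [eulerSeries, hs.tsum_eq_zero_add, eulerTerm_zero, pow_zero, mul_one, add_sub_cancel_left,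
      ← tsum_mul_left, abs_of_nonneg (tsum_nonneg fun k =>
        mul_nonneg (eulerTerm_pos _).le (pow_nonneg hz0 _))]
    refine Summable.tsum_le_tsum (fun k => ?_) ((summable_nat_add_iff 1).2 hs) (hs1.mul_left z)
    rw [pow_succ, mul_comm z]
    have := pow_le_one₀ hz0 hz1 (n := k)
    have h0 := (eulerTerm_pos (k + 1)).le
    rw [← mul_assoc]
    exact mul_le_mul_of_nonneg_right (mul_le_of_le_one_right h0 this) hz0
  rw [tendsto_iff_norm_sub_tendsto_zero]
  refine squeeze_zero (fun _ => norm_nonneg _) hb ?_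
  simpa using hz.mul_const (∑' k, eulerTerm (k + 1))

theorem eulerSeries_one_mul :
    eulerSeries 1 * (∏' j : ℕ, (1 + ((2 : ℝ) ^ j)⁻¹)⁻¹) = 1 := by
  have h1 := multipliable_alpha.hasProd.tendsto_prod_nat
  have h2 := (h1.const_mul (eulerSeries 1))
  refine tendsto_nhds_unique h2 ?_
  refine tendsto_eulerSeries.congr fun n => ?_
  rw [eulerSeries_one_eq_prod n, mul_comm (Finset.prod _ _), mul_assoc, ← Finset.prod_mul_distrib]
  rw [Finset.prod_congr rfl (g := fun _ => (1 : ℝ)), Finset.prod_const_one, mul_one]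
  intro j _
  exact mul_inv_cancel₀ (by positivity)

theorem eulerSeries_neg_one : eulerSeries (-1) = 0 := by
  rw [eulerSeries_eq (by simp)]; simp

theorem alpha_eq (k : ℕ) :
    alpha k = 2 * (∏' j : ℕ, (1 + ((2 : ℝ) ^ j)⁻¹)⁻¹) * eulerTerm k := by
  rw [alpha, eulerTerm, pow_succ]; ring

theorem alpha_nonneg (k : ℕ) : 0 ≤ alpha k := by
  rw [alpha_eq]
  refine mul_nonneg (mul_nonneg zero_le_two ?_) (eulerTerm_pos k).le
  by_contra h
  have h1 := eulerSeries_one_mul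
  have h2 : 0 ≤ eulerSeries 1 := tsum_nonneg fun k => mul_nonneg (eulerTerm_pos k).le (by simp)
  nlinarith [mul_nonneg h2 (neg_nonneg.2 (not_le.1 h).le)]

/-- The even and the odd part of the series add up to `E(1)`, the reciprocal of the infinite
product, and differ by `E(-1) = 0`. Each is therefore half of `E(1)`, which the factor 2 in
`alpha_eq` compensates. -/
theorem hasSum_alpha_even_odd :
    HasSum (fun h => alpha (2 * h)) 1 ∧ HasSum (fun h => alpha (2 * h + 1)) 1 := by
  set P := ∏' j : ℕ, (1 + ((2 : ℝ) ^ j)⁻¹)⁻¹ with hP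
  have hs := summable_eulerTerm
  have he : Summable fun h => eulerTerm (2 * h) :=
    hs.comp_injective (i := fun h => 2 * h) fun a b h => by simpa using h
  have ho : Summable fun h => eulerTerm (2 * h + 1) :=
    hs.comp_injective (i := fun h => 2 * h + 1) fun a b h => by simpa using h
  have h1 : (∑' h, eulerTerm (2 * h)) + ∑' h, eulerTerm (2 * h + 1) = eulerSeries 1 := by
    rw [tsum_even_add_odd he ho]; simp [eulerSeries]
  have h2 : (∑' h, eulerTerm (2 * h)) - ∑' h, eulerTerm (2 * h + 1) = eulerSeries (-1) := by
    rw [eulerSeries, ← tsum_even_add_odd (f := fun k => eulerTerm k * (-1) ^ k), sub_eq_add_neg,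
      ← tsum_neg]
    · congr 1 <;> refine tsum_congr fun h => ?_ <;> simp [pow_succ, pow_mul]
    · simpa [pow_mul] using he
    · simpa [pow_succ, pow_mul] using ho.neg
  rw [eulerSeries_neg_one] at h2
  have h3 := eulerSeries_one_mul
  rw [← hP] at h3
  have e1 : 2 * P * ∑' h, eulerTerm (2 * h) = 1 := by
    linear_combination h3 + P * h1 + P * h2
  have e2 : 2 * P * ∑' h, eulerTerm (2 * h + 1) = 1 := by
    linear_combination h3 + P * h1 - P * h2
  simp only [alpha_eq, ← hP]
  constructor
  · rw [← e1]; exact he.hasSum.mul_left _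
  · rw [← e2]; exact ho.hasSum.mul_left _

theorem hasSum_alpha {ε : ℕ} (hε : ε ≤ 1) : HasSum (fun h => alpha (2 * h + ε)) 1 := by
  interval_cases ε
  · exact hasSum_alpha_even_odd.1
  · exact hasSum_alpha_even_odd.2

/-! ### The limiting Markov chain -/

/-- The probability of a jump from corank `k` to corank `k + 2`. -/
noncomputable def upRate (k : ℕ) : ℝ := ((2 : ℝ) ^ (2 * k + 1))⁻¹

/-- The probability of a jump from corank `k` to corank `k - 2`. -/
noncomputable def downRate (k : ℕ) : ℝ := (1 - ((2 : ℝ) ^ k)⁻¹) * (1 - 2 * ((2 : ℝ) ^ k)⁻¹)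

theorem alpha_add_two (k : ℕ) :
    alpha (k + 2) * ((2 ^ (k + 1) - 1) * (2 ^ (k + 2) - 1)) = 4 * alpha k := by
  have h1 := eulerTerm_succ k
  have h2 := eulerTerm_succ (k + 1)
  simp only [alpha_eq]
  rw [add_assoc] at h2
  norm_num at h2
  linear_combination (2 * ∏' j : ℕ, (1 + ((2 : ℝ) ^ j)⁻¹)⁻¹) * ((2 ^ (k + 1) - 1) * h2 + 2 * h1)

/-- Reversibility singles out `alpha` as the stationary law: the ratio in `alpha_add_two` is the
quotient of the upward and the downward rate. -/
theorem detailed_balance (k : ℕ) : alpha k * upRate k = alpha (k + 2) * downRate (k + 2) := by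
  have h := alpha_add_two k
  have e : downRate (k + 2) = ((2 ^ (k + 1) - 1) * (2 ^ (k + 2) - 1)) * (upRate k / 4) := by
    rw [upRate, downRate, show 2 * k + 1 = k + k + 1 by ring]
    simp only [pow_succ, pow_add]
    field_simp
    ring
  rw [e, ← mul_assoc, h]
  ring

theorem upRate_nonneg (k : ℕ) : 0 ≤ upRate k := by unfold upRate; positivity

theorem two_pow_inv_add_two (k : ℕ) : ((2 : ℝ) ^ (k + 2))⁻¹ = ((2 : ℝ) ^ k)⁻¹ / 4 := by
  rw [pow_add]; norm_num; ring

theorem two_pow_inv_pos_le_one (k : ℕ) : 0 < ((2 : ℝ) ^ k)⁻¹ ∧ ((2 : ℝ) ^ k)⁻¹ ≤ 1 :=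
  ⟨by positivity, inv_le_one_of_one_le₀ (one_le_pow₀ (by norm_num))⟩

theorem upRate_eq (k : ℕ) : upRate k = ((2 : ℝ) ^ k)⁻¹ ^ 2 / 2 := by
  rw [upRate, pow_succ, pow_mul']; field_simp

theorem downRate_add_two (k : ℕ) :
    downRate (k + 2) = (1 - ((2 : ℝ) ^ k)⁻¹ / 4) * (1 - ((2 : ℝ) ^ k)⁻¹ / 2) := by
  rw [downRate, two_pow_inv_add_two]; ring

/-- Tail probabilities of the limiting distribution on `{k : k ≡ ε mod 2}`. -/
noncomputable def alphaTail (ε h : ℕ) : ℝ := ∑' j, alpha (2 * (j + h) + ε)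

theorem summable_alpha_add {ε : ℕ} (hε : ε ≤ 1) (h : ℕ) :
    Summable fun j => alpha (2 * (j + h) + ε) :=
  (summable_nat_add_iff h).2 (hasSum_alpha hε).summable

theorem alphaTail_zero {ε : ℕ} (hε : ε ≤ 1) : alphaTail ε 0 = 1 := (hasSum_alpha hε).tsum_eq

theorem alphaTail_sub {ε : ℕ} (hε : ε ≤ 1) (h : ℕ) :
    alphaTail ε h - alphaTail ε (h + 1) = alpha (2 * h + ε) := by
  rw [alphaTail, (summable_alpha_add hε h).tsum_eq_zero_add, alphaTail]
  simp only [zero_add]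
  rw [add_sub_assoc, add_eq_left, sub_eq_zero]
  refine tsum_congr fun j => ?_
  congr 1; ring

/-- By `alpha_add_two` the ratio of consecutive terms is at most `4 / 8` from the second step on.
The first ratio can be as large as `4 / 3`, which the constant 3 absorbs. -/
theorem alpha_le_geometric (ε h : ℕ) : alpha (2 * h + ε) ≤ 3 * alpha ε * (1 / 2) ^ h := by
  have step : ∀ h, alpha (2 * (h + 1) + ε) *
      ((2 ^ (2 * h + ε + 1) - 1) * (2 ^ (2 * h + ε + 2) - 1)) = 4 * alpha (2 * h + ε) := by
    intro h
    rw [show 2 * (h + 1) + ε = 2 * h + ε + 2 by ring]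
    exact alpha_add_two _
  have lower : ∀ a b : ℕ, a ≤ b → (2 : ℝ) ^ a ≤ 2 ^ b := fun a b hab =>
    pow_le_pow_right₀ (by norm_num) hab
  have hε := alpha_nonneg ε
  induction h with
  | zero => simp; linarith
  | succ h ih =>
    have hs := step h
    have h1 := alpha_nonneg (2 * (h + 1) + ε)
    rcases h with _ | h
    · have a1 := lower 1 (2 * 0 + ε + 1) (by omega)
      have a2 := lower 2 (2 * 0 + ε + 2) (by omega)
      have : (3 : ℝ) ≤ (2 ^ (2 * 0 + ε + 1) - 1) * (2 ^ (2 * 0 + ε + 2) - 1) := by nlinarith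
      have h2 := mul_le_mul_of_nonneg_left this h1
      rw [hs] at h2
      simp at h2 ⊢
      linarith
    · have a1 := lower 3 (2 * (h + 1) + ε + 1) (by omega)
      have a2 := lower 3 (2 * (h + 1) + ε + 2) (by omega)
      have : (8 : ℝ) ≤ (2 ^ (2 * (h + 1) + ε + 1) - 1) * (2 ^ (2 * (h + 1) + ε + 2) - 1) := by
        nlinarith
      have h2 := mul_le_mul_of_nonneg_left this h1
      rw [hs] at h2
      rw [pow_succ]
      linarith

theorem alphaTail_nonneg (ε h : ℕ) : 0 ≤ alphaTail ε h := tsum_nonneg fun _ => alpha_nonneg _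

theorem alphaTail_le {ε : ℕ} (hε : ε ≤ 1) (h : ℕ) :
    alphaTail ε h ≤ 6 * alpha ε * (1 / 2) ^ h := by
  have hg : HasSum (fun j : ℕ => 3 * alpha ε * (1 / 2) ^ h * (1 / 2 : ℝ) ^ j)
      (3 * alpha ε * (1 / 2) ^ h * 2) := hasSum_geometric_two.mul_left _
  calc alphaTail ε h ≤ 3 * alpha ε * (1 / 2) ^ h * 2 := by
        refine hasSum_le (fun j => ?_) (summable_alpha_add hε h).hasSum hg
        refine (alpha_le_geometric ε (j + h)).trans_eq ?_
        rw [pow_add]; ring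
    _ = _ := by ring

/-- One step of the limiting chain (on `{k : k ≡ ε mod 2}`) acting on tail probabilities. -/
noncomputable def tailStep (ε : ℕ) (g : ℕ → ℝ) (h : ℕ) : ℝ :=
  g (h + 2) + (1 - downRate (2 * h + ε + 2)) * (g (h + 1) - g (h + 2)) +
    upRate (2 * h + ε) * (g h - g (h + 1))

/-- In one step the mass at or above level `h + 1` changes only by the flows between levels `h` and
`h + 1`, and these cancel by `detailed_balance`. -/
theorem tailStep_alphaTail {ε : ℕ} (hε : ε ≤ 1) (h : ℕ) :
    tailStep ε (alphaTail ε) h = alphaTail ε (h + 1) := by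
  rw [tailStep, alphaTail_sub hε h, alphaTail_sub hε (h + 1), mul_comm (upRate _),
    detailed_balance, show 2 * (h + 1) + ε = 2 * h + ε + 2 by ring]
  have := alphaTail_sub hε (h + 1)
  rw [show 2 * (h + 1) + ε = 2 * h + ε + 2 by ring] at this
  linear_combination -this

/-- The limiting chain contracts differences of tail probabilities. -/
theorem abs_tailStep_le {ε : ℕ} {g : ℕ → ℝ} {N : ℝ} (h0 : g 0 = 0)
    (hN : ∀ h, |g h| * (5 / 4) ^ h ≤ N) (h : ℕ) :
    |tailStep ε g h| * (5 / 4) ^ (h + 1) ≤ 37 / 40 * N := by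
  obtain ⟨y0, y1⟩ := two_pow_inv_pos_le_one (2 * h + ε)
  set y := ((2 : ℝ) ^ (2 * h + ε))⁻¹ with hy
  set W : ℝ := (5 / 4) ^ h with hW
  have hW0 : 0 < W := by positivity
  have n0 := hN h
  have n1 := hN (h + 1)
  have n2 := hN (h + 2)
  rw [pow_add, ← hW] at n1 n2
  norm_num at n1 n2
  have hNn : 0 ≤ N := le_trans (by positivity) n0
  have hd : downRate (2 * h + ε + 2) = (1 - y / 4) * (1 - y / 2) := downRate_add_two _
  have hu : upRate (2 * h + ε) = y ^ 2 / 2 := upRate_eq _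
  set d := downRate (2 * h + ε + 2)
  set u := upRate (2 * h + ε)
  -- Up to the weight, the step is a convex combination whose three terms are at most `(1 - d - u)
  -- N`, `(4 / 5) d N` and `(5 / 4) u N`. The rate `37 / 40 = 1 - (1 / 5) (3 / 8)` comes from `h =
  -- 0`, where the last term is absent; `3 / 8` is the value of `d` at `y = 1`.
  have hd38 : 3 / 8 ≤ d := by rw [hd]; nlinarith
  have hu0 : 0 ≤ u := upRate_nonneg _
  have hud : 0 ≤ 1 - d - u := by rw [hd, hu]; nlinarith
  have e : tailStep ε g h = (1 - d - u) * g (h + 1) + d * g (h + 2) + u * g h := by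
    rw [tailStep]; ring
  have b : |tailStep ε g h| ≤ (1 - d - u) * |g (h + 1)| + d * |g (h + 2)| + u * |g h| := by
    rw [e]
    refine (abs_add_three _ _ _).trans ?_
    rw [abs_mul, abs_mul, abs_mul, abs_of_nonneg hud, abs_of_nonneg (by linarith : 0 ≤ d),
      abs_of_nonneg hu0]
  rw [pow_succ, ← hW]
  have b2 : |tailStep ε g h| * (W * (5 / 4)) ≤
      ((1 - d - u) * |g (h + 1)| + d * |g (h + 2)| + u * |g h|) * (W * (5 / 4)) :=
    mul_le_mul_of_nonneg_right b (by positivity)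
  refine b2.trans ?_
  have c1 := mul_le_mul_of_nonneg_left n1 hud
  have c2 := mul_le_mul_of_nonneg_left n2 (by linarith : 0 ≤ d)
  rcases Nat.eq_zero_or_pos h with rfl | hpos
  · rw [h0, abs_zero, mul_zero, add_zero]
    nlinarith
  -- The upward term is now present and its weight grows by `5 / 4`, but `y ≤ 1 / 4` makes `u` small
  -- and `d` large.
  · have c3 := mul_le_mul_of_nonneg_left n0 hu0
    have hy4 : y ≤ 1 / 4 := by
      rw [hy]
      rw [inv_le_comm₀ (by positivity) (by norm_num)]
      calc ((1 : ℝ) / 4)⁻¹ = 2 ^ 2 := by norm_num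
        _ ≤ _ := pow_le_pow_right₀ (by norm_num) (by omega)
    have hd2 : 4 / 5 ≤ d := by rw [hd]; nlinarith
    have hu2 : u ≤ 1 / 32 := by rw [hu]; nlinarith
    have : (1 - d - u) * N + d * N * (4 / 5) + u * N * (5 / 4) ≤ 37 / 40 * N := by nlinarith
    nlinarith

/-- Tail probabilities that evolve by the limiting chain up to a geometrically small error converge
to those of the limiting distribution. -/
theorem tendsto_alphaTail {ε : ℕ} (hε : ε ≤ 1) {G : ℕ → ℕ → ℝ} {C : ℝ} {h₀ : ℕ}
    (hG0 : ∀ m, G m 0 = 1) (hsupp : ∀ m h, m + h₀ < h → G m h = 0)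
    (hstep : ∀ m h, |G (m + 1) (h + 1) - tailStep ε (G m) h| ≤ C * (3 / 4) ^ m) (h : ℕ) :
    Tendsto (fun m => G m h) atTop (𝓝 (alphaTail ε h)) := by
  have hC : 0 ≤ C := by simpa using (abs_nonneg _).trans (hstep 0 0)
  set N₀ : ℝ := (∑ i ∈ Finset.range (h₀ + 1), |G 0 i| * (5 / 4) ^ i) + 6 * alpha ε with hN₀
  set C' : ℝ := C * (5 / 4) ^ (h₀ + 2) with hC'
  have hC'0 : 0 ≤ C' := by positivity
  -- The contraction gives `37 / 40` while the induction aims at `19 / 20`; the gap `1 / 40` times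
  -- `K` has to absorb the new error `C'`.
  set K : ℝ := N₀ + 40 * C' with hK
  have hα := alpha_nonneg ε
  have hN₀0 : 0 ≤ N₀ := by positivity
  have key : ∀ m h, |G m h - alphaTail ε h| * (5 / 4) ^ h ≤ K * (19 / 20) ^ m := by
    intro m
    induction m with
    | zero =>
      intro h
      rw [pow_zero, mul_one]
      have t1 : alphaTail ε h * (5 / 4) ^ h ≤ 6 * alpha ε := by
        calc alphaTail ε h * (5 / 4) ^ h ≤ 6 * alpha ε * (1 / 2) ^ h * (5 / 4) ^ h :=
              mul_le_mul_of_nonneg_right (alphaTail_le hε h) (by positivity)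
          _ = 6 * alpha ε * (5 / 8) ^ h := by rw [mul_assoc, ← mul_pow]; norm_num
          _ ≤ 6 * alpha ε := mul_le_of_le_one_right (by positivity)
              (pow_le_one₀ (by norm_num) (by norm_num))
      have t2 : |G 0 h| * (5 / 4) ^ h ≤ ∑ i ∈ Finset.range (h₀ + 1), |G 0 i| * (5 / 4) ^ i := by
        by_cases hh : h < h₀ + 1
        · exact Finset.single_le_sum (f := fun i => |G 0 i| * (5 / 4) ^ i)
            (fun i _ => by positivity) (Finset.mem_range.2 hh)
        · rw [hsupp 0 h (by omega), abs_zero, zero_mul]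
          positivity
      have t3 := abs_sub (G 0 h) (alphaTail ε h)
      rw [abs_of_nonneg (alphaTail_nonneg ε h)] at t3
      have t4 := mul_le_mul_of_nonneg_right t3 (by positivity : (0 : ℝ) ≤ (5 / 4) ^ h)
      linarith
    | succ m ih =>
      intro h
      rcases h with _ | h
      · rw [hG0, alphaTail_zero hε]
        simp
        positivity
      · have hcon := abs_tailStep_le (ε := ε) (g := fun h => G m h - alphaTail ε h)
          (by simp [hG0, alphaTail_zero hε]) ih h
        have hlin : tailStep ε (fun h => G m h - alphaTail ε h) h =
            tailStep ε (G m) h - alphaTail ε (h + 1) := by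
          rw [← tailStep_alphaTail hε h]; simp only [tailStep]; ring
        rw [hlin] at hcon
        have herr : |G (m + 1) (h + 1) - tailStep ε (G m) h| * (5 / 4) ^ (h + 1) ≤
            C' * (15 / 16) ^ m := by
          -- Within the support the weight is at most `(5 / 4) ^ (m + h₀ + 2)`, so the error decays
          -- like `(3 / 4 · 5 / 4) ^ m = (15 / 16) ^ m`, still faster than `(19 / 20) ^ m`. Beyond
          -- the support both terms vanish.
          by_cases hh : h ≤ m + h₀ + 1
          · calc |G (m + 1) (h + 1) - tailStep ε (G m) h| * (5 / 4) ^ (h + 1)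
                ≤ C * (3 / 4) ^ m * (5 / 4) ^ (m + h₀ + 2) :=
                  mul_le_mul (hstep m h) (pow_le_pow_right₀ (by norm_num) (by omega))
                    (by positivity) (by positivity)
              _ = C' * (15 / 16) ^ m := by
                  rw [show (15 / 16 : ℝ) = 3 / 4 * (5 / 4) by norm_num, mul_pow, hC',
                    add_assoc m, pow_add]
                  ring
          · rw [hsupp _ _ (by omega), tailStep, hsupp m h (by omega), hsupp m (h + 1) (by omega),
              hsupp m (h + 2) (by omega)]
            simp
            positivity
        have htri := abs_sub_le (G (m + 1) (h + 1)) (tailStep ε (G m) h) (alphaTail ε (h + 1))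
        have h5 := mul_le_mul_of_nonneg_right htri (by positivity : (0 : ℝ) ≤ (5 / 4) ^ (h + 1))
        have h6 : C' * (15 / 16) ^ m ≤ C' * (19 / 20) ^ m :=
          mul_le_mul_of_nonneg_left (pow_le_pow_left₀ (by norm_num) (by norm_num) m) hC'0
        have h7 : (0 : ℝ) ≤ (19 / 20) ^ m := by positivity
        rw [pow_succ (19 / 20 : ℝ)]
        nlinarith [mul_nonneg hN₀0 h7]
  rw [tendsto_iff_norm_sub_tendsto_zero]
  refine squeeze_zero (g := fun m => K * (19 / 20) ^ m) (fun _ => norm_nonneg _) (fun m => ?_) ?_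
  · refine le_trans ?_ (key m h)
    exact le_mul_of_one_le_right (abs_nonneg _) (one_le_pow₀ (by norm_num))
  · simpa using (tendsto_pow_atTop_nhds_zero_of_lt_one (r := (19 / 20 : ℝ)) (by norm_num)
      (by norm_num)).const_mul K


/-! ### Alternating forms over `𝔽₂` -/

section Forms

variable {V W : Type*} [AddCommGroup V] [Module (ZMod 2) V] [AddCommGroup W] [Module (ZMod 2) W]

/-- The dimension of the radical of a bilinear form. -/
noncomputable def radDim (ω : V →ₗ[ZMod 2] V →ₗ[ZMod 2] ZMod 2) : ℕ :=
  finrank (ZMod 2) (LinearMap.ker ω)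

theorem radDim_congr (e : V ≃ₗ[ZMod 2] W) {ω : V →ₗ[ZMod 2] V →ₗ[ZMod 2] ZMod 2}
    {ω' : W →ₗ[ZMod 2] W →ₗ[ZMod 2] ZMod 2} (h : ∀ x y, ω' (e x) (e y) = ω x y) :
    radDim ω = radDim ω' := by
  have hk : LinearMap.ker ω = (LinearMap.ker ω').comap e.toLinearMap := by
    ext x
    simp only [LinearMap.mem_ker, Submodule.mem_comap, LinearEquiv.coe_coe]
    constructor
    · intro hx
      ext y
      obtain ⟨y, rfl⟩ := e.surjective y
      rw [h, hx]; rfl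
    · intro hx
      ext y
      rw [← h, hx]; rfl
  rw [radDim, radDim, hk]
  exact LinearEquiv.finrank_eq (e.submoduleMap _ |>.trans
    (LinearEquiv.ofEq _ _ (Submodule.map_comap_eq_of_surjective e.surjective _)))

theorem alt_symm {ω : V →ₗ[ZMod 2] V →ₗ[ZMod 2] ZMod 2} (h : ∀ x, ω x x = 0) (x y : V) :
    ω x y = ω y x := by
  have := h (x + y)
  simp only [map_add, LinearMap.add_apply, h, zero_add, add_zero] at this
  exact (CharTwo.add_eq_zero.1 this).symm

/-- The extension of a form `ω` on `V` to `V × 𝔽₂` in which the new basis vector pairs with `V`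
through `f`. -/
noncomputable def extendForm (ω : V →ₗ[ZMod 2] V →ₗ[ZMod 2] ZMod 2) (f : V →ₗ[ZMod 2] ZMod 2) :
    (V × ZMod 2) →ₗ[ZMod 2] (V × ZMod 2) →ₗ[ZMod 2] ZMod 2 :=
  LinearMap.mk₂ (ZMod 2) (fun p q => ω p.1 q.1 + p.2 * f q.1 + q.2 * f p.1)
    (fun p p' q => by simp; ring) (fun c p q => by simp; ring)
    (fun p q q' => by simp; ring) (fun c p q => by simp; ring)

@[simp] theorem extendForm_apply (ω : V →ₗ[ZMod 2] V →ₗ[ZMod 2] ZMod 2)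
    (f : V →ₗ[ZMod 2] ZMod 2) (p q : V × ZMod 2) :
    extendForm ω f p q = ω p.1 q.1 + p.2 * f q.1 + q.2 * f p.1 := rfl

theorem extendForm_self {ω : V →ₗ[ZMod 2] V →ₗ[ZMod 2] ZMod 2} (hω : ∀ x, ω x x = 0)
    (f : V →ₗ[ZMod 2] ZMod 2) (p : V × ZMod 2) : extendForm ω f p p = 0 := by
  simp [hω, CharTwo.add_self_eq_zero]

theorem mem_ker_extendForm {ω : V →ₗ[ZMod 2] V →ₗ[ZMod 2] ZMod 2} {f : V →ₗ[ZMod 2] ZMod 2}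
    {p : V × ZMod 2} :
    p ∈ LinearMap.ker (extendForm ω f) ↔ ω p.1 + p.2 • f = 0 ∧ f p.1 = 0 := by
  rw [LinearMap.mem_ker]
  constructor
  · intro h
    constructor
    · ext v
      simpa using LinearMap.congr_fun h (v, 0)
    · simpa using LinearMap.congr_fun h (0, 1)
  · rintro ⟨h1, h2⟩
    ext q
    · simpa [h2] using LinearMap.congr_fun h1 q
    · simp [h2]

/-- By symmetry the range of `ω` lies in the annihilator of its kernel, and by rank–nullity the two
have the same dimension. -/
theorem mem_range_of_vanish_on_ker [FiniteDimensional (ZMod 2) V] {ω : V →ₗ[ZMod 2] V →ₗ[ZMod 2] ZMod 2} (hω : ∀ x, ω x x = 0)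
    {f : V →ₗ[ZMod 2] ZMod 2} (hf : ∀ x ∈ LinearMap.ker ω, f x = 0) : ∃ v, ω v = f := by
  have hle : LinearMap.range ω ≤ (LinearMap.ker ω).dualAnnihilator := by
    rintro _ ⟨v, rfl⟩
    rw [Submodule.mem_dualAnnihilator]
    intro x hx
    rw [alt_symm hω, LinearMap.mem_ker.1 hx]; rfl
  have hdim : finrank (ZMod 2) (LinearMap.range ω) =
      finrank (ZMod 2) (LinearMap.ker ω).dualAnnihilator := by
    have h1 := LinearMap.finrank_range_add_finrank_ker ω
    have h2 := Subspace.finrank_add_finrank_dualAnnihilator_eq (LinearMap.ker ω)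
    omega
  have := Submodule.eq_of_le_of_finrank_eq hle hdim
  have hmem : f ∈ (LinearMap.ker ω).dualAnnihilator := (Submodule.mem_dualAnnihilator _).2 hf
  rwa [← this] at hmem

/-- If `f` is nonzero on the radical, the radical of the extension is the kernel of `f` on it. -/
theorem ker_extendForm_of_ne {ω : V →ₗ[ZMod 2] V →ₗ[ZMod 2] ZMod 2} (hω : ∀ x, ω x x = 0)
    {f : V →ₗ[ZMod 2] ZMod 2} (hf : ∃ x ∈ LinearMap.ker ω, f x ≠ 0) :
    LinearMap.ker (extendForm ω f) =
      (LinearMap.ker ω ⊓ LinearMap.ker f).map (LinearMap.inl (ZMod 2) V (ZMod 2)) := by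
  ext ⟨v, s⟩
  rw [mem_ker_extendForm, Submodule.mem_map]
  constructor
  · rintro ⟨h1, h2⟩
    obtain ⟨x, hx, hfx⟩ := hf
    have hs : s = 0 := by
      have := LinearMap.congr_fun h1 x
      simp only [LinearMap.add_apply, LinearMap.smul_apply, LinearMap.zero_apply, smul_eq_mul] at this
      rw [alt_symm hω, LinearMap.mem_ker.1 hx, LinearMap.zero_apply, zero_add] at this
      exact (mul_eq_zero.1 this).resolve_right hfx
    subst hs
    exact ⟨v, ⟨by simpa using h1, h2⟩, rfl⟩
  · rintro ⟨v', ⟨h1, h2⟩, h⟩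
    obtain ⟨rfl, rfl⟩ := Prod.mk.inj h
    exact ⟨by simpa using h1, h2⟩

theorem radDim_extendForm_of_ne [FiniteDimensional (ZMod 2) V] {ω : V →ₗ[ZMod 2] V →ₗ[ZMod 2] ZMod 2} (hω : ∀ x, ω x x = 0)
    {f : V →ₗ[ZMod 2] ZMod 2} (hf : ∃ x ∈ LinearMap.ker ω, f x ≠ 0) :
    radDim (extendForm ω f) + 1 = radDim ω := by
  rw [radDim, radDim, ker_extendForm_of_ne hω hf,
    LinearEquiv.finrank_eq (Submodule.equivMapOfInjective _ LinearMap.inl_injective _).symm]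
  set g := f.domRestrict (LinearMap.ker ω) with hg
  have hgs : Function.Surjective g := by
    refine LinearMap.surjective ?_
    obtain ⟨x, hx, hfx⟩ := hf
    exact fun h => hfx (LinearMap.congr_fun h ⟨x, hx⟩)
  have h1 := LinearMap.finrank_range_add_finrank_ker g
  rw [LinearMap.range_eq_top.2 hgs, finrank_top, finrank_self] at h1
  have h2 : (LinearMap.ker g).map (LinearMap.ker ω).subtype = LinearMap.ker ω ⊓ LinearMap.ker f := by
    ext x; simp [hg, and_comm]
  rw [← h2, Submodule.finrank_map_subtype_eq]
  omega

/-- If `f = ω v₀`, the radical of the extension is spanned by the radical and `(v₀, 1)`. -/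
theorem mem_ker_extendForm_of_eq {ω : V →ₗ[ZMod 2] V →ₗ[ZMod 2] ZMod 2} (hω : ∀ x, ω x x = 0)
    {v₀ : V} {p : V × ZMod 2} :
    p ∈ LinearMap.ker (extendForm ω (ω v₀)) ↔ p.1 + p.2 • v₀ ∈ LinearMap.ker ω := by
  rw [mem_ker_extendForm, LinearMap.mem_ker, map_add, map_smul]
  refine ⟨fun h => h.1, fun h => ⟨h, ?_⟩⟩
  have h2 := LinearMap.congr_fun h v₀
  simpa [hω, alt_symm hω v₀ p.1] using h2

theorem radDim_extendForm_of_eq [FiniteDimensional (ZMod 2) V] {ω : V →ₗ[ZMod 2] V →ₗ[ZMod 2] ZMod 2} (hω : ∀ x, ω x x = 0)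
    (v₀ : V) : radDim (extendForm ω (ω v₀)) = radDim ω + 1 := by
  let ψ : (LinearMap.ker ω × ZMod 2) →ₗ[ZMod 2] V × ZMod 2 :=
    LinearMap.prod ((LinearMap.ker ω).subtype.comp (LinearMap.fst _ _ _) +
      (LinearMap.toSpanSingleton (ZMod 2) V v₀).comp (LinearMap.snd _ _ _)) (LinearMap.snd _ _ _)
  have hψ : Function.Injective ψ := by
    rintro ⟨x, s⟩ ⟨y, t⟩ h
    obtain ⟨h1, h2⟩ := Prod.mk.inj h
    simp at h1 h2
    subst h2
    simpa using h1
  have hr : LinearMap.range ψ = LinearMap.ker (extendForm ω (ω v₀)) := by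
    ext ⟨v, s⟩
    rw [mem_ker_extendForm_of_eq hω]
    constructor
    · rintro ⟨⟨x, t⟩, h⟩
      obtain ⟨rfl, rfl⟩ := Prod.mk.inj h
      simp only [LinearMap.add_apply, LinearMap.comp_apply, LinearMap.fst_apply,
        LinearMap.snd_apply, Submodule.subtype_apply, LinearMap.toSpanSingleton_apply, add_assoc]
      rw [← two_smul (ZMod 2) (t • v₀), show (2 : ZMod 2) = 0 from rfl, zero_smul, add_zero]
      exact x.2
    · intro h
      refine ⟨(⟨_, h⟩, s), ?_⟩
      refine Prod.ext ?_ rfl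
      show v + s • v₀ + s • v₀ = v
      rw [add_assoc, ← two_smul (ZMod 2) (s • v₀), show (2 : ZMod 2) = 0 from rfl, zero_smul,
        add_zero]
  rw [radDim, radDim, ← hr, LinearMap.finrank_range_of_inj hψ, finrank_prod, finrank_self]

theorem radDim_extendForm_of_vanish [FiniteDimensional (ZMod 2) V] {ω : V →ₗ[ZMod 2] V →ₗ[ZMod 2] ZMod 2} (hω : ∀ x, ω x x = 0)
    {f : V →ₗ[ZMod 2] ZMod 2} (hf : ∀ x ∈ LinearMap.ker ω, f x = 0) :
    radDim (extendForm ω f) = radDim ω + 1 := by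
  obtain ⟨v₀, rfl⟩ := mem_range_of_vanish_on_ker hω hf
  exact radDim_extendForm_of_eq hω v₀

/-- The functional on `V × 𝔽₂` which is `g` on `V` and sends the new basis vector to `a`. -/
noncomputable def extendFun (g : V →ₗ[ZMod 2] ZMod 2) (a : ZMod 2) : V × ZMod 2 →ₗ[ZMod 2] ZMod 2 :=
  g.coprod (LinearMap.toSpanSingleton (ZMod 2) (ZMod 2) a)

@[simp] theorem extendFun_apply (g : V →ₗ[ZMod 2] ZMod 2) (a : ZMod 2) (p : V × ZMod 2) :
    extendFun g a p = g p.1 + p.2 * a := by simp [extendFun]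

/-- Extension of a form by two further basis vectors. -/
noncomputable def extendForm₂ (ω : V →ₗ[ZMod 2] V →ₗ[ZMod 2] ZMod 2) (f g : V →ₗ[ZMod 2] ZMod 2)
    (a : ZMod 2) :
    ((V × ZMod 2) × ZMod 2) →ₗ[ZMod 2] ((V × ZMod 2) × ZMod 2) →ₗ[ZMod 2] ZMod 2 :=
  extendForm (extendForm ω f) (extendFun g a)


theorem radDim_extendForm_parity [FiniteDimensional (ZMod 2) V]
    {ω : V →ₗ[ZMod 2] V →ₗ[ZMod 2] ZMod 2} (hω : ∀ x, ω x x = 0) (f : V →ₗ[ZMod 2] ZMod 2) :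
    radDim (extendForm ω f) % 2 = (radDim ω + 1) % 2 := by
  by_cases hf : ∀ x ∈ LinearMap.ker ω, f x = 0
  · rw [radDim_extendForm_of_vanish hω hf]
  · push Not at hf
    have := radDim_extendForm_of_ne hω hf
    omega

/-- An alternating form has even rank. -/
theorem radDim_mod_two [FiniteDimensional (ZMod 2) V]
    {ω : V →ₗ[ZMod 2] V →ₗ[ZMod 2] ZMod 2} (hω : ∀ x, ω x x = 0) :
    radDim ω % 2 = finrank (ZMod 2) V % 2 := by
  have key : ∀ (n : ℕ) (ω : (Fin n → ZMod 2) →ₗ[ZMod 2] (Fin n → ZMod 2) →ₗ[ZMod 2] ZMod 2),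
      (∀ x, ω x x = 0) → radDim ω % 2 = n % 2 := by
    intro n
    induction n with
    | zero =>
      intro ω _
      have : radDim ω ≤ 0 := (Submodule.finrank_le _).trans (by simp)
      omega
    | succ n ih =>
      intro ω hω
      -- Splitting off a coordinate presents the form as an extension by one vector, which moves the
      -- radical dimension by exactly one up or down.
      let e : ((Fin n → ZMod 2) × ZMod 2) ≃ₗ[ZMod 2] (Fin (n + 1) → ZMod 2) :=
        (LinearEquiv.prodComm _ _ _).trans (Fin.consLinearEquiv (ZMod 2) (fun _ => ZMod 2))
      let i : (Fin n → ZMod 2) →ₗ[ZMod 2] (Fin (n + 1) → ZMod 2) :=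
        e.toLinearMap.comp (LinearMap.inl _ _ _)
      let v : Fin (n + 1) → ZMod 2 := e (0, 1)
      let ω' := ω.compl₁₂ i i
      have hω' : ∀ x, ω' x x = 0 := fun x => hω _
      have h : ∀ x y, ω (e x) (e y) = extendForm ω' ((ω v).comp i) x y := by
        have he : ∀ x, e x = i x.1 + x.2 • v := by
          rintro ⟨x, s⟩
          show e (x, s) = e (x, 0) + s • e (0, 1)
          rw [← map_smul, ← map_add]; simp
        intro x y
        rw [he, he]
        simp only [map_add, map_smul, LinearMap.add_apply, LinearMap.smul_apply, smul_eq_mul,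
          extendForm_apply, LinearMap.comp_apply, hω, alt_symm hω (i x.1) v]
        simp only [ω', LinearMap.compl₁₂_apply]
        ring
      rw [← radDim_congr e h, radDim_extendForm_parity hω']
      have := ih ω' hω'
      omega
  let e := (finBasis (ZMod 2) V).equivFun
  rw [← key _ (ω.compl₁₂ e.symm.toLinearMap e.symm.toLinearMap) (fun x => hω _),
    radDim_congr e (ω := ω)]
  intro x y
  simp

/-! ### Extension by two basis vectors -/

section TwoStep

variable [FiniteDimensional (ZMod 2) V] {ω : V →ₗ[ZMod 2] V →ₗ[ZMod 2] ZMod 2}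

theorem zmod_two_eq_one {a : ZMod 2} (h : a ≠ 0) : a = 1 := by
  revert a; decide

/-- With `f = ω v₀` the first extension adds `(v₀, 1)` to the radical. The second functional takes
the value `g v₀ + a` on it, so `a = g v₀` means a further gain and the other bit means a loss. -/
theorem radDim_extendForm₂_of_vanish (hω : ∀ x, ω x x = 0) {f g : V →ₗ[ZMod 2] ZMod 2}
    (hf : ∀ x ∈ LinearMap.ker ω, f x = 0) (hg : ∀ x ∈ LinearMap.ker ω, g x = 0) :
    ∃ a₀, ∀ a, radDim (extendForm₂ ω f g a) = if a = a₀ then radDim ω + 2 else radDim ω := by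
  obtain ⟨v₀, rfl⟩ := mem_range_of_vanish_on_ker hω hf
  have h1 := radDim_extendForm_of_eq hω v₀
  have hω' := extendForm_self hω (ω v₀)
  refine ⟨g v₀, fun a => ?_⟩
  split_ifs with h
  · rw [extendForm₂, radDim_extendForm_of_vanish hω', h1]
    intro p hp
    rw [mem_ker_extendForm_of_eq hω] at hp
    have := hg _ hp
    simpa [h] using this
  · have := radDim_extendForm_of_ne hω' (f := extendFun g a) ⟨(v₀, 1), ?_, ?_⟩
    · rw [extendForm₂]; omega
    · rw [mem_ker_extendForm_of_eq hω]
      simp [← two_smul (ZMod 2) v₀, show (2 : ZMod 2) = 0 from rfl]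
    · simp only [extendFun_apply, one_mul]
      rw [Ne, CharTwo.add_eq_zero]
      exact fun h' => h h'.symm

theorem radDim_extendForm₂_of_vanish_left (hω : ∀ x, ω x x = 0) {f g : V →ₗ[ZMod 2] ZMod 2}
    (hf : ∀ x ∈ LinearMap.ker ω, f x = 0) (hg : ∃ x ∈ LinearMap.ker ω, g x ≠ 0) (a : ZMod 2) :
    radDim (extendForm₂ ω f g a) = radDim ω := by
  have h1 := radDim_extendForm_of_vanish hω hf
  obtain ⟨x, hx, hgx⟩ := hg
  have := radDim_extendForm_of_ne (extendForm_self hω f) (f := extendFun g a) ⟨(x, 0), ?_, ?_⟩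
  · rw [extendForm₂]; omega
  · rw [mem_ker_extendForm]; simpa [hf x hx] using hx
  · simpa using hgx

theorem radDim_extendForm₂_of_dep (hω : ∀ x, ω x x = 0) {f g : V →ₗ[ZMod 2] ZMod 2}
    (hf : ∃ x ∈ LinearMap.ker ω, f x ≠ 0) (hg : ∀ x ∈ LinearMap.ker ω, f x = 0 → g x = 0)
    (a : ZMod 2) : radDim (extendForm₂ ω f g a) = radDim ω := by
  have h1 := radDim_extendForm_of_ne hω hf
  rw [extendForm₂, radDim_extendForm_of_vanish (extendForm_self hω f), h1]
  intro p hp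
  rw [ker_extendForm_of_ne hω hf] at hp
  obtain ⟨x, ⟨hx, hfx⟩, rfl⟩ := hp
  simpa using hg x hx hfx

theorem radDim_extendForm₂_of_indep (hω : ∀ x, ω x x = 0) {f g : V →ₗ[ZMod 2] ZMod 2}
    (hf : ∃ x ∈ LinearMap.ker ω, f x ≠ 0) (hg : ∃ x ∈ LinearMap.ker ω, f x = 0 ∧ g x ≠ 0)
    (a : ZMod 2) : radDim (extendForm₂ ω f g a) + 2 = radDim ω := by
  have h1 := radDim_extendForm_of_ne hω hf
  obtain ⟨x, hx, hfx, hgx⟩ := hg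
  have h2 := radDim_extendForm_of_ne (extendForm_self hω f) (f := extendFun g a) ⟨(x, 0), ?_, ?_⟩
  · rw [extendForm₂]; omega
  · rw [ker_extendForm_of_ne hω hf]; exact ⟨x, ⟨hx, hfx⟩, rfl⟩
  · simpa using hgx

theorem radDim_extendForm₂_le (hω : ∀ x, ω x x = 0) (f g : V →ₗ[ZMod 2] ZMod 2) (a : ZMod 2) :
    radDim (extendForm₂ ω f g a) ≤ radDim ω + 2 ∧ radDim ω ≤ radDim (extendForm₂ ω f g a) + 2 := by
  have step : ∀ {V : Type _} [AddCommGroup V] [Module (ZMod 2) V] [FiniteDimensional (ZMod 2) V]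
      {ω : V →ₗ[ZMod 2] V →ₗ[ZMod 2] ZMod 2} (_ : ∀ x, ω x x = 0) (f : V →ₗ[ZMod 2] ZMod 2),
      radDim (extendForm ω f) ≤ radDim ω + 1 ∧ radDim ω ≤ radDim (extendForm ω f) + 1 := by
    intro V _ _ _ ω hω f
    by_cases hf : ∀ x ∈ LinearMap.ker ω, f x = 0
    · have := radDim_extendForm_of_vanish hω hf
      omega
    · push Not at hf
      have := radDim_extendForm_of_ne hω hf
      omega
  have h1 := step hω f
  have h2 := step (extendForm_self hω f) (extendFun g a)
  rw [extendForm₂]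
  omega

theorem radDim_extendForm₂_parity (hω : ∀ x, ω x x = 0) (f g : V →ₗ[ZMod 2] ZMod 2) (a : ZMod 2) :
    radDim (extendForm₂ ω f g a) % 2 = radDim ω % 2 := by
  have h1 := radDim_extendForm_parity hω f
  have h2 := radDim_extendForm_parity (extendForm_self hω f) (extendFun g a)
  rw [extendForm₂]
  omega

/-- The corank drops by two exactly if the new functionals are independent on the radical. -/
theorem radDim_extendForm₂_add_two_eq_iff (hω : ∀ x, ω x x = 0) {f g : V →ₗ[ZMod 2] ZMod 2}
    {a : ZMod 2} : radDim (extendForm₂ ω f g a) + 2 = radDim ω ↔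
      f.domRestrict (LinearMap.ker ω) ≠ 0 ∧ g.domRestrict (LinearMap.ker ω) ≠ 0 ∧
        f.domRestrict (LinearMap.ker ω) ≠ g.domRestrict (LinearMap.ker ω) := by
  have ne : ∀ h : V →ₗ[ZMod 2] ZMod 2, h.domRestrict (LinearMap.ker ω) ≠ 0 ↔
      ∃ x ∈ LinearMap.ker ω, h x ≠ 0 := by
    intro h
    rw [Ne, LinearMap.ext_iff, not_forall]
    simp
  by_cases hf : ∃ x ∈ LinearMap.ker ω, f x ≠ 0
  · by_cases hg : ∃ x ∈ LinearMap.ker ω, f x = 0 ∧ g x ≠ 0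
    · refine ⟨fun _ => ⟨(ne f).2 hf, ?_, ?_⟩, fun _ => radDim_extendForm₂_of_indep hω hf hg a⟩
      · obtain ⟨x, hx, -, h⟩ := hg
        exact (ne g).2 ⟨x, hx, h⟩
      · obtain ⟨x, hx, h0, h⟩ := hg
        intro he
        have := LinearMap.congr_fun he ⟨x, hx⟩
        exact h (by simpa [h0] using this.symm)
    · push Not at hg
      have h1 := radDim_extendForm₂_of_dep hω hf hg a
      -- A functional that vanishes wherever `f` does is a multiple of `f`; over `𝔽₂` it is 0 or `f`
      -- on the radical, and both are excluded.
      refine ⟨fun h => by omega, fun ⟨h2, h3, h4⟩ => ?_⟩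
      exfalso
      obtain ⟨y, hy, hgy⟩ := (ne g).1 h3
      have hfy : f y ≠ 0 := fun h => hgy (hg y hy h)
      apply h4
      ext ⟨x, hx⟩
      show f x = g x
      by_cases hfx : f x = 0
      · rw [hfx, hg x hx hfx]
      · have h5 := hg (x + y) (Submodule.add_mem _ hx hy)
          (by rw [map_add, zmod_two_eq_one hfx, zmod_two_eq_one hfy]; rfl)
        rw [map_add, CharTwo.add_eq_zero] at h5
        rw [h5, zmod_two_eq_one hfx, zmod_two_eq_one hgy]
  · have hf' : f.domRestrict (LinearMap.ker ω) = 0 := by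
      by_contra h; exact hf ((ne f).1 h)
    push Not at hf
    refine ⟨fun h => ?_, fun h => absurd hf' h.1⟩
    exfalso
    by_cases hg : ∀ x ∈ LinearMap.ker ω, g x = 0
    · obtain ⟨a₀, ha⟩ := radDim_extendForm₂_of_vanish hω hf hg
      have := ha a
      split_ifs at this <;> omega
    · push Not at hg
      have := radDim_extendForm₂_of_vanish_left hω hf hg a
      omega

/-- The corank grows by two exactly if the new functionals vanish on the radical and one bit has
the right value. -/
theorem radDim_extendForm₂_eq_add_two_iff (hω : ∀ x, ω x x = 0) (f g : V →ₗ[ZMod 2] ZMod 2) :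
    ∃ a₀, ∀ a, radDim (extendForm₂ ω f g a) = radDim ω + 2 ↔
      (f.domRestrict (LinearMap.ker ω) = 0 ∧ g.domRestrict (LinearMap.ker ω) = 0) ∧ a = a₀ := by
  have eq : ∀ h : V →ₗ[ZMod 2] ZMod 2, h.domRestrict (LinearMap.ker ω) = 0 ↔
      ∀ x ∈ LinearMap.ker ω, h x = 0 := by
    intro h
    rw [LinearMap.ext_iff]
    simp
  rw [eq, eq]
  by_cases hf : ∀ x ∈ LinearMap.ker ω, f x = 0
  · by_cases hg : ∀ x ∈ LinearMap.ker ω, g x = 0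
    · obtain ⟨a₀, ha⟩ := radDim_extendForm₂_of_vanish hω hf hg
      refine ⟨a₀, fun a => ?_⟩
      rw [ha]
      split_ifs with h
      · exact ⟨fun _ => ⟨⟨hf, hg⟩, h⟩, fun _ => rfl⟩
      · exact ⟨fun h => by omega, fun h' => absurd h'.2 h⟩
    · refine ⟨0, fun a => ⟨fun h => ?_, fun h => absurd h.1.2 hg⟩⟩
      push Not at hg
      have := radDim_extendForm₂_of_vanish_left hω hf hg a
      omega
  · refine ⟨0, fun a => ⟨fun h => ?_, fun h => absurd h.1.1 hf⟩⟩
    push Not at hf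
    have h1 := radDim_extendForm_of_ne hω hf
    have h2 := radDim_extendForm_parity (extendForm_self hω f) (extendFun g a)
    by_cases hg : ∀ x ∈ LinearMap.ker (extendForm ω f), extendFun g a x = 0
    · have := radDim_extendForm_of_vanish (extendForm_self hω f) hg
      rw [extendForm₂] at h
      omega
    · push Not at hg
      have := radDim_extendForm_of_ne (extendForm_self hω f) hg
      rw [extendForm₂] at h
      omega

end TwoStep

end Forms

/-! ### Proportions -/

/-- The proportion of elements of a finite type satisfying a predicate. -/
noncomputable def frac {α : Type*} (P : α → Prop) : ℝ :=
  (Nat.card {a // P a} : ℝ) / Nat.card α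

section Frac

variable {α β : Type*}

theorem frac_eq_sum [Fintype α] (P : α → Prop) [DecidablePred P] :
    frac P = (∑ a, if P a then (1 : ℝ) else 0) / Nat.card α := by
  rw [frac, Nat.card_eq_fintype_card, Fintype.card_subtype, Finset.sum_boole]

theorem frac_equiv (e : α ≃ β) (P : β → Prop) : frac (fun a => P (e a)) = frac P := by
  rw [frac, frac, Nat.card_congr e,
    Nat.card_congr (e.subtypeEquiv (p := fun a => P (e a)) (q := P) fun _ => Iff.rfl)]

theorem frac_nonneg (P : α → Prop) : 0 ≤ frac P := by unfold frac; positivity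

theorem frac_le_of_imp [Finite α] {P Q : α → Prop} (h : ∀ a, P a → Q a) : frac P ≤ frac Q := by
  unfold frac
  gcongr
  exact Nat.card_le_card_of_injective (Subtype.map id h) (Subtype.map_injective _ fun _ _ h => h)

theorem frac_congr {P Q : α → Prop} (h : ∀ a, P a ↔ Q a) : frac P = frac Q := by
  rw [funext fun a => propext (h a)]

theorem frac_of_forall [Finite α] [Nonempty α] {P : α → Prop} (h : ∀ a, P a) : frac P = 1 := by
  rw [frac, Nat.card_congr (Equiv.subtypeUnivEquiv h)]
  exact div_self (by exact_mod_cast Nat.card_pos.ne')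

theorem frac_of_forall_not {P : α → Prop} (h : ∀ a, ¬ P a) : frac P = 0 := by
  have : IsEmpty {a // P a} := ⟨fun a => h a a.2⟩
  simp [frac]

theorem frac_le_one [Finite α] (P : α → Prop) : frac P ≤ 1 := by
  unfold frac
  refine div_le_one_of_le₀ ?_ (by positivity)
  exact_mod_cast Nat.card_le_card_of_injective _ (Subtype.val_injective (p := P))

theorem frac_not [Finite α] [Nonempty α] (P : α → Prop) : frac (fun a => ¬ P a) = 1 - frac P := by
  classical
  have : Fintype α := Fintype.ofFinite α
  have h0 : (Nat.card α : ℝ) ≠ 0 := by exact_mod_cast Nat.card_pos.ne'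
  rw [frac_eq_sum, frac_eq_sum, eq_sub_iff_add_eq, ← add_div, ← Finset.sum_add_distrib,
    div_eq_one_iff_eq h0, Finset.sum_congr rfl (g := fun _ => (1 : ℝ)) (fun a _ => by
      by_cases h : P a <;> simp [h])]
  simp

theorem frac_or_le [Finite α] (P Q : α → Prop) : frac (fun a => P a ∨ Q a) ≤ frac P + frac Q := by
  classical
  have : Fintype α := Fintype.ofFinite α
  rw [frac_eq_sum, frac_eq_sum, frac_eq_sum, ← add_div, ← Finset.sum_add_distrib]
  gcongr with a
  by_cases h1 : P a <;> by_cases h2 : Q a <;> simp [h1, h2]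

theorem frac_prod [Fintype α] [Finite β] (P : α × β → Prop) :
    frac P = (∑ a, frac fun b => P (a, b)) / Nat.card α := by
  classical
  have : Fintype β := Fintype.ofFinite β
  rw [frac_eq_sum, Fintype.sum_prod_type, Nat.card_prod]
  push_cast
  simp only [frac_eq_sum, ← Finset.sum_div]
  rw [div_div, mul_comm]

theorem frac_fst [Finite α] [Finite β] [Nonempty β] (P : α → Prop) :
    frac (fun p : α × β => P p.1) = frac P := by
  classical
  have : Fintype α := Fintype.ofFinite α
  rw [frac_prod, frac_eq_sum]
  congr 1
  refine Finset.sum_congr rfl fun a _ => ?_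
  by_cases h : P a
  · simp only [h, if_true]; exact frac_of_forall fun _ => trivial
  · simp only [h, if_false]; exact frac_of_forall_not fun _ => id

/-- All fibres are cosets of the kernel, so the uniform measure pushes forward to the uniform
measure. This is how probabilities are transferred to the dual of the radical. -/
theorem frac_of_surjective {G H : Type*} [AddCommGroup G] [AddCommGroup H] [Finite G]
    (φ : G →+ H) (hφ : Function.Surjective φ) (P : H → Prop) :
    frac (fun g => P (φ g)) = frac P := by
  classical
  have : Finite H := Finite.of_surjective φ hφ
  have : Fintype G := Fintype.ofFinite G
  have : Fintype H := Fintype.ofFinite H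
  have hf : ∀ y, ({g | φ g = y} : Finset G).card = ({g | φ g = 0} : Finset G).card := fun y =>
    AddMonoidHom.card_fiber_eq_of_mem_range φ (hφ y) (hφ 0)
  have hfib : ∀ F : H → ℝ, ∑ g, F (φ g) = ({g | φ g = 0} : Finset G).card * ∑ y, F y := by
    intro F
    rw [← Finset.sum_fiberwise (s := Finset.univ) (g := φ), Finset.mul_sum]
    refine Finset.sum_congr rfl fun y _ => ?_
    rw [Finset.sum_congr rfl (g := fun _ => F y) (fun g hg => by rw [(Finset.mem_filter.1 hg).2]),
      Finset.sum_const, nsmul_eq_mul, hf]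
  have hc := hfib fun _ => 1
  simp only [Finset.sum_const, Finset.card_univ, nsmul_eq_mul, mul_one] at hc
  have h0 : (({g | φ g = 0} : Finset G).card : ℝ) ≠ 0 := by
    have : (Fintype.card G : ℝ) ≠ 0 := by exact_mod_cast Fintype.card_ne_zero
    intro h; rw [h, zero_mul] at hc; exact this hc
  rw [frac_eq_sum, frac_eq_sum, hfib fun y => if P y then (1 : ℝ) else 0, Nat.card_eq_fintype_card,
    Nat.card_eq_fintype_card, hc, mul_div_mul_left _ _ h0]

end Frac

/-! ### The transition probabilities -/

/-- The probability that the limiting chain jumps from `k ≡ j mod 2` to at least `j + 2`. -/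
noncomputable def stepTail (j k : ℕ) : ℝ :=
  (if j + 4 ≤ k then 1 else 0) +
    (1 - downRate (j + 2)) * ((if j + 2 ≤ k then 1 else 0) - (if j + 4 ≤ k then 1 else 0)) +
    upRate j * ((if j ≤ k then 1 else 0) - (if j + 2 ≤ k then 1 else 0))

theorem stepTail_mem (j k : ℕ) : 0 ≤ stepTail j k ∧ stepTail j k ≤ 1 := by
  have hu := upRate_eq j
  have hd := downRate_add_two j
  obtain ⟨y0, y1⟩ := two_pow_inv_pos_le_one j
  unfold stepTail
  split_ifs <;> first | omega | (rw [hu, hd]; constructor <;> nlinarith)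

theorem stepTail_nonneg (j k : ℕ) : 0 ≤ stepTail j k := (stepTail_mem j k).1

theorem stepTail_le_one (j k : ℕ) : stepTail j k ≤ 1 := (stepTail_mem j k).2

section Transition

variable {V Y : Type*} [AddCommGroup V] [Module (ZMod 2) V] [FiniteDimensional (ZMod 2) V]
  [AddCommGroup Y] [Module (ZMod 2) Y] [Finite Y]

/-- Restriction of a pair of functionals to the radical of a form. -/
noncomputable def radRestrict (ω : V →ₗ[ZMod 2] V →ₗ[ZMod 2] ZMod 2)
    (f g : Y →ₗ[ZMod 2] V →ₗ[ZMod 2] ZMod 2) :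
    Y →ₗ[ZMod 2] (LinearMap.ker ω →ₗ[ZMod 2] ZMod 2) × (LinearMap.ker ω →ₗ[ZMod 2] ZMod 2) :=
  LinearMap.prod ((LinearMap.lcomp (ZMod 2) (ZMod 2) (LinearMap.ker ω).subtype).comp f)
    ((LinearMap.lcomp (ZMod 2) (ZMod 2) (LinearMap.ker ω).subtype).comp g)

theorem card_dual_ker (ω : V →ₗ[ZMod 2] V →ₗ[ZMod 2] ZMod 2) :
    Nat.card (LinearMap.ker ω →ₗ[ZMod 2] ZMod 2) = 2 ^ radDim ω := by
  rw [Module.natCard_eq_pow_finrank (K := ZMod 2), Nat.card_zmod, radDim]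
  congr 1
  exact Subspace.dual_finrank_eq

instance finite_dual_ker (ω : V →ₗ[ZMod 2] V →ₗ[ZMod 2] ZMod 2) :
    Finite (LinearMap.ker ω →ₗ[ZMod 2] ZMod 2) :=
  Module.finite_of_finite (ZMod 2)

theorem frac_prod_eq_zero {D : Type*} [AddCommGroup D] [Finite D] :
    frac (fun t : D × D => t.1 = 0 ∧ t.2 = 0) = ((Nat.card D : ℝ)⁻¹) ^ 2 := by
  have : Unique {t : D × D // t.1 = 0 ∧ t.2 = 0} :=
    ⟨⟨⟨0, rfl, rfl⟩⟩, fun t => Subtype.ext (Prod.ext t.2.1 t.2.2)⟩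
  rw [frac, Nat.card_unique, Nat.card_prod]
  push_cast
  rw [one_div, mul_inv, sq]

/-- Over `𝔽₂` the three inequations express linear independence of a pair. Each of the `|D| - 1`
nonzero first entries leaves `|D| - 2` second ones, and the formula remains correct for trivial `D`,
where it gives 0. -/
theorem frac_prod_indep {D : Type*} [AddCommGroup D] [Finite D] :
    frac (fun t : D × D => t.1 ≠ 0 ∧ t.2 ≠ 0 ∧ t.1 ≠ t.2) =
      (1 - (Nat.card D : ℝ)⁻¹) * (1 - 2 * (Nat.card D : ℝ)⁻¹) := by
  classical
  have : Fintype D := Fintype.ofFinite D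
  have hpos : 1 ≤ Fintype.card D := Fintype.card_pos
  have h0 : (Fintype.card D : ℝ) ≠ 0 := by positivity
  have hin : ∀ a : D, frac (fun b => a ≠ 0 ∧ b ≠ 0 ∧ a ≠ b) =
      if a = 0 then 0 else ((Fintype.card D : ℝ) - 2) / Fintype.card D := by
    intro a
    split_ifs with ha
    · exact frac_of_forall_not fun b h => h.1 ha
    · rw [frac, Nat.card_eq_fintype_card, Nat.card_eq_fintype_card, Fintype.card_subtype]
      congr 1
      have : ({b | a ≠ 0 ∧ b ≠ 0 ∧ a ≠ b} : Finset D) = (Finset.univ.erase 0).erase a := by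
        ext b; simp [ha, and_comm, eq_comm]
      rw [this, Finset.card_erase_of_mem (by simp [ha]), Finset.card_erase_of_mem (by simp),
        Finset.card_univ]
      have h2 : 2 ≤ Fintype.card D := Fintype.one_lt_card_iff.2 ⟨a, 0, ha⟩
      rw [Nat.sub_sub, Nat.cast_sub h2]
      norm_num
  rw [frac_prod]
  simp only [hin]
  rw [Finset.sum_ite, Finset.sum_const_zero, zero_add, Finset.sum_const, nsmul_eq_mul,
    Finset.filter_ne', Finset.card_erase_of_mem (by simp), Finset.card_univ, Nat.cast_sub hpos,
    Nat.card_eq_fintype_card]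
  field_simp
  push_cast
  ring

variable {ω : V →ₗ[ZMod 2] V →ₗ[ZMod 2] ZMod 2} {f g : Y →ₗ[ZMod 2] V →ₗ[ZMod 2] ZMod 2}

/-- Each of the two functionals vanishes on the radical with probability `2 ^ (-k)`, independently,
and then exactly one value of the last bit raises the corank. -/
theorem frac_up (hω : ∀ x, ω x x = 0) (hs : Function.Surjective (radRestrict ω f g)) :
    frac (fun p : Y × ZMod 2 =>
      radDim (extendForm₂ ω (f p.1) (g p.1) p.2) = radDim ω + 2) = upRate (radDim ω) := by
  classical
  have : Fintype Y := Fintype.ofFinite Y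
  choose a₀ ha₀ using fun y => radDim_extendForm₂_eq_add_two_iff hω (f y) (g y)
  have hin : ∀ y, frac (fun a => radDim (extendForm₂ ω (f y) (g y) a) = radDim ω + 2) =
      (if (radRestrict ω f g y).1 = 0 ∧ (radRestrict ω f g y).2 = 0 then (1 : ℝ) else 0) / 2 := by
    intro y
    split_ifs with h
    · rw [frac_congr (Q := fun a => a = a₀ y) fun a => by
        rw [ha₀]; exact ⟨fun h => h.2, fun h' => ⟨h, h'⟩⟩]
      rw [frac, Nat.card_unique, Nat.card_zmod]
      norm_num
    · rw [zero_div]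
      exact frac_of_forall_not fun a ha => h ((ha₀ y a).1 ha).1
  rw [frac_prod]
  simp only [hin]
  have h1 : frac (fun y => (radRestrict ω f g y).1 = 0 ∧ (radRestrict ω f g y).2 = 0) = _ :=
    frac_of_surjective (radRestrict ω f g).toAddMonoidHom hs fun t => t.1 = 0 ∧ t.2 = 0
  rw [← Finset.sum_div, div_right_comm, ← frac_eq_sum, h1, frac_prod_eq_zero, card_dual_ker,
    upRate_eq]
  push_cast
  rfl

theorem frac_down (hω : ∀ x, ω x x = 0) (hs : Function.Surjective (radRestrict ω f g)) :
    frac (fun p : Y × ZMod 2 =>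
      radDim (extendForm₂ ω (f p.1) (g p.1) p.2) + 2 = radDim ω) = downRate (radDim ω) := by
  have h1 : frac (fun y => (radRestrict ω f g y).1 ≠ 0 ∧ (radRestrict ω f g y).2 ≠ 0 ∧
      (radRestrict ω f g y).1 ≠ (radRestrict ω f g y).2) = _ :=
    frac_of_surjective (radRestrict ω f g).toAddMonoidHom hs
      fun t => t.1 ≠ 0 ∧ t.2 ≠ 0 ∧ t.1 ≠ t.2
  rw [frac_prod_indep, card_dual_ker, ← frac_fst (β := ZMod 2)] at h1
  rw [downRate]
  push_cast at h1
  rw [← h1]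
  exact frac_congr fun p => radDim_extendForm₂_add_two_eq_iff hω

/-- If the new functionals are equidistributed on the radical, the corank moves by the limiting
chain. -/
theorem frac_le_radDim_extendForm₂ (hω : ∀ x, ω x x = 0)
    (hs : Function.Surjective (radRestrict ω f g)) {j : ℕ} (hj : radDim ω % 2 = j % 2) :
    frac (fun p : Y × ZMod 2 => j + 2 ≤ radDim (extendForm₂ ω (f p.1) (g p.1) p.2)) =
      stepTail j (radDim ω) := by
  have hle := fun p : Y × ZMod 2 => radDim_extendForm₂_le hω (f p.1) (g p.1) p.2
  have hpar := fun p : Y × ZMod 2 => radDim_extendForm₂_parity hω (f p.1) (g p.1) p.2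
  -- Parity rules out all other values. A step of size at most two can cross the threshold `j + 2`
  -- only downwards from `j + 2` or upwards from `j`.
  have hcases : j + 4 ≤ radDim ω ∨ radDim ω = j + 2 ∨ radDim ω = j ∨ radDim ω + 2 ≤ j := by omega
  unfold stepTail
  rcases hcases with h | h | h | h
  · rw [frac_of_forall fun p => by have := hle p; omega]
    simp [h, show j + 2 ≤ radDim ω by omega, show j ≤ radDim ω by omega]
  · rw [frac_congr (Q := fun p => ¬ (radDim (extendForm₂ ω (f p.1) (g p.1) p.2) + 2 = radDim ω))
      fun p => by have := hle p; have := hpar p; omega, frac_not, frac_down hω hs, h]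
    simp
  · rw [frac_congr (Q := fun p => radDim (extendForm₂ ω (f p.1) (g p.1) p.2) = radDim ω + 2)
      fun p => by have := hle p; have := hpar p; omega, frac_up hω hs, h]
    simp
  · rw [frac_of_forall_not fun p => by have := hle p; have := hpar p; omega]
    simp [show ¬ j + 4 ≤ radDim ω by omega, show ¬ j + 2 ≤ radDim ω by omega,
      show ¬ j ≤ radDim ω by omega]

end Transition

/-! ### Random bordered alternating forms -/

/-- The data from which random alternating forms on `𝔽₂^m × 𝔽₂^m × Z` are built. -/
structure FormData (X Z : Type*) [AddCommGroup X] [Module (ZMod 2) X] [AddCommGroup Z]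
    [Module (ZMod 2) Z] where
  χ : X →ₗ[ZMod 2] ZMod 2
  b₁ : X →ₗ[ZMod 2] ZMod 2
  b₂ : X →ₗ[ZMod 2] ZMod 2
  β₁ : X →ₗ[ZMod 2] X →ₗ[ZMod 2] ZMod 2
  β₂ : X →ₗ[ZMod 2] X →ₗ[ZMod 2] ZMod 2
  l₁ : Z →ₗ[ZMod 2] X →ₗ[ZMod 2] ZMod 2
  l₂ : Z →ₗ[ZMod 2] X →ₗ[ZMod 2] ZMod 2
  C : Z →ₗ[ZMod 2] Z →ₗ[ZMod 2] ZMod 2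
  β₁_symm : ∀ x y, β₁ x y = β₁ y x
  β₂_symm : ∀ x y, β₂ x y = β₂ y x
  β₁_diag : ∀ x, β₁ x x = b₁ x
  β₂_diag : ∀ x, β₂ x x = b₂ x
  C_alt : ∀ z, C z z = 0

/-- The space carrying the random form. -/
abbrev FormSpace (Z : Type*) (m : ℕ) := (Fin m → ZMod 2) × (Fin m → ZMod 2) × Z

namespace FormData

variable {X Z : Type*} [AddCommGroup X] [Module (ZMod 2) X] [AddCommGroup Z] [Module (ZMod 2) Z]
  (𝓕 : FormData X Z) {m : ℕ}

/-- A vector of symbols for each of `m` primes together with a matrix satisfying the reciprocity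
law. -/
def Config (m : ℕ) : Type _ :=
  {p : (Fin m → X) × Matrix (Fin m) (Fin m) (ZMod 2) //
    ∀ i j, i ≠ j → p.2 i j + p.2 j i = 𝓕.χ (p.1 i) * 𝓕.χ (p.1 j)}

/-- The off-diagonal part of a Gram matrix. -/
def offDiag (β : X →ₗ[ZMod 2] X →ₗ[ZMod 2] ZMod 2) (x : Fin m → X) (i j : Fin m) : ZMod 2 :=
  if i = j then 0 else β (x i) (x j)

/-- The random alternating form attached to symbol vectors `x` and a matrix `A`. -/
noncomputable def form (x : Fin m → X) (A : Matrix (Fin m) (Fin m) (ZMod 2)) :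
    FormSpace Z m →ₗ[ZMod 2] FormSpace Z m →ₗ[ZMod 2] ZMod 2 :=
  LinearMap.mk₂ (ZMod 2)
    (fun p q =>
      ∑ i, q.1 i * (∑ j, offDiag 𝓕.β₁ x i j * p.1 j + ∑ j, A j i * p.2.1 j + 𝓕.l₁ p.2.2 (x i)) +
      ∑ i, q.2.1 i * (∑ j, A i j * p.1 j + ∑ j, offDiag 𝓕.β₂ x i j * p.2.1 j + 𝓕.l₂ p.2.2 (x i)) +
      (∑ j, 𝓕.l₁ q.2.2 (x j) * p.1 j + ∑ j, 𝓕.l₂ q.2.2 (x j) * p.2.1 j + 𝓕.C p.2.2 q.2.2))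
    (fun p p' q => by
      simp only [Prod.fst_add, Prod.snd_add, Pi.add_apply, mul_add, Finset.sum_add_distrib, map_add,
        LinearMap.add_apply]
      ring)
    (fun c p q => by
      simp only [Prod.smul_fst, Prod.smul_snd, Pi.smul_apply, smul_eq_mul, map_smul,
        LinearMap.smul_apply, mul_left_comm _ c, ← Finset.mul_sum, ← mul_add])
    (fun p q q' => by
      simp only [Prod.fst_add, Prod.snd_add, Pi.add_apply, add_mul, Finset.sum_add_distrib, map_add,
        LinearMap.add_apply]
      ring)
    (fun c p q => by
      simp only [Prod.smul_fst, Prod.smul_snd, Pi.smul_apply, smul_eq_mul, map_smul,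
        LinearMap.smul_apply, mul_assoc c, ← Finset.mul_sum, ← mul_add])

theorem form_apply (x : Fin m → X) (A : Matrix (Fin m) (Fin m) (ZMod 2)) (p q : FormSpace Z m) :
    𝓕.form x A p q =
      ∑ i, q.1 i * (∑ j, offDiag 𝓕.β₁ x i j * p.1 j + ∑ j, A j i * p.2.1 j + 𝓕.l₁ p.2.2 (x i)) +
      ∑ i, q.2.1 i * (∑ j, A i j * p.1 j + ∑ j, offDiag 𝓕.β₂ x i j * p.2.1 j + 𝓕.l₂ p.2.2 (x i)) +
      (∑ j, 𝓕.l₁ q.2.2 (x j) * p.1 j + ∑ j, 𝓕.l₂ q.2.2 (x j) * p.2.1 j + 𝓕.C p.2.2 q.2.2) := rfl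

/-- The equations cutting out the radical of the form. -/
theorem eqs_of_mem_ker {x : Fin m → X} {A : Matrix (Fin m) (Fin m) (ZMod 2)} {p : FormSpace Z m}
    (hp : p ∈ LinearMap.ker (𝓕.form x A)) :
    (∀ i, ∑ j, offDiag 𝓕.β₁ x i j * p.1 j + ∑ j, A j i * p.2.1 j + 𝓕.l₁ p.2.2 (x i) = 0) ∧
    (∀ i, ∑ j, A i j * p.1 j + ∑ j, offDiag 𝓕.β₂ x i j * p.2.1 j + 𝓕.l₂ p.2.2 (x i) = 0) ∧
    ∀ z, ∑ j, 𝓕.l₁ z (x j) * p.1 j + ∑ j, 𝓕.l₂ z (x j) * p.2.1 j + 𝓕.C p.2.2 z = 0 := by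
  have h := fun q => LinearMap.congr_fun (LinearMap.mem_ker.1 hp) q
  simp only [form_apply, LinearMap.zero_apply] at h
  refine ⟨fun i => ?_, fun i => ?_, fun z => ?_⟩
  · simpa [Pi.single_apply] using h (Pi.single i 1, 0, 0)
  · simpa [Pi.single_apply] using h (0, Pi.single i 1, 0)
  · simpa using h (0, 0, z)

/-! ### Adding one prime -/

/-- The pairing of the first new basis vector with the old space. -/
noncomputable def newFun₁ (x : Fin m → X) :
    (X × (Fin m → ZMod 2)) →ₗ[ZMod 2] FormSpace Z m →ₗ[ZMod 2] ZMod 2 :=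
  LinearMap.mk₂ (ZMod 2)
    (fun y p => ∑ j, 𝓕.β₁ y.1 (x j) * p.1 j + ∑ j, y.2 j * p.2.1 j + 𝓕.l₁ p.2.2 y.1)
    (fun y y' p => by
      simp only [Prod.fst_add, Prod.snd_add, Pi.add_apply, add_mul, Finset.sum_add_distrib, map_add,
        LinearMap.add_apply]
      ring)
    (fun c y p => by
      simp only [Prod.smul_fst, Prod.smul_snd, Pi.smul_apply, smul_eq_mul, map_smul,
        LinearMap.smul_apply, mul_assoc c, ← Finset.mul_sum, ← mul_add])
    (fun y p p' => by
      simp only [Prod.fst_add, Prod.snd_add, Pi.add_apply, mul_add, Finset.sum_add_distrib, map_add,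
        LinearMap.add_apply]
      ring)
    (fun c y p => by
      simp only [Prod.smul_fst, Prod.smul_snd, Pi.smul_apply, smul_eq_mul, map_smul,
        LinearMap.smul_apply, mul_left_comm _ c, ← Finset.mul_sum, ← mul_add])

/-- The pairing of the second new basis vector with the old space. -/
noncomputable def newFun₂ (x : Fin m → X) :
    (X × (Fin m → ZMod 2)) →ₗ[ZMod 2] FormSpace Z m →ₗ[ZMod 2] ZMod 2 :=
  LinearMap.mk₂ (ZMod 2)
    (fun y p => ∑ j, (y.2 j + 𝓕.χ (x j) * 𝓕.χ y.1) * p.1 j + ∑ j, 𝓕.β₂ y.1 (x j) * p.2.1 j +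
      𝓕.l₂ p.2.2 y.1)
    (fun y y' p => by
      simp only [Prod.fst_add, Prod.snd_add, Pi.add_apply, add_mul, mul_add, Finset.sum_add_distrib,
        map_add, LinearMap.add_apply]
      ring)
    (fun c y p => by
      simp only [Prod.smul_fst, Prod.smul_snd, Pi.smul_apply, smul_eq_mul, map_smul,
        LinearMap.smul_apply, mul_assoc c, ← Finset.mul_sum, ← mul_add, mul_left_comm _ c])
    (fun y p p' => by
      simp only [Prod.fst_add, Prod.snd_add, Pi.add_apply, mul_add, Finset.sum_add_distrib, map_add,
        LinearMap.add_apply]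
      ring)
    (fun c y p => by
      simp only [Prod.smul_fst, Prod.smul_snd, Pi.smul_apply, smul_eq_mul, map_smul,
        LinearMap.smul_apply, mul_left_comm _ c, ← Finset.mul_sum, ← mul_add])

theorem newFun₁_apply (x : Fin m → X) (y : X × (Fin m → ZMod 2)) (p : FormSpace Z m) :
    𝓕.newFun₁ x y p =
      ∑ j, 𝓕.β₁ y.1 (x j) * p.1 j + ∑ j, y.2 j * p.2.1 j + 𝓕.l₁ p.2.2 y.1 := rfl

theorem newFun₂_apply (x : Fin m → X) (y : X × (Fin m → ZMod 2)) (p : FormSpace Z m) :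
    𝓕.newFun₂ x y p =
      ∑ j, (y.2 j + 𝓕.χ (x j) * 𝓕.χ y.1) * p.1 j + ∑ j, 𝓕.β₂ y.1 (x j) * p.2.1 j +
        𝓕.l₂ p.2.2 y.1 := rfl

/-- The matrix of a configuration enlarged by one prime. -/
def consMatrix (x : Fin m → X) (A : Matrix (Fin m) (Fin m) (ZMod 2)) (y : X × (Fin m → ZMod 2))
    (a : ZMod 2) : Matrix (Fin (m + 1)) (Fin (m + 1)) (ZMod 2) := fun i j =>
  Fin.cases (Fin.cases a (fun j => y.2 j + 𝓕.χ (x j) * 𝓕.χ y.1) j)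
    (fun i => Fin.cases (y.2 i) (fun j => A i j) j) i

/-- Splitting off the first prime of a configuration. -/
def consConfig (m : ℕ) :
    𝓕.Config m × ((X × (Fin m → ZMod 2)) × ZMod 2) ≃ 𝓕.Config (m + 1) where
  toFun p := ⟨(Fin.cons p.2.1.1 p.1.1.1, 𝓕.consMatrix p.1.1.1 p.1.1.2 p.2.1 p.2.2), by
    intro i j
    refine Fin.cases ?_ (fun i => ?_) i <;> refine Fin.cases ?_ (fun j => ?_) j
    · simp
    · intro _
      simp only [consMatrix, Fin.cases_zero, Fin.cases_succ, Fin.cons_zero, Fin.cons_succ]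
      rw [add_right_comm, CharTwo.add_self_eq_zero, zero_add, mul_comm]
    · intro _
      simp only [consMatrix, Fin.cases_zero, Fin.cases_succ, Fin.cons_zero, Fin.cons_succ]
      rw [← add_assoc, CharTwo.add_self_eq_zero, zero_add]
    · intro h
      exact p.1.2 i j (fun h' => h (by rw [h']))⟩
  invFun q := (⟨(Fin.tail q.1.1, fun i j => q.1.2 i.succ j.succ),
    fun i j h => q.2 i.succ j.succ (fun h' => h (Fin.succ_injective _ h'))⟩,
    (q.1.1 0, fun i => q.1.2 i.succ 0), q.1.2 0 0)
  left_inv p := rfl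
  right_inv q := by
    apply Subtype.ext
    refine Prod.ext (Fin.cons_self_tail _) ?_
    ext i j
    refine Fin.cases ?_ (fun i => ?_) i <;> refine Fin.cases ?_ (fun j => ?_) j
    · rfl
    · simp only [consMatrix, Fin.cases_zero, Fin.cases_succ, Fin.tail]
      rw [← q.2 j.succ 0 (Fin.succ_ne_zero _), ← add_assoc, CharTwo.add_self_eq_zero, zero_add]
    · rfl
    · rfl

/-- The space of the enlarged form. -/
def consSpace (Z : Type*) [AddCommGroup Z] [Module (ZMod 2) Z] (m : ℕ) :
    ((FormSpace Z m × ZMod 2) × ZMod 2) ≃ₗ[ZMod 2] FormSpace Z (m + 1) where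
  toFun p := (Fin.cons p.1.2 p.1.1.1, Fin.cons p.2 p.1.1.2.1, p.1.1.2.2)
  invFun q := (((Fin.tail q.1, Fin.tail q.2.1, q.2.2), q.1 0), q.2.1 0)
  left_inv p := rfl
  right_inv q := by
    refine Prod.ext (Fin.cons_self_tail _) (Prod.ext (Fin.cons_self_tail _) rfl)
  map_add' p q := by
    refine Prod.ext ?_ (Prod.ext ?_ rfl) <;> ext i <;> refine Fin.cases ?_ (fun i => ?_) i <;> rfl
  map_smul' c p := by
    refine Prod.ext ?_ (Prod.ext ?_ rfl) <;> ext i <;> refine Fin.cases ?_ (fun i => ?_) i <;> rfl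

theorem consSpace_apply (p : (FormSpace Z m × ZMod 2) × ZMod 2) :
    consSpace Z m p = (Fin.cons p.1.2 p.1.1.1, Fin.cons p.2 p.1.1.2.1, p.1.1.2.2) := rfl

/-- A further prime contributes one basis vector to each block, and the two pair with each other by
the new diagonal entry `a`. The reciprocity term in `newFun₂` is the one in the first row of
`consMatrix`, while the first column is free. -/
theorem form_cons (x : Fin m → X) (A : Matrix (Fin m) (Fin m) (ZMod 2))
    (y : X × (Fin m → ZMod 2)) (a : ZMod 2) (p q : (FormSpace Z m × ZMod 2) × ZMod 2) :
    𝓕.form (Fin.cons y.1 x) (𝓕.consMatrix x A y a) (consSpace Z m p) (consSpace Z m q) =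
      extendForm₂ (𝓕.form x A) (𝓕.newFun₁ x y) (𝓕.newFun₂ x y) a p q := by
  obtain ⟨⟨⟨u, v, z⟩, s⟩, t⟩ := p
  obtain ⟨⟨⟨u', v', z'⟩, s'⟩, t'⟩ := q
  have e : ∀ (s : ZMod 2) (w c : Fin m → ZMod 2), ∑ i, w i * (c i * s) = s * ∑ i, c i * w i := by
    intro s w c
    rw [Finset.mul_sum]
    exact Finset.sum_congr rfl fun _ _ => by ring
  simp only [extendForm₂, extendForm_apply, extendFun_apply, form_apply, newFun₁_apply,
    newFun₂_apply, consSpace_apply,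
    Fin.sum_univ_succ, Fin.cons_zero, Fin.cons_succ, consMatrix, Fin.cases_zero, Fin.cases_succ,
    offDiag, Fin.succ_inj, (Fin.succ_ne_zero _).symm, Fin.succ_ne_zero, if_true, if_false]
  simp only [mul_add, Finset.sum_add_distrib, e, 𝓕.β₁_symm (x _) y.1,
    𝓕.β₂_symm (x _) y.1]
  ring

end FormData

/-! ### The corank of a random form as an approximate Markov chain -/

namespace FormData

variable {X Z : Type*} [AddCommGroup X] [Module (ZMod 2) X] [AddCommGroup Z] [Module (ZMod 2) Z]
  (𝓕 : FormData X Z) {m : ℕ}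

/-- Induction on the number of primes: starting from `C`, each prime extends an alternating form by
two vectors. -/
theorem form_self (ω : 𝓕.Config m) (p : FormSpace Z m) : 𝓕.form ω.1.1 ω.1.2 p p = 0 := by
  induction m with
  | zero => simp [form_apply, 𝓕.C_alt]
  | succ m ih =>
    obtain ⟨⟨ω, y, a⟩, rfl⟩ := (𝓕.consConfig m).surjective ω
    obtain ⟨p, rfl⟩ := (consSpace Z m).surjective p
    exact (𝓕.form_cons ω.1.1 ω.1.2 y a p p).trans
      (extendForm_self (extendForm_self (ih ω) _) _ p)

/-- The corank of the form of a configuration. -/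
noncomputable def rad (ω : 𝓕.Config m) : ℕ := radDim (𝓕.form ω.1.1 ω.1.2)

theorem rad_consConfig (ω : 𝓕.Config m) (y : X × (Fin m → ZMod 2)) (a : ZMod 2) :
    𝓕.rad (𝓕.consConfig m (ω, y, a)) =
      radDim (extendForm₂ (𝓕.form ω.1.1 ω.1.2) (𝓕.newFun₁ ω.1.1 y) (𝓕.newFun₂ ω.1.1 y) a) :=
  (radDim_congr (consSpace Z m) (𝓕.form_cons ω.1.1 ω.1.2 y a)).symm

/-- The functionals attached to the next prime are equidistributed on the radical. -/
def Good (ω : 𝓕.Config m) : Prop :=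
  Function.Surjective
    (radRestrict (𝓕.form ω.1.1 ω.1.2) (𝓕.newFun₁ ω.1.1) (𝓕.newFun₂ ω.1.1))

theorem finrank_formSpace [Finite Z] : finrank (ZMod 2) (FormSpace Z m) =
    2 * m + finrank (ZMod 2) Z := by
  simp; ring

theorem rad_mod_two [Finite Z] (ω : 𝓕.Config m) : 𝓕.rad ω % 2 = finrank (ZMod 2) Z % 2 := by
  rw [rad, radDim_mod_two (𝓕.form_self ω), finrank_formSpace]
  omega

theorem rad_le [Finite Z] (ω : 𝓕.Config m) : 𝓕.rad ω ≤ 2 * m + finrank (ZMod 2) Z := by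
  rw [← finrank_formSpace]
  exact Submodule.finrank_le _

instance [Finite X] : Finite (𝓕.Config m) := by unfold Config; infer_instance

instance : Nonempty (𝓕.Config m) := by
  induction m with
  | zero => exact ⟨⟨(0, 0), fun i => i.elim0⟩⟩
  | succ m ih =>
    obtain ⟨ω⟩ := ih
    exact ⟨𝓕.consConfig m (ω, 0, 0)⟩

/-- The proportion of configurations of corank at least `2h + ε`, where `ε` is the parity of the
corank. -/
noncomputable def radTail (m h : ℕ) : ℝ :=
  frac fun ω : 𝓕.Config m => 2 * h + finrank (ZMod 2) Z % 2 ≤ 𝓕.rad ω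

/-- Condition on all primes but the new one. Over a good configuration the transition is exactly
that of the limiting chain; over a bad one both probabilities lie in `[0, 1]`, so it costs no more
than its share. -/
theorem abs_radTail_succ_sub_le [Finite X] [Finite Z] (m h : ℕ) :
    |𝓕.radTail (m + 1) (h + 1) - tailStep (finrank (ZMod 2) Z % 2) (𝓕.radTail m) h| ≤
      frac fun ω : 𝓕.Config m => ¬ 𝓕.Good ω := by
  classical
  have : Fintype (𝓕.Config m) := Fintype.ofFinite _
  set ε := finrank (ZMod 2) Z % 2 with hε
  have h1 : 𝓕.radTail (m + 1) (h + 1) = (∑ ω : 𝓕.Config m,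
      frac fun p : (X × (Fin m → ZMod 2)) × ZMod 2 => (2 * h + ε) + 2 ≤
        radDim (extendForm₂ (𝓕.form ω.1.1 ω.1.2) (𝓕.newFun₁ ω.1.1 p.1) (𝓕.newFun₂ ω.1.1 p.1) p.2)) /
      Nat.card (𝓕.Config m) := by
    rw [radTail, ← frac_equiv (𝓕.consConfig m), frac_prod]
    congr 1
    refine Finset.sum_congr rfl fun ω _ => frac_congr fun p => ?_
    rw [rad_consConfig, ← hε]
    omega
  have h2 : tailStep ε (𝓕.radTail m) h = (∑ ω : 𝓕.Config m, stepTail (2 * h + ε) (𝓕.rad ω)) /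
      Nat.card (𝓕.Config m) := by
    simp only [tailStep, radTail, frac_eq_sum, stepTail, ← sub_div, ← Finset.sum_sub_distrib,
      ← mul_div_assoc, Finset.mul_sum, ← add_div, ← Finset.sum_add_distrib, ← hε]
    congr 1
    refine Finset.sum_congr rfl fun ω _ => ?_
    rw [show 2 * (h + 2) + ε = 2 * h + ε + 4 by ring, show 2 * (h + 1) + ε = 2 * h + ε + 2 by ring]
  rw [h1, h2, ← sub_div, ← Finset.sum_sub_distrib, abs_div, Nat.abs_cast, frac_eq_sum]
  gcongr
  refine (Finset.abs_sum_le_sum_abs _ _).trans (Finset.sum_le_sum fun ω _ => ?_)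
  by_cases hg : 𝓕.Good ω
  · rw [frac_le_radDim_extendForm₂ (𝓕.form_self ω) hg (by
      have := 𝓕.rad_mod_two ω
      rw [rad] at this
      omega)]
    simp [hg, rad]
  · simp only [hg, not_false_eq_true, if_true]
    have a1 := frac_nonneg fun p : (X × (Fin m → ZMod 2)) × ZMod 2 => (2 * h + ε) + 2 ≤
        radDim (extendForm₂ (𝓕.form ω.1.1 ω.1.2) (𝓕.newFun₁ ω.1.1 p.1) (𝓕.newFun₂ ω.1.1 p.1) p.2)
    have a2 := frac_le_one fun p : (X × (Fin m → ZMod 2)) × ZMod 2 => (2 * h + ε) + 2 ≤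
        radDim (extendForm₂ (𝓕.form ω.1.1 ω.1.2) (𝓕.newFun₁ ω.1.1 p.1) (𝓕.newFun₂ ω.1.1 p.1) p.2)
    have a3 := stepTail_nonneg (2 * h + ε) (𝓕.rad ω)
    have a4 := stepTail_le_one (2 * h + ε) (𝓕.rad ω)
    rw [abs_le]
    constructor <;> linarith

/-- If bad configurations are exponentially rare, the corank distribution converges. -/
theorem tendsto_frac_rad [Finite X] [Finite Z] {C : ℝ}
    (hbad : ∀ m, (frac fun ω : 𝓕.Config m => ¬ 𝓕.Good ω) ≤ C * (3 / 4) ^ m) (k : ℕ)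
    (hk : k % 2 = finrank (ZMod 2) Z % 2) :
    Tendsto (fun m => frac fun ω : 𝓕.Config m => 𝓕.rad ω = k) atTop (𝓝 (alpha k)) := by
  classical
  set ε := finrank (ZMod 2) Z % 2 with hε
  have hε1 : ε ≤ 1 := by omega
  -- The choice of `h₀` reflects the dimension `2 m + dim Z` of the whole space, which bounds the
  -- corank. The tail at 0 is 1 because `ε` is the parity of every corank.
  have key := tendsto_alphaTail hε1 (G := 𝓕.radTail) (h₀ := finrank (ZMod 2) Z)
    (fun m => frac_of_forall fun ω => by have := 𝓕.rad_mod_two ω; omega)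
    (fun m h hh => frac_of_forall_not fun ω => by have := 𝓕.rad_le ω; omega)
    (fun m h => (𝓕.abs_radTail_succ_sub_le m h).trans (hbad m))
  have h1 := (key (k / 2)).sub (key (k / 2 + 1))
  rw [alphaTail_sub hε1, show 2 * (k / 2) + ε = k by omega] at h1
  refine h1.congr fun m => ?_
  have : Fintype (𝓕.Config m) := Fintype.ofFinite _
  rw [radTail, radTail, frac_eq_sum, frac_eq_sum, frac_eq_sum, ← sub_div, ← Finset.sum_sub_distrib]
  congr 1
  refine Finset.sum_congr rfl fun ω _ => ?_
  have hp := 𝓕.rad_mod_two ω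
  rw [← hε] at hp ⊢
  have hc : 𝓕.rad ω + 2 ≤ k ∨ 𝓕.rad ω = k ∨ k + 2 ≤ 𝓕.rad ω := by omega
  rcases hc with h | h | h
  · simp [show ¬ 2 * (k / 2) + ε ≤ 𝓕.rad ω by omega,
      show ¬ 2 * (k / 2 + 1) + ε ≤ 𝓕.rad ω by omega, show 𝓕.rad ω ≠ k by omega]
  · simp [h, show 2 * (k / 2) + ε ≤ k by omega, show ¬ 2 * (k / 2 + 1) + ε ≤ k by omega]
  · simp [show 2 * (k / 2) + ε ≤ 𝓕.rad ω by omega,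
      show 2 * (k / 2 + 1) + ε ≤ 𝓕.rad ω by omega, show 𝓕.rad ω ≠ k by omega]

end FormData

/-! ### Random symmetric matrices -/

/-- The space of symmetric matrices over `𝔽₂`. -/
def symMatrix (m : ℕ) : Submodule (ZMod 2) (Matrix (Fin m) (Fin m) (ZMod 2)) where
  carrier := {S | S.transpose = S}
  add_mem' := fun {a b} ha hb => by
    simp only [Set.mem_ofPred_eq] at ha hb ⊢
    rw [Matrix.transpose_add, ha, hb]
  zero_mem' := Matrix.transpose_zero
  smul_mem' := fun c a ha => by
    simp only [Set.mem_ofPred_eq] at ha ⊢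
    rw [Matrix.transpose_smul, ha]

theorem mem_symMatrix {m : ℕ} {S : Matrix (Fin m) (Fin m) (ZMod 2)} :
    S ∈ symMatrix m ↔ S.transpose = S := Iff.rfl

/-- Evaluation of symmetric matrices at a family of vectors. -/
noncomputable def symEval {m ρ : ℕ} (y : Fin ρ → Fin m → ZMod 2) :
    symMatrix m →ₗ[ZMod 2] (Fin ρ → Fin m → ZMod 2) where
  toFun S k := S.1.mulVec (y k)
  map_add' S T := by ext k : 1; exact Matrix.add_mulVec _ _ _
  map_smul' c S := by ext k : 1; exact Matrix.smul_mulVec _ _ _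

/-- By independence, the map taking the standard basis vectors to the `y k` has a left inverse; its
rows are the dual vectors. -/
theorem exists_dual_vectors {m ρ : ℕ} {y : Fin ρ → Fin m → ZMod 2}
    (hy : LinearIndependent (ZMod 2) y) :
    ∃ w : Fin ρ → Fin m → ZMod 2, ∀ k l, w l ⬝ᵥ y k = if k = l then 1 else 0 := by
  obtain ⟨g, hg⟩ := LinearMap.exists_leftInverse_of_injective
    (Fintype.linearCombination (ZMod 2) y) (LinearMap.ker_eq_bot.2
      (linearIndependent_iff_injective_fintypeLinearCombination.1 hy))
  refine ⟨fun l i => g (Pi.single i 1) l, fun k l => ?_⟩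
  have h1 := LinearMap.congr_fun hg (Pi.single k 1)
  simp only [LinearMap.comp_apply, LinearMap.id_apply, Fintype.linearCombination_apply_single,
    one_smul] at h1
  have h2 : y k = ∑ i, y k i • (Pi.single i 1 : Fin m → ZMod 2) := by
    ext j; simp [Pi.single_apply]
  have h3 := congr_fun h1 l
  rw [h2, map_sum, Finset.sum_apply] at h3
  simp only [map_smul, Pi.smul_apply, smul_eq_mul, Pi.single_apply] at h3
  rw [dotProduct]
  simp only [mul_comm _ (y k _)]
  rw [h3]
  simp [eq_comm]

/-- The image of symmetric matrices under evaluation at independent vectors has small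
codimension. -/
theorem le_finrank_range_symEval {m ρ : ℕ} {y : Fin ρ → Fin m → ZMod 2}
    (hy : LinearIndependent (ZMod 2) y) :
    ρ * m ≤ finrank (ZMod 2) (LinearMap.range (symEval y)) + ρ * ρ := by
  obtain ⟨w, hw⟩ := exists_dual_vectors hy
  set N := (LinearMap.range (symEval y)).dualAnnihilator with hN
  -- A functional vanishing on the image turns out to be determined by its `ρ ^ 2` values at the
  -- vectors `w l` placed in slot `k`, which bounds the codimension by `ρ ^ 2`.
  let ψ : N →ₗ[ZMod 2] (Fin ρ → Fin ρ → ZMod 2) :=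
    LinearMap.pi fun k => LinearMap.pi fun l =>
      (Dual.eval (ZMod 2) _ (Pi.single k (w l))).comp N.subtype
  have hψ : LinearMap.ker ψ = ⊥ := by
    rw [LinearMap.ker_eq_bot']
    rintro ⟨Λ, hΛ⟩ h
    have h0 : ∀ k l, Λ (Pi.single k (w l)) = 0 := fun k l => congr_fun (congr_fun h k) l
    apply Subtype.ext
    apply LinearMap.pi_ext'
    intro l
    ext1 i
    set e : Fin m → ZMod 2 := Pi.single i 1 with he
    -- This symmetric test matrix takes `y l` to `e` plus a multiple of `w l`, and every other `y k`
    -- to a multiple of `w l`. So `Λ` at `e` in slot `l` is expressed by the values recorded in `ψ`.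
    have hS : Matrix.vecMulVec e (w l) + Matrix.vecMulVec (w l) e ∈ symMatrix m := by
      rw [mem_symMatrix, Matrix.transpose_add, Matrix.transpose_vecMulVec,
        Matrix.transpose_vecMulVec, add_comm]
    have h1 := (Submodule.mem_dualAnnihilator Λ).1 hΛ _ ⟨⟨_, hS⟩, rfl⟩
    have h2 : symEval y ⟨_, hS⟩ = Pi.single l e + ∑ k, (e ⬝ᵥ y k) • Pi.single k (w l) := by
      ext k j
      simp only [symEval, LinearMap.coe_mk, AddHom.coe_mk, Matrix.add_mulVec,
        Matrix.vecMulVec_mulVec, Pi.add_apply, Finset.sum_apply, Pi.smul_apply, hw]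
      congr 1
      · by_cases hkl : k = l
        · subst hkl; simp
        · simp [hkl]
      · rw [Finset.sum_eq_single k]
        · simp [mul_comm]
        · intro b _ hb; simp [hb]
        · simp
    apply LinearMap.ext_ring
    rw [h2, map_add, map_sum] at h1
    simp only [map_smul, h0, smul_zero, Finset.sum_const_zero, add_zero] at h1
    exact h1
  have h3 : finrank (ZMod 2) N ≤ ρ * ρ := by
    have := LinearMap.finrank_le_finrank_of_injective (LinearMap.ker_eq_bot.1 hψ)
    simpa only [Module.finrank_pi_fintype, finrank_self, Finset.sum_const, Finset.card_univ,
      Fintype.card_fin, smul_eq_mul, mul_one] using this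
  have h4 := Subspace.finrank_add_finrank_dualAnnihilator_eq (LinearMap.range (symEval y))
  rw [← hN] at h4
  simp only [Module.finrank_pi_fintype, finrank_self, Finset.sum_const, Finset.card_univ,
    Fintype.card_fin, smul_eq_mul, mul_one] at h4
  omega

theorem frac_eq_le {G H : Type*} [AddCommGroup G] [AddCommGroup H] [Finite G] (φ : G →+ H) (h : H) :
    frac (fun g => φ g = h) ≤ (Nat.card φ.range : ℝ)⁻¹ := by
  by_cases hh : h ∈ φ.range
  · have := frac_of_surjective φ.rangeRestrict φ.rangeRestrict_surjective fun r => r = ⟨h, hh⟩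
    rw [frac_congr (Q := fun g => φ.rangeRestrict g = ⟨h, hh⟩) fun g => by
      rw [Subtype.ext_iff]; rfl, this, frac, Nat.card_unique, Nat.cast_one, one_div]
  · rw [frac_of_forall_not fun g hg => hh ⟨g, hg⟩]
    positivity

/-- A random symmetric matrix takes prescribed values at independent vectors with small
probability. -/
theorem frac_symEval_le {m ρ : ℕ} {y : Fin ρ → Fin m → ZMod 2}
    (hy : LinearIndependent (ZMod 2) y) (h : Fin ρ → Fin m → ZMod 2) :
    frac (fun S : symMatrix m => symEval y S = h) ≤ 2 ^ (ρ * ρ) / 2 ^ (ρ * m) := by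
  refine (frac_eq_le (symEval y).toAddMonoidHom h).trans ?_
  have hc : Nat.card (symEval y).toAddMonoidHom.range =
      2 ^ finrank (ZMod 2) (LinearMap.range (symEval y)) := by
    have := Module.natCard_eq_pow_finrank (K := ZMod 2) (V := LinearMap.range (symEval y))
    rw [Nat.card_zmod] at this
    exact this
  rw [hc, Nat.cast_pow, Nat.cast_ofNat, inv_eq_one_div, div_le_div_iff₀ (by positivity)
    (by positivity), one_mul, ← pow_add]
  exact pow_le_pow_right₀ (by norm_num) (by have := le_finrank_range_symEval hy; omega)

theorem frac_exists_le {α ι : Type*} [Finite α] [Fintype ι] (P : ι → α → Prop) :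
    frac (fun a => ∃ i, P i a) ≤ ∑ i, frac (P i) := by
  classical
  have : Fintype α := Fintype.ofFinite α
  simp only [frac_eq_sum, ← Finset.sum_div]
  rw [Finset.sum_comm]
  gcongr with a
  split_ifs with h
  · obtain ⟨i, hi⟩ := h
    calc (1 : ℝ) = if P i a then 1 else 0 := by simp [hi]
      _ ≤ _ := Finset.single_le_sum (f := fun i => if P i a then (1 : ℝ) else 0)
        (fun i _ => by positivity) (Finset.mem_univ i)
  · positivity

theorem frac_pi {α : Type*} [Finite α] (P : α → Prop) (m : ℕ) :
    frac (fun q : Fin m → α => ∀ i, P (q i)) = frac P ^ m := by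
  rw [frac, frac, Nat.card_congr (Equiv.subtypePiEquivPi (p := fun _ => P)), Nat.card_pi, Nat.card_pi]
  simp [div_pow]

theorem frac_zmod_linear {Y : Type*} [AddCommGroup Y] [Module (ZMod 2) Y] [Finite Y]
    {φ : Y →ₗ[ZMod 2] ZMod 2} (hφ : φ ≠ 0) (c : ZMod 2) : frac (fun y => φ y = c) = 1 / 2 := by
  have := frac_of_surjective φ.toAddMonoidHom (LinearMap.surjective hφ) fun t => t = c
  refine Eq.trans this ?_
  rw [frac, Nat.card_unique, Nat.card_zmod]
  norm_num


/-! ### Counting configurations with prescribed images and relations -/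

namespace FormData

variable {X Z : Type*} [AddCommGroup X] [Module (ZMod 2) X] [AddCommGroup Z] [Module (ZMod 2) Z]
  (𝓕 : FormData X Z) {m : ℕ}

/-- A particular matrix satisfying the reciprocity law. -/
def baseMatrix (x : Fin m → X) : Matrix (Fin m) (Fin m) (ZMod 2) := fun i j =>
  if i < j then 𝓕.χ (x i) * 𝓕.χ (x j) else 0

theorem baseMatrix_add (x : Fin m → X) {i j : Fin m} (h : i ≠ j) :
    𝓕.baseMatrix x i j + 𝓕.baseMatrix x j i = 𝓕.χ (x i) * 𝓕.χ (x j) := by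
  unfold baseMatrix
  rcases lt_or_gt_of_ne h with h | h
  · rw [if_pos h, if_neg h.not_gt, add_zero]
  · rw [if_pos h, if_neg h.not_gt, zero_add, mul_comm]

/-- Given the symbol vectors, the admissible matrices form a coset of the symmetric matrices. -/
def configEquiv (m : ℕ) : (Fin m → X) × symMatrix m ≃ 𝓕.Config m where
  toFun p := ⟨(p.1, 𝓕.baseMatrix p.1 + p.2.1), fun i j h => by
    have hs : p.2.1 j i = p.2.1 i j := congr_fun (congr_fun (mem_symMatrix.1 p.2.2) i) j
    simp only [Matrix.add_apply]
    rw [hs, add_add_add_comm, CharTwo.add_self_eq_zero, add_zero, 𝓕.baseMatrix_add _ h]⟩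
  invFun q := (q.1.1, ⟨𝓕.baseMatrix q.1.1 + q.1.2, mem_symMatrix.2 (by
    ext i j
    rw [Matrix.transpose_apply, Matrix.add_apply, Matrix.add_apply]
    by_cases h : i = j
    · rw [h]
    · rw [← sub_eq_zero, CharTwo.sub_eq_add, add_add_add_comm, 𝓕.baseMatrix_add _ (Ne.symm h),
        q.2 j i (Ne.symm h), CharTwo.add_self_eq_zero])⟩)
  left_inv p := by
    refine Prod.ext rfl (Subtype.ext ?_)
    show 𝓕.baseMatrix p.1 + (𝓕.baseMatrix p.1 + p.2.1) = p.2.1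
    ext i j
    simp only [Matrix.add_apply]
    rw [← add_assoc, CharTwo.add_self_eq_zero, zero_add]
  right_inv q := by
    refine Subtype.ext (Prod.ext rfl ?_)
    show 𝓕.baseMatrix q.1.1 + (𝓕.baseMatrix q.1.1 + q.1.2) = q.1.2
    ext i j
    simp only [Matrix.add_apply]
    rw [← add_assoc, CharTwo.add_self_eq_zero, zero_add]

/-- With probability `1 / 2` the coefficient `κ k₀ x` is nonzero, and the equation then holds for
half of the `η`; otherwise the trivial bound 1 is used. This gives `1 / 2 + 1 / 2 · 1 / 2 = 3 / 4`.
-/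
theorem frac_coordinate_le [Finite X] {ρ : ℕ} (κ : Fin ρ → X →ₗ[ZMod 2] ZMod 2)
    (hκ : ∃ k, κ k ≠ 0) (φ : X → ZMod 2) :
    frac (fun p : X × (Fin ρ → ZMod 2) => ∑ k, κ k p.1 * p.2 k = φ p.1) ≤ 3 / 4 := by
  classical
  have : Fintype X := Fintype.ofFinite X
  obtain ⟨k₀, hk₀⟩ := hκ
  have hin : ∀ x, frac (fun η : Fin ρ → ZMod 2 => ∑ k, κ k x * η k = φ x) ≤
      1 / 2 + (if κ k₀ x = 0 then 1 else 0) / 2 := by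
    intro x
    by_cases hx : κ k₀ x = 0
    · rw [if_pos hx]
      exact (frac_le_one _).trans (by norm_num)
    · rw [if_neg hx]
      let ψ : (Fin ρ → ZMod 2) →ₗ[ZMod 2] ZMod 2 := ∑ k, κ k x • LinearMap.proj k
      have hψ : ∀ η, ψ η = ∑ k, κ k x * η k := fun η => by simp [ψ]
      have hne : ψ ≠ 0 := by
        intro h
        have := LinearMap.congr_fun h (Pi.single k₀ 1)
        rw [hψ] at this
        simp [Pi.single_apply] at this
        exact hx this
      have := frac_zmod_linear hne (φ x)
      simp only [hψ] at this
      rw [this]; norm_num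
  have hpos : (0 : ℝ) < Nat.card X := by exact_mod_cast Nat.card_pos
  rw [frac_prod]
  calc (∑ x, frac fun η : Fin ρ → ZMod 2 => ∑ k, κ k x * η k = φ x) / Nat.card X
      ≤ (∑ x, (1 / 2 + (if κ k₀ x = 0 then 1 else 0) / 2)) / Nat.card X := by
        gcongr with x; exact hin x
    _ = 1 / 2 + frac (fun x => κ k₀ x = 0) / 2 := by
        rw [Finset.sum_add_distrib, add_div, frac_eq_sum]
        congr 1
        · simp only [Finset.sum_const, Finset.card_univ, nsmul_eq_mul, ← Nat.card_eq_fintype_card]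
          rw [mul_div_cancel_left₀ _ hpos.ne']
        · rw [← Finset.sum_div, div_right_comm]
    _ = 3 / 4 := by rw [frac_zmod_linear hk₀]; norm_num

/-- The main counting estimate: for independent vectors `y_k` whose images under the random matrix
are prescribed and which satisfy a linear relation at each index. -/
theorem frac_config_le [Finite X] {ρ : ℕ} (κ : Fin ρ → X →ₗ[ZMod 2] ZMod 2)
    (hκ : ∃ k, κ k ≠ 0) {Θ : Type*} [Fintype Θ] (φ : Θ → X → ZMod 2)
    (h : Θ → (Fin m → X) → (Fin ρ → Fin m → ZMod 2) → Fin ρ → Fin m → ZMod 2) :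
    frac (fun ω : 𝓕.Config m => ∃ θ, ∃ y : Fin ρ → Fin m → ZMod 2, LinearIndependent (ZMod 2) y ∧
      (∀ i, ∑ k, κ k (ω.1.1 i) * y k i = φ θ (ω.1.1 i)) ∧
        ∀ k, ω.1.2.mulVec (y k) = h θ ω.1.1 y k) ≤
      (Fintype.card Θ * 2 ^ (ρ * ρ)) * (3 / 4) ^ m := by
  classical
  have : Fintype X := Fintype.ofFinite X
  refine (frac_exists_le _).trans ?_
  rw [mul_assoc, ← nsmul_eq_mul, ← Finset.card_univ]
  refine Finset.sum_le_card_nsmul _ _ _ fun θ _ => ?_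
  -- Regrouped index by index, the data at different primes are independent and the relation
  -- constrains each index separately.
  let e : (Fin m → X × (Fin ρ → ZMod 2)) ≃ (Fin m → X) × (Fin ρ → Fin m → ZMod 2) :=
    (Equiv.arrowProdEquivProdArrow (Fin m) (fun _ => X) fun _ => (Fin ρ → ZMod 2)).trans
      ((Equiv.refl _).prodCongr (Equiv.piComm _))
  have h1 : frac (fun p : (Fin m → X) × (Fin ρ → Fin m → ZMod 2) =>
      ∀ i, ∑ k, κ k (p.1 i) * p.2 k i = φ θ (p.1 i)) ≤ (3 / 4) ^ m := by
    rw [← frac_equiv e]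
    have := frac_pi (fun p : X × (Fin ρ → ZMod 2) => ∑ k, κ k p.1 * p.2 k = φ θ p.1) m
    refine (Eq.trans_le this ?_)
    exact pow_le_pow_left₀ (frac_nonneg _) (frac_coordinate_le κ hκ (φ θ)) m
  -- Union bound over `y`: each admissible `y` costs at most `2 ^ (ρ * ρ) / 2 ^ (ρ * m)`, and there
  -- are `2 ^ (ρ * m)` families in all. Only the proportion of those satisfying the relation
  -- remains.
  have h2 : ∀ x : Fin m → X, frac (fun S : symMatrix m => ∃ y : Fin ρ → Fin m → ZMod 2, LinearIndependent (ZMod 2) y ∧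
      (∀ i, ∑ k, κ k (x i) * y k i = φ θ (x i)) ∧
        ∀ k, (𝓕.baseMatrix x + S.1).mulVec (y k) = h θ x y k) ≤
      2 ^ (ρ * ρ) * frac (fun y : Fin ρ → Fin m → ZMod 2 =>
        ∀ i, ∑ k, κ k (x i) * y k i = φ θ (x i)) := by
    intro x
    refine (frac_exists_le _).trans ?_
    rw [frac_eq_sum, ← mul_div_assoc, Finset.mul_sum, Finset.sum_div]
    refine Finset.sum_le_sum fun y _ => ?_
    by_cases hy : LinearIndependent (ZMod 2) y ∧ ∀ i, ∑ k, κ k (x i) * y k i = φ θ (x i)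
    · rw [if_pos hy.2, mul_one]
      have h3 := frac_symEval_le hy.1 fun k => h θ x y k - (𝓕.baseMatrix x).mulVec (y k)
      have hc : (Nat.card (Fin ρ → Fin m → ZMod 2) : ℝ) = 2 ^ (ρ * m) := by
        simp [mul_comm ρ m, pow_mul]
      rw [hc]
      refine (frac_le_of_imp fun S hS => ?_).trans h3
      funext k
      rw [← hS.2.2 k, Matrix.add_mulVec, add_sub_cancel_left]
      rfl
    · rw [frac_of_forall_not fun S hS => hy ⟨hS.1, hS.2.1⟩]
      positivity
  rw [← frac_equiv (𝓕.configEquiv m), frac_prod]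
  rw [frac_prod] at h1
  calc _ ≤ (∑ x : Fin m → X, 2 ^ (ρ * ρ) * frac (fun y : Fin ρ → Fin m → ZMod 2 =>
        ∀ i, ∑ k, κ k (x i) * y k i = φ θ (x i))) / (Nat.card (Fin m → X) : ℝ) := by
        gcongr with x
        exact h2 x
    _ ≤ _ := by
        rw [← Finset.mul_sum, mul_div_assoc]
        gcongr

end FormData

/-! ### Radical vectors witnessing a bad configuration -/

theorem exists_pair_of_not_surjective {V Y : Type*} [AddCommGroup V] [Module (ZMod 2) V]
    [FiniteDimensional (ZMod 2) V] [AddCommGroup Y] [Module (ZMod 2) Y]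
    {ω : V →ₗ[ZMod 2] V →ₗ[ZMod 2] ZMod 2} {f g : Y →ₗ[ZMod 2] V →ₗ[ZMod 2] ZMod 2}
    (h : ¬ Function.Surjective (radRestrict ω f g)) :
    ∃ w ∈ LinearMap.ker ω, ∃ w' ∈ LinearMap.ker ω, (w ≠ 0 ∨ w' ≠ 0) ∧
      ∀ y, f y w + g y w' = 0 := by
  -- A proper subspace is killed by a nonzero functional. On a product of two duals such a
  -- functional is evaluation at a pair of radical vectors.
  rw [← LinearMap.dualMap_injective_iff, ← LinearMap.ker_eq_bot, LinearMap.ker_eq_bot'] at h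
  push Not at h
  obtain ⟨Λ, hΛ, hne⟩ := h
  obtain ⟨w, hw⟩ := (evalEquiv (ZMod 2) (LinearMap.ker ω)).surjective
    (Λ.comp (LinearMap.inl (ZMod 2) _ _))
  obtain ⟨w', hw'⟩ := (evalEquiv (ZMod 2) (LinearMap.ker ω)).surjective
    (Λ.comp (LinearMap.inr (ZMod 2) _ _))
  have e1 : ∀ φ, Λ (φ, 0) = φ w := fun φ => (LinearMap.congr_fun hw φ).symm
  have e2 : ∀ φ, Λ (0, φ) = φ w' := fun φ => (LinearMap.congr_fun hw' φ).symm
  have e3 : ∀ φ ψ, Λ (φ, ψ) = φ w + ψ w' := fun φ ψ => by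
    rw [← e1, ← e2, ← map_add]; simp
  refine ⟨w, w.2, w', w'.2, ?_, fun y => ?_⟩
  · by_contra hc
    push Not at hc
    have hw0 : w = 0 := Subtype.ext hc.1
    have hw0' : w' = 0 := Subtype.ext hc.2
    apply hne
    apply LinearMap.ext
    rintro ⟨φ, ψ⟩
    rw [e3, hw0, hw0']
    simp
  · have := LinearMap.congr_fun hΛ y
    rw [LinearMap.dualMap_apply] at this
    exact (e3 _ _).symm.trans this

namespace FormData

variable {X Z : Type*} [AddCommGroup X] [Module (ZMod 2) X] [AddCommGroup Z] [Module (ZMod 2) Z]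
  (𝓕 : FormData X Z) {m : ℕ}

/-- Restoring the diagonal makes the sum depend on `u` only through `∑ u_j x_j` and the entry at
`i`. A Gram matrix thus enters through a single element of the finite space `X`. -/
theorem sum_offDiag {β : X →ₗ[ZMod 2] X →ₗ[ZMod 2] ZMod 2} {b : X →ₗ[ZMod 2] ZMod 2}
    (hb : ∀ x, β x x = b x) (x : Fin m → X) (u : Fin m → ZMod 2) (i : Fin m) :
    ∑ j, offDiag β x i j * u j = β (x i) (∑ j, u j • x j) + b (x i) * u i := by
  have h : ∀ j, offDiag β x i j * u j = u j * β (x i) (x j) + if i = j then b (x i) * u i else 0 := by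
    intro j
    unfold offDiag
    split_ifs with hij
    · subst hij
      rw [hb, mul_comm (u i), CharTwo.add_self_eq_zero, zero_mul]
    · ring
  simp only [h, Finset.sum_add_distrib, map_sum, map_smul, smul_eq_mul, Finset.sum_ite_eq,
    Finset.mem_univ, if_true]

/-- Reciprocity makes `A` and its transpose differ by the rank-one matrix `χ(x_i) χ(x_j)` with its
diagonal removed. -/
theorem sum_transpose (ω : 𝓕.Config m) (v : Fin m → ZMod 2) (i : Fin m) :
    ∑ j, ω.1.2 j i * v j = ∑ j, ω.1.2 i j * v j +
      (𝓕.χ (ω.1.1 i) * 𝓕.χ (∑ j, v j • ω.1.1 j) + 𝓕.χ (ω.1.1 i) * v i) := by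
  have hsq : ∀ a : ZMod 2, a * a = a := by decide
  have h : ∀ j, ω.1.2 j i * v j = ω.1.2 i j * v j + (𝓕.χ (ω.1.1 i) * (v j * 𝓕.χ (ω.1.1 j)) +
      if i = j then 𝓕.χ (ω.1.1 i) * v i else 0) := by
    intro j
    split_ifs with hij
    · subst hij
      rw [mul_left_comm, hsq, mul_comm (v i), CharTwo.add_self_eq_zero, add_zero]
    · have := ω.2 i j hij
      have h2 : ω.1.2 j i = ω.1.2 i j + 𝓕.χ (ω.1.1 i) * 𝓕.χ (ω.1.1 j) := by
        rw [← this, ← add_assoc, CharTwo.add_self_eq_zero, zero_add]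
      rw [h2]; ring
  simp only [h, Finset.sum_add_distrib, map_sum, map_smul, smul_eq_mul, Finset.sum_ite_eq,
    Finset.mem_univ, if_true, Finset.mul_sum]

/-- The radical vectors `(u, v, z)`, `(v, v', z')` witnessing a bad configuration. -/
structure BadPair (ω : 𝓕.Config m) where
  t : Fin 3 → Fin m → ZMod 2
  z : Z
  z' : Z
  ne : t ≠ 0 ∨ z ≠ 0 ∨ z' ≠ 0
  row₁ : ∀ i, 𝓕.β₁ (ω.1.1 i) (∑ j, t 0 j • ω.1.1 j) + 𝓕.b₁ (ω.1.1 i) * t 0 i +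
    ∑ j, ω.1.2 j i * t 1 j + 𝓕.l₁ z (ω.1.1 i) = 0
  row₂ : ∀ i, ∑ j, ω.1.2 i j * t 0 j + (𝓕.β₂ (ω.1.1 i) (∑ j, t 1 j • ω.1.1 j) +
    𝓕.b₂ (ω.1.1 i) * t 1 i) + 𝓕.l₂ z (ω.1.1 i) = 0
  row₁' : ∀ i, 𝓕.β₁ (ω.1.1 i) (∑ j, t 1 j • ω.1.1 j) + 𝓕.b₁ (ω.1.1 i) * t 1 i +
    ∑ j, ω.1.2 j i * t 2 j + 𝓕.l₁ z' (ω.1.1 i) = 0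
  row₂' : ∀ i, ∑ j, ω.1.2 i j * t 1 j + (𝓕.β₂ (ω.1.1 i) (∑ j, t 2 j • ω.1.1 j) +
    𝓕.b₂ (ω.1.1 i) * t 2 i) + 𝓕.l₂ z' (ω.1.1 i) = 0
  border : t = 0 → 𝓕.C z = 0 ∧ 𝓕.C z' = 0
  functional : ∀ x, 𝓕.β₁ x (∑ j, t 0 j • ω.1.1 j) + 𝓕.χ (∑ j, t 1 j • ω.1.1 j) * 𝓕.χ x +
    𝓕.β₂ x (∑ j, t 2 j • ω.1.1 j) + 𝓕.l₁ z x + 𝓕.l₂ z' x = 0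

/-- Write the annihilating radical vectors as `(u, v, z)` and `(u', v', z')`. Testing against a new
prime with zero symbol vector and one nonzero pair symbol forces `u' = v`; testing against zero pair
symbols yields the field `functional`. -/
theorem nonempty_badPair [Finite Z] {ω : 𝓕.Config m} (h : ¬ 𝓕.Good ω) :
    Nonempty (𝓕.BadPair ω) := by
  obtain ⟨⟨u, v, z⟩, hw, ⟨u', v', z'⟩, hw', hne, hy⟩ := exists_pair_of_not_surjective h
  have huv : u' = v := by
    funext i
    have := hy (0, Pi.single i 1)
    simp [newFun₁_apply, newFun₂_apply, Pi.single_apply] at this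
    exact (CharTwo.add_eq_zero.1 this).symm
  subst huv
  obtain ⟨h1, h2, h3⟩ := 𝓕.eqs_of_mem_ker hw
  obtain ⟨h1', h2', h3'⟩ := 𝓕.eqs_of_mem_ker hw'
  simp only [sum_offDiag 𝓕.β₁_diag, sum_offDiag 𝓕.β₂_diag] at h1 h2 h1' h2'
  refine ⟨⟨![u, u', v'], z, z', ?_, h1, h2, h1', h2', ?_, ?_⟩⟩
  · by_contra hc
    push Not at hc
    obtain ⟨ht, rfl, rfl⟩ := hc
    have a0 : u = 0 := congr_fun ht 0
    have a1 : u' = 0 := congr_fun ht 1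
    have a2 : v' = 0 := congr_fun ht 2
    subst a0 a1 a2
    simp at hne
  · intro ht
    have a0 : u = 0 := congr_fun ht 0
    have a1 : u' = 0 := congr_fun ht 1
    have a2 : v' = 0 := congr_fun ht 2
    subst a0 a1 a2
    exact ⟨LinearMap.ext fun x => by simpa using h3 x, LinearMap.ext fun x => by simpa using h3' x⟩
  · intro x
    have := hy (x, 0)
    simp only [newFun₁_apply, newFun₂_apply, Pi.zero_apply, zero_mul, zero_add,
      Finset.sum_const_zero, add_zero] at this
    simp only [Matrix.cons_val_zero, Matrix.cons_val_one, Matrix.cons_val_two, Matrix.tail_cons,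
      Matrix.head_cons, map_sum, map_smul, smul_eq_mul, Finset.sum_mul]
    have e : ∑ j, 𝓕.χ (ω.1.1 j) * 𝓕.χ x * u' j = ∑ j, u' j * 𝓕.χ (ω.1.1 j) * 𝓕.χ x :=
      Finset.sum_congr rfl fun j _ => by ring
    rw [← this, e]
    simp only [mul_comm (𝓕.β₁ x _), mul_comm (𝓕.β₂ x _)]
    ring

variable {𝓕} {ω : 𝓕.Config m} (P : 𝓕.BadPair ω)

/-- The key relation at each prime satisfied by a bad pair. -/
theorem BadPair.relation (i : Fin m) :
    𝓕.b₁ (ω.1.1 i) * P.t 0 i + 𝓕.χ (ω.1.1 i) * P.t 1 i + 𝓕.b₂ (ω.1.1 i) * P.t 2 i = 0 := by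
  have h1 := P.row₁ i
  have h2 := P.row₂' i
  have h3 := P.functional (ω.1.1 i)
  rw [𝓕.sum_transpose] at h1
  have two : (2 : ZMod 2) = 0 := rfl
  -- In this sum the matrix terms cancel by reciprocity, and the Gram and border terms cancel
  -- against `functional`. Only the diagonal corrections survive, and they form the relation.
  linear_combination h1 + h2 + h3 - (𝓕.β₁ (ω.1.1 i) (∑ j, P.t 0 j • ω.1.1 j) +
    𝓕.χ (∑ j, P.t 1 j • ω.1.1 j) * 𝓕.χ (ω.1.1 i) + 𝓕.β₂ (ω.1.1 i) (∑ j, P.t 2 j • ω.1.1 j) +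
    𝓕.l₁ P.z (ω.1.1 i) + 𝓕.l₂ P.z' (ω.1.1 i) + ∑ j, ω.1.2 i j * P.t 1 j) * two

/-- The values of the random matrix on the vectors of a bad pair. -/
noncomputable def prescribed (𝓕 : FormData X Z) (θ : Z × Z) (x : Fin m → X)
    (t : Fin 3 → Fin m → ZMod 2) (k : Fin 3) (i : Fin m) : ZMod 2 :=
  ![𝓕.β₂ (x i) (∑ j, t 1 j • x j) + 𝓕.b₂ (x i) * t 1 i + 𝓕.l₂ θ.1 (x i),
    𝓕.β₂ (x i) (∑ j, t 2 j • x j) + 𝓕.b₂ (x i) * t 2 i + 𝓕.l₂ θ.2 (x i),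
    𝓕.β₁ (x i) (∑ j, t 1 j • x j) + 𝓕.b₁ (x i) * t 1 i + 𝓕.l₁ θ.2 (x i) +
      (𝓕.χ (x i) * 𝓕.χ (∑ j, t 2 j • x j) + 𝓕.χ (x i) * t 2 i)] k

/-- The images of the first two vectors are read off from the second-block equations. The third
vector occurs only under the transpose, in `row₁'`, and is converted by reciprocity. -/
theorem BadPair.mulVec (k : Fin 3) :
    ω.1.2.mulVec (P.t k) = 𝓕.prescribed (P.z, P.z') ω.1.1 P.t k := by
  funext i
  rw [← sub_eq_zero, CharTwo.sub_eq_add]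
  fin_cases k
  · exact (P.row₂ i).symm.trans (by
      simp [prescribed, Matrix.mulVec, dotProduct]; ring) |>.symm
  · exact (P.row₂' i).symm.trans (by
      simp [prescribed, Matrix.mulVec, dotProduct]; ring) |>.symm
  · have h := P.row₁' i
    rw [𝓕.sum_transpose] at h
    exact h.symm.trans (by
      simp [prescribed, Matrix.mulVec, dotProduct]; ring) |>.symm

end FormData

theorem linearIndependent_single {V : Type*} [AddCommGroup V] [Module (ZMod 2) V] {u : V}
    (hu : u ≠ 0) : LinearIndependent (ZMod 2) ![u] := by
  rw [Fintype.linearIndependent_iff]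
  intro g hg
  simp only [Fin.sum_univ_one, Matrix.cons_val_fin_one] at hg
  intro i
  fin_cases i
  exact (smul_eq_zero.1 hg).resolve_right hu

theorem zmod_two_cases (a : ZMod 2) : a = 0 ∨ a = 1 := by
  revert a; decide

theorem add_eq_zero_iff_of_zmod_two {V : Type*} [AddCommGroup V] [Module (ZMod 2) V] {u v : V} :
    u + v = 0 ↔ u = v := by
  rw [add_eq_zero_iff_eq_neg, ← neg_one_smul (ZMod 2) v, show (-1 : ZMod 2) = 1 from rfl, one_smul]

theorem linearIndependent_pair {V : Type*} [AddCommGroup V] [Module (ZMod 2) V] {u v : V}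
    (hu : u ≠ 0) (hv : v ≠ 0) (huv : u ≠ v) : LinearIndependent (ZMod 2) ![u, v] := by
  rw [Fintype.linearIndependent_iff]
  intro g hg
  simp only [Fin.sum_univ_two, Matrix.cons_val_zero, Matrix.cons_val_one] at hg
  have h : g 0 = 0 ∧ g 1 = 0 := by
    rcases zmod_two_cases (g 0) with h0 | h0 <;> rcases zmod_two_cases (g 1) with h1 | h1 <;>
      simp [h0, h1, hu, hv, add_eq_zero_iff_of_zmod_two, huv] at hg ⊢
  intro i
  fin_cases i
  exacts [h.1, h.2]

theorem linearIndependent_triple {V : Type*} [AddCommGroup V] [Module (ZMod 2) V] {u v w : V}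
    (hu : u ≠ 0) (hv : v ≠ 0) (hw : w ≠ 0) (huv : u ≠ v) (hvw : v ≠ w) (huw : u ≠ w)
    (h3 : u + v ≠ w) : LinearIndependent (ZMod 2) ![u, v, w] := by
  rw [Fintype.linearIndependent_iff]
  intro g hg
  simp only [Fin.sum_univ_three, Matrix.cons_val_zero, Matrix.cons_val_one, Matrix.cons_val_two,
    Matrix.tail_cons, Matrix.head_cons] at hg
  have h : g 0 = 0 ∧ g 1 = 0 ∧ g 2 = 0 := by
    rcases zmod_two_cases (g 0) with h0 | h0 <;> rcases zmod_two_cases (g 1) with h1 | h1 <;>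
      rcases zmod_two_cases (g 2) with h2 | h2 <;>
      simp [h0, h1, h2, hu, hv, hw, add_eq_zero_iff_of_zmod_two, huv, hvw, huw, h3] at hg ⊢
  intro i
  fin_cases i
  exacts [h.1, h.2.1, h.2.2]

/-! ### Bad configurations are exponentially rare -/

namespace FormData

variable {X Z : Type*} [AddCommGroup X] [Module (ZMod 2) X] [AddCommGroup Z] [Module (ZMod 2) Z]
  (𝓕 : FormData X Z) {m : ℕ}

/-- Events whose probability decays geometrically. -/
def Negligible (P : ∀ m, 𝓕.Config m → Prop) : Prop :=
  ∃ C : ℝ, ∀ m, frac (P m) ≤ C * (3 / 4) ^ m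

variable {𝓕}

theorem Negligible.mono [Finite X] {P Q : ∀ m, 𝓕.Config m → Prop} (hQ : 𝓕.Negligible Q)
    (h : ∀ m ω, P m ω → Q m ω) : 𝓕.Negligible P := by
  obtain ⟨C, hC⟩ := hQ
  exact ⟨C, fun m => (frac_le_of_imp (h m)).trans (hC m)⟩

theorem Negligible.or [Finite X] {P Q : ∀ m, 𝓕.Config m → Prop} (hP : 𝓕.Negligible P)
    (hQ : 𝓕.Negligible Q) : 𝓕.Negligible fun m ω => P m ω ∨ Q m ω := by
  obtain ⟨C, hC⟩ := hP
  obtain ⟨C', hC'⟩ := hQ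
  refine ⟨C + C', fun m => (frac_or_le _ _).trans ?_⟩
  rw [add_mul]
  exact add_le_add (hC m) (hC' m)

theorem Negligible.exists [Finite X] {ι : Type*} [Finite ι] {P : ι → ∀ m, 𝓕.Config m → Prop}
    (hP : ∀ i, 𝓕.Negligible (P i)) : 𝓕.Negligible fun m ω => ∃ i, P i m ω := by
  have : Fintype ι := Fintype.ofFinite ι
  choose C hC using hP
  refine ⟨∑ i, C i, fun m => (frac_exists_le _).trans ?_⟩
  rw [Finset.sum_mul]
  exact Finset.sum_le_sum fun i _ => hC i m

theorem Negligible.and_left [Finite X] {p : Prop} {P : ∀ m, 𝓕.Config m → Prop}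
    (hP : p → 𝓕.Negligible P) : 𝓕.Negligible fun m ω => p ∧ P m ω := by
  by_cases h : p
  · exact (hP h).mono fun _ _ h' => h'.2
  · exact ⟨0, fun m => by rw [frac_of_forall_not fun ω h' => h h'.1, zero_mul]⟩

variable (𝓕)

/-- The vectors of a bad pair are combinations, with coefficients `R`, of `ρ` independent ones among
them, which satisfy a relation at each index. -/
def RankEvent {ρ : ℕ} (c : Fin ρ → Fin 3) (R : Matrix (Fin 3) (Fin ρ) (ZMod 2))
    (κ : Fin ρ → X →ₗ[ZMod 2] ZMod 2) (φ : Z × Z × X → X → ZMod 2) (m : ℕ) (ω : 𝓕.Config m) :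
    Prop :=
  ∃ θ : Z × Z × X, ∃ y : Fin ρ → Fin m → ZMod 2, LinearIndependent (ZMod 2) y ∧
    (∀ i, ∑ k, κ k (ω.1.1 i) * y k i = φ θ (ω.1.1 i)) ∧
    ∀ k, ω.1.2.mulVec (y k) =
      𝓕.prescribed (θ.1, θ.2.1) ω.1.1 (fun a => ∑ k, R a k • y k) (c k)

theorem negligible_rankEvent [Finite X] [Finite Z] {ρ : ℕ} (c : Fin ρ → Fin 3)
    (R : Matrix (Fin 3) (Fin ρ) (ZMod 2)) (κ : Fin ρ → X →ₗ[ZMod 2] ZMod 2)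
    (φ : Z × Z × X → X → ZMod 2) (hκ : ∃ k, κ k ≠ 0) : 𝓕.Negligible (𝓕.RankEvent c R κ φ) := by
  have : Fintype X := Fintype.ofFinite X
  have : Fintype Z := Fintype.ofFinite Z
  exact ⟨_, fun m => 𝓕.frac_config_le κ hκ φ fun θ x y k =>
    𝓕.prescribed (θ.1, θ.2.1) x (fun a => ∑ k, R a k • y k) (c k)⟩

/-- The coefficients of the key relation. -/
noncomputable def relCoeff (a : Fin 3) : X →ₗ[ZMod 2] ZMod 2 := ![𝓕.b₁, 𝓕.χ, 𝓕.b₂] a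

/-- The coefficients of the key relation in terms of a basis. -/
noncomputable def relCoeffBasis {ρ : ℕ} (R : Matrix (Fin 3) (Fin ρ) (ZMod 2)) (k : Fin ρ) :
    X →ₗ[ZMod 2] ZMod 2 :=
  ∑ a, R a k • 𝓕.relCoeff a

/-- A bad pair of rank `ρ` for which the key relation is nontrivial. -/
def RelationEvent (ρ : ℕ) (m : ℕ) (ω : 𝓕.Config m) : Prop :=
  ∃ cR : (Fin ρ → Fin 3) × Matrix (Fin 3) (Fin ρ) (ZMod 2),
    (∃ k, 𝓕.relCoeffBasis cR.2 k ≠ 0) ∧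
      𝓕.RankEvent cR.1 cR.2 (𝓕.relCoeffBasis cR.2) (fun _ _ => 0) m ω

theorem negligible_relationEvent [Finite X] [Finite Z] (ρ : ℕ) :
    𝓕.Negligible (𝓕.RelationEvent ρ) := by
  have : Finite (Matrix (Fin 3) (Fin ρ) (ZMod 2)) := inferInstanceAs (Finite (Fin 3 → Fin ρ → ZMod 2))
  exact Negligible.exists fun cR => Negligible.and_left fun h => 𝓕.negligible_rankEvent _ _ _ _ h

/-- A bad pair of rank one lying in the radical of a Gram matrix. -/
def LineEvent (b : X →ₗ[ZMod 2] ZMod 2) (φ : Z × Z × X → X → ZMod 2) (m : ℕ) (ω : 𝓕.Config m) :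
    Prop :=
  ∃ cR : (Fin 1 → Fin 3) × Matrix (Fin 3) (Fin 1) (ZMod 2), 𝓕.RankEvent cR.1 cR.2 (fun _ => b) φ m ω

theorem negligible_lineEvent [Finite X] [Finite Z] {b : X →ₗ[ZMod 2] ZMod 2} (hb : b ≠ 0)
    (φ : Z × Z × X → X → ZMod 2) : 𝓕.Negligible (𝓕.LineEvent b φ) := by
  have : Finite (Matrix (Fin 3) (Fin 1) (ZMod 2)) := inferInstanceAs (Finite (Fin 3 → Fin 1 → ZMod 2))
  exact Negligible.exists fun cR => 𝓕.negligible_rankEvent _ _ _ _ ⟨0, hb⟩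

/-- A nonzero functional kills all `m` uniform vectors with probability `2 ^ (-m)`, and there are
finitely many functionals. -/
theorem negligible_vanish [Finite X] : 𝓕.Negligible fun _ ω =>
    ∃ l : X →ₗ[ZMod 2] ZMod 2, l ≠ 0 ∧ ∀ i, l (ω.1.1 i) = 0 := by
  have : Finite (X →ₗ[ZMod 2] ZMod 2) := Module.finite_of_finite (ZMod 2)
  refine Negligible.exists fun l => Negligible.and_left fun hl => ⟨1, fun m => ?_⟩
  have h1 := frac_fst (β := symMatrix m) fun x : Fin m → X => ∀ i, l (x i) = 0
  rw [← frac_equiv (𝓕.configEquiv m)]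
  refine Eq.trans_le h1 ?_
  rw [frac_pi fun x => l x = 0, frac_zmod_linear hl, one_mul]
  exact pow_le_pow_left₀ (by norm_num) (by norm_num) m

variable {𝓕} {ω : 𝓕.Config m} (P : 𝓕.BadPair ω)

/-- The parameters `z`, `z'` and `Y` range over a finite set that does not grow with `m`, so a union
bound over them is harmless. Here `Y` leaves room for a sum `∑ t_j x_j`, which the relation at each
index could not otherwise contain. -/
theorem BadPair.rankEvent {ρ : ℕ} (c : Fin ρ → Fin 3) (R : Matrix (Fin 3) (Fin ρ) (ZMod 2))
    (κ : Fin ρ → X →ₗ[ZMod 2] ZMod 2) (φ : Z × Z × X → X → ZMod 2) (Y : X)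
    (hy : LinearIndependent (ZMod 2) fun k => P.t (c k))
    (ht : ∀ a, P.t a = ∑ k, R a k • P.t (c k))
    (hκ : ∀ i, ∑ k, κ k (ω.1.1 i) * P.t (c k) i = φ (P.z, P.z', Y) (ω.1.1 i)) :
    𝓕.RankEvent c R κ φ m ω := by
  refine ⟨(P.z, P.z', Y), fun k => P.t (c k), hy, hκ, fun k => ?_⟩
  rw [P.mulVec]
  congr 1
  exact funext ht

theorem BadPair.relationEvent {ρ : ℕ} (c : Fin ρ → Fin 3) (R : Matrix (Fin 3) (Fin ρ) (ZMod 2))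
    (hy : LinearIndependent (ZMod 2) fun k => P.t (c k))
    (ht : ∀ a, P.t a = ∑ k, R a k • P.t (c k)) (h : ∃ k, 𝓕.relCoeffBasis R k ≠ 0) :
    𝓕.RelationEvent ρ m ω := by
  refine ⟨(c, R), h, P.rankEvent c R _ _ 0 hy ht fun i => ?_⟩
  have hr := P.relation i
  have h1 : ∑ a, 𝓕.relCoeff a (ω.1.1 i) * P.t a i = 0 := by
    rw [Fin.sum_univ_three]; exact hr
  rw [← h1]
  simp only [relCoeffBasis, LinearMap.sum_apply, LinearMap.smul_apply, smul_eq_mul, Finset.sum_mul]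
  rw [Finset.sum_comm]
  refine Finset.sum_congr rfl fun a _ => ?_
  conv_rhs => rw [ht a]
  rw [Finset.sum_apply, Finset.mul_sum]
  refine Finset.sum_congr rfl fun k _ => ?_
  simp only [Pi.smul_apply, smul_eq_mul]
  ring

end FormData

namespace FormData

variable {X Z : Type*} [AddCommGroup X] [Module (ZMod 2) X] [AddCommGroup Z] [Module (ZMod 2) Z]
  {𝓕 : FormData X Z} {m : ℕ}

section

variable {ω : 𝓕.Config m} (P : 𝓕.BadPair ω)

theorem BadPair.lineEvent (a : Fin 3) (r : Fin 3 → ZMod 2) (hne : P.t a ≠ 0)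
    (ht : ∀ a', P.t a' = r a' • P.t a) {b : X →ₗ[ZMod 2] ZMod 2} {φ : Z × Z × X → X → ZMod 2} (Y : X)
    (h : ∀ i, b (ω.1.1 i) * P.t a i = φ (P.z, P.z', Y) (ω.1.1 i)) : 𝓕.LineEvent b φ m ω := by
  refine ⟨(fun _ => a, fun a' _ => r a'), P.rankEvent _ _ _ _ Y ?_ ?_ ?_⟩
  · have hf : (fun _ : Fin 1 => P.t a) = ![P.t a] := by ext i; simp
    exact hf ▸ linearIndependent_single hne
  · intro a'
    rw [Fin.sum_univ_one]; exact ht a'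
  · intro i
    rw [Fin.sum_univ_one]; exact h i

theorem BadPair.relationEvent_one (hne : P.t 0 ≠ 0) (h1 : P.t 1 = P.t 0) (h2 : P.t 2 = P.t 0)
    (h : 𝓕.b₁ + 𝓕.χ + 𝓕.b₂ ≠ 0) : 𝓕.RelationEvent 1 m ω := by
  refine P.relationEvent (fun _ => 0) (fun _ _ => 1) ?_ ?_ ⟨0, ?_⟩
  · have hf : (fun _ : Fin 1 => P.t 0) = ![P.t 0] := by ext i; simp
    exact hf ▸ linearIndependent_single hne
  · intro a
    rw [Fin.sum_univ_one, one_smul]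
    fin_cases a
    exacts [rfl, h1, h2]
  · simpa [relCoeffBasis, relCoeff, Fin.sum_univ_three] using h

theorem BadPair.relationEvent_two (a b : Fin 3) (r s : Fin 3 → ZMod 2) (ha : P.t a ≠ 0)
    (hb : P.t b ≠ 0) (hab : P.t a ≠ P.t b) (ht : ∀ i, P.t i = r i • P.t a + s i • P.t b)
    (h : r 0 • 𝓕.b₁ + r 1 • 𝓕.χ + r 2 • 𝓕.b₂ ≠ 0 ∨ s 0 • 𝓕.b₁ + s 1 • 𝓕.χ + s 2 • 𝓕.b₂ ≠ 0) :
    𝓕.RelationEvent 2 m ω := by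
  refine P.relationEvent ![a, b] (fun i => ![r i, s i]) ?_ ?_ ?_
  · have hf : (fun k => P.t (![a, b] k)) = ![P.t a, P.t b] := by ext k; fin_cases k <;> rfl
    exact hf ▸ linearIndependent_pair ha hb hab
  · intro i
    rw [Fin.sum_univ_two]; exact ht i
  · rcases h with h | h
    · exact ⟨0, by simpa [relCoeffBasis, relCoeff, Fin.sum_univ_three] using h⟩
    · exact ⟨1, by simpa [relCoeffBasis, relCoeff, Fin.sum_univ_three] using h⟩

theorem BadPair.relationEvent_three (h0 : P.t 0 ≠ 0) (h1 : P.t 1 ≠ 0) (h2 : P.t 2 ≠ 0)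
    (h01 : P.t 0 ≠ P.t 1) (h12 : P.t 1 ≠ P.t 2) (h02 : P.t 0 ≠ P.t 2)
    (h3 : P.t 0 + P.t 1 ≠ P.t 2) (hb : 𝓕.b₁ ≠ 0) : 𝓕.RelationEvent 3 m ω := by
  refine P.relationEvent id 1 ?_ ?_ ⟨0, ?_⟩
  · have hf : (fun k => P.t (id k)) = ![P.t 0, P.t 1, P.t 2] := by ext k; fin_cases k <;> rfl
    exact hf ▸ linearIndependent_triple h0 h1 h2 h01 h12 h02 h3
  · intro a
    simp [Matrix.one_apply]
  · simpa [relCoeffBasis, relCoeff, Fin.sum_univ_three, Matrix.one_apply] using hb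

/-- When a vector of the pair is zero, some row equation loses its matrix term and relates another
vector to the symbols alone. The next three lemmas do the same for the other rows. -/
theorem BadPair.line₁ (h1 : P.t 1 = 0) (i : Fin m) :
    𝓕.b₁ (ω.1.1 i) * P.t 0 i =
      𝓕.β₁ (ω.1.1 i) (∑ j, P.t 0 j • ω.1.1 j) + 𝓕.l₁ P.z (ω.1.1 i) := by
  have := P.row₁ i
  simp only [h1, Pi.zero_apply, mul_zero, Finset.sum_const_zero, add_zero] at this
  rw [← CharTwo.add_eq_zero, ← this]; ring

theorem BadPair.line₁' (h2 : P.t 2 = 0) (i : Fin m) :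
    𝓕.b₁ (ω.1.1 i) * P.t 1 i =
      𝓕.β₁ (ω.1.1 i) (∑ j, P.t 1 j • ω.1.1 j) + 𝓕.l₁ P.z' (ω.1.1 i) := by
  have := P.row₁' i
  simp only [h2, Pi.zero_apply, mul_zero, Finset.sum_const_zero, add_zero] at this
  rw [← CharTwo.add_eq_zero, ← this]; ring

theorem BadPair.line₂ (h0 : P.t 0 = 0) (i : Fin m) :
    𝓕.b₂ (ω.1.1 i) * P.t 1 i =
      𝓕.β₂ (ω.1.1 i) (∑ j, P.t 1 j • ω.1.1 j) + 𝓕.l₂ P.z (ω.1.1 i) := by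
  have := P.row₂ i
  simp only [h0, Pi.zero_apply, mul_zero, Finset.sum_const_zero, zero_add] at this
  rw [← CharTwo.add_eq_zero, ← this]; ring

theorem BadPair.line₂' (h1 : P.t 1 = 0) (i : Fin m) :
    𝓕.b₂ (ω.1.1 i) * P.t 2 i =
      𝓕.β₂ (ω.1.1 i) (∑ j, P.t 2 j • ω.1.1 j) + 𝓕.l₂ P.z' (ω.1.1 i) := by
  have := P.row₂' i
  simp only [h1, Pi.zero_apply, mul_zero, Finset.sum_const_zero, zero_add] at this
  rw [← CharTwo.add_eq_zero, ← this]; ring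

/-- With all three vectors zero, the rows say that the border functionals of `z` and `z'` vanish at
every `x_i`. Unless some nonzero functional kills all `x_i`, these functionals are zero, and `hZ`
then makes `z` and `z'` zero. -/
theorem BadPair.vanish (ht : P.t = 0)
    (hZ : ∀ z, 𝓕.l₁ z = 0 → 𝓕.l₂ z = 0 → 𝓕.C z = 0 → z = 0) :
    ∃ l : X →ₗ[ZMod 2] ZMod 2, l ≠ 0 ∧ ∀ i, l (ω.1.1 i) = 0 := by
  obtain ⟨hC, hC'⟩ := P.border ht
  have t0 : P.t 0 = 0 := by rw [ht]; rfl
  have t1 : P.t 1 = 0 := by rw [ht]; rfl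
  have t2 : P.t 2 = 0 := by rw [ht]; rfl
  have a1 : ∀ i, 𝓕.l₁ P.z (ω.1.1 i) = 0 := fun i => by simpa [t0] using (P.line₁ t1 i).symm
  have a2 : ∀ i, 𝓕.l₂ P.z (ω.1.1 i) = 0 := fun i => by simpa [t1] using (P.line₂ t0 i).symm
  have a3 : ∀ i, 𝓕.l₁ P.z' (ω.1.1 i) = 0 := fun i => by simpa [t1] using (P.line₁' t2 i).symm
  have a4 : ∀ i, 𝓕.l₂ P.z' (ω.1.1 i) = 0 := fun i => by simpa [t2] using (P.line₂' t1 i).symm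
  by_contra hc
  push Not at hc
  have key : ∀ l : X →ₗ[ZMod 2] ZMod 2, (∀ i, l (ω.1.1 i) = 0) → l = 0 := by
    intro l hl
    by_contra hne
    obtain ⟨i, hi⟩ := hc l hne
    exact hi (hl i)
  rcases P.ne with h | h | h
  · exact h ht
  · exact h (hZ _ (key _ a1) (key _ a2) hC)
  · exact h (hZ _ (key _ a3) (key _ a4) hC')

end

/-- Bad configurations are exponentially rare. -/
theorem negligible_not_good [Finite X] [Finite Z] (hχ : 𝓕.χ ≠ 0) (hb₁ : 𝓕.b₁ ≠ 0) (hb₂ : 𝓕.b₂ ≠ 0)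
    (hsum : 𝓕.b₁ + 𝓕.χ + 𝓕.b₂ ≠ 0) (hne : 𝓕.b₁ ≠ 𝓕.χ ∨ 𝓕.b₂ ≠ 𝓕.χ)
    (hZ : ∀ z, 𝓕.l₁ z = 0 → 𝓕.l₂ z = 0 → 𝓕.C z = 0 → z = 0) :
    𝓕.Negligible fun _ ω => ¬ 𝓕.Good ω := by
  refine Negligible.mono
    ((𝓕.negligible_relationEvent 1).or <| (𝓕.negligible_relationEvent 2).or <|
      (𝓕.negligible_relationEvent 3).or <|
      (𝓕.negligible_lineEvent hb₁ fun θ x => 𝓕.β₁ x θ.2.2 + 𝓕.l₁ θ.1 x).or <|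
      (𝓕.negligible_lineEvent hb₁ fun θ x => 𝓕.β₁ x θ.2.2 + 𝓕.l₁ θ.2.1 x).or <|
      (𝓕.negligible_lineEvent hb₂ fun θ x => 𝓕.β₂ x θ.2.2 + 𝓕.l₂ θ.1 x).or <|
      (𝓕.negligible_lineEvent hb₂ fun θ x => 𝓕.β₂ x θ.2.2 + 𝓕.l₂ θ.2.1 x).or 𝓕.negligible_vanish)
    fun m ω hω => ?_
  obtain ⟨P⟩ := 𝓕.nonempty_badPair hω
  have three : ∀ {Q : Fin 3 → Prop}, Q 0 → Q 1 → Q 2 → ∀ a, Q a := by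
    intro Q q0 q1 q2 a
    fin_cases a
    exacts [q0, q1, q2]
  -- The cases are the possible coincidences among `0, u, v, v'`. Every rank-one pattern except `u =
  -- v = v'` contains a zero vector and gives a line event; the pattern `u = v = v'` is where `b₁ +
  -- χ + b₂ ≠ 0` is needed. In higher rank some coefficient of the key relation is nonzero.
  by_cases hv : P.t 1 = 0
  · by_cases hu : P.t 0 = 0
    · by_cases hw : P.t 2 = 0
      · exact .inr <| .inr <| .inr <| .inr <| .inr <| .inr <| .inr <|
          P.vanish (funext (three hu hv hw)) hZ
      · exact .inr <| .inr <| .inr <| .inr <| .inr <| .inr <| .inl <|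
          P.lineEvent 2 ![0, 0, 1] hw (three (by simp [hu]) (by simp [hv]) (by simp)) _
            (P.line₂' hv)
    · by_cases hw : P.t 2 = 0
      · exact .inr <| .inr <| .inr <| .inl <|
          P.lineEvent 0 ![1, 0, 0] hu (three (by simp) (by simp [hv]) (by simp [hw])) _ (P.line₁ hv)
      by_cases huw : P.t 0 = P.t 2
      · exact .inr <| .inr <| .inr <| .inl <|
          P.lineEvent 0 ![1, 0, 1] hu (three (by simp) (by simp [hv]) (by simp [huw])) _
            (P.line₁ hv)
      · exact .inr <| .inl <| P.relationEvent_two 0 2 ![1, 0, 0] ![0, 0, 1] hu hw huw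
          (three (by simp) (by simp [hv]) (by simp)) (.inl (by simpa using hb₁))
  · by_cases hu : P.t 0 = 0
    · by_cases hw : P.t 2 = 0
      · exact .inr <| .inr <| .inr <| .inr <| .inr <| .inl <|
          P.lineEvent 1 ![0, 1, 0] hv (three (by simp [hu]) (by simp) (by simp [hw])) _ (P.line₂ hu)
      by_cases hvw : P.t 1 = P.t 2
      · exact .inr <| .inr <| .inr <| .inr <| .inr <| .inl <|
          P.lineEvent 1 ![0, 1, 1] hv (three (by simp [hu]) (by simp) (by simp [hvw])) _
            (P.line₂ hu)
      · exact .inr <| .inl <| P.relationEvent_two 1 2 ![0, 1, 0] ![0, 0, 1] hv hw hvw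
          (three (by simp [hu]) (by simp) (by simp)) (.inl (by simpa using hχ))
    by_cases huv : P.t 0 = P.t 1
    · by_cases hw : P.t 2 = 0
      · exact .inr <| .inr <| .inr <| .inr <| .inl <|
          P.lineEvent 1 ![1, 1, 0] hv (three (by simp [huv]) (by simp) (by simp [hw])) _
            (P.line₁' hw)
      by_cases hvw : P.t 1 = P.t 2
      · exact .inl <| P.relationEvent_one hu huv.symm (hvw.symm.trans huv.symm) hsum
      · exact .inr <| .inl <| P.relationEvent_two 1 2 ![1, 1, 0] ![0, 0, 1] hv hw hvw
          (three (by simp [huv]) (by simp) (by simp)) (.inr (by simpa using hb₂))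
    by_cases hw : P.t 2 = 0
    · exact .inr <| .inl <| P.relationEvent_two 0 1 ![1, 0, 0] ![0, 1, 0] hu hv huv
        (three (by simp) (by simp) (by simp [hw])) (.inl (by simpa using hb₁))
    by_cases hvw : P.t 1 = P.t 2
    · exact .inr <| .inl <| P.relationEvent_two 0 1 ![1, 0, 0] ![0, 1, 1] hu hv huv
        (three (by simp) (by simp) (by simp [hvw])) (.inl (by simpa using hb₁))
    by_cases huw : P.t 0 = P.t 2
    · exact .inr <| .inl <| P.relationEvent_two 0 1 ![1, 0, 1] ![0, 1, 0] hu hv huv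
        (three (by simp) (by simp) (by simp [huw])) (.inr (by simpa using hχ))
    -- In terms of `u` and `v` the relation has coefficients `b₁ + b₂` and `χ + b₂`. Both vanish
    -- only for `b₁ = χ = b₂`, which `hne` excludes.
    by_cases h3 : P.t 0 + P.t 1 = P.t 2
    · refine .inr <| .inl <| P.relationEvent_two 0 1 ![1, 0, 1] ![0, 1, 1] hu hv huv
        (three (by simp) (by simp) (by simp [h3])) ?_
      by_contra hc
      push Not at hc
      simp [add_eq_zero_iff_of_zmod_two] at hc
      rcases hne with h | h
      · exact h (hc.1.trans hc.2.symm)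
      · exact h hc.2.symm
    · exact .inr <| .inr <| .inl <| P.relationEvent_three hu hv hw huv hvw huw h3 hb₁

end FormData

/-! ### The form data attached to the input data -/

namespace Data

variable (S : Data)

/-- The space of symbol vectors `((-1/p)₊, ((q/p)₊)_q)`. -/
abbrev SymbolSpace := ZMod 2 × ((2 * S.D).primeFactors → ZMod 2)

/-- The space spanned by the sums of the first and of the second `r` basis vectors and the last `t`
basis vectors. -/
abbrev BorderSpace := ZMod 2 × ZMod 2 × (Fin S.t → ZMod 2)

/-- The symbol `(d/·)₊` as a functional of the symbol vector. -/
noncomputable def divFun (d : ℤ) : S.SymbolSpace →ₗ[ZMod 2] ZMod 2 :=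
  (if d < 0 then LinearMap.fst _ _ _ else 0) +
    ∑ q : (2 * S.D).primeFactors,
      if ((q : ℕ) : ℤ) ∣ d then (LinearMap.proj q).comp (LinearMap.snd _ _ _) else 0

/-- The symbol vector of a number. -/
def symbolVector (n : ℕ) : S.SymbolSpace := (addSym (-1) n, fun q => addSym ((q : ℕ) : ℤ) n)

theorem divFun_apply (d : ℤ) (x : S.SymbolSpace) :
    S.divFun d x = (if d < 0 then x.1 else 0) +
      ∑ q : (2 * S.D).primeFactors, if ((q : ℕ) : ℤ) ∣ d then x.2 q else 0 := by
  rw [divFun, LinearMap.add_apply, LinearMap.sum_apply]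
  congr 1
  · split_ifs <;> rfl
  · refine Finset.sum_congr rfl fun q _ => ?_
    split_ifs <;> rfl

/-- The symbol vector of the product of the primes. -/
def total : S.SymbolSpace := S.symbolVector S.n₀.natAbs

/-- The Gram form `∑_{d ∈ Q} (d/·)₊ (d/·)₊`. -/
noncomputable def gram (Q : List ℤ) : S.SymbolSpace →ₗ[ZMod 2] S.SymbolSpace →ₗ[ZMod 2] ZMod 2 :=
  (Q.map fun d => (S.divFun d).smulRight (S.divFun d)).sum

theorem gram_apply (Q : List ℤ) (x y : S.SymbolSpace) :
    S.gram Q x y = (Q.map fun d => S.divFun d x * S.divFun d y).sum := by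
  unfold gram
  induction Q with
  | nil => rfl
  | cons d Q ih =>
    simp only [List.map_cons, List.sum_cons, LinearMap.add_apply, ih]
    rfl

/-- The functional `∑_{d ∈ Q} (d/·)₊`, the symbol of the product of `Q`. -/
noncomputable def listFun (Q : List ℤ) : S.SymbolSpace →ₗ[ZMod 2] ZMod 2 := (Q.map S.divFun).sum

theorem listFun_apply (Q : List ℤ) (x : S.SymbolSpace) :
    S.listFun Q x = (Q.map fun d => S.divFun d x).sum := by
  unfold listFun
  induction Q with
  | nil => rfl
  | cons d Q ih => simp only [List.map_cons, List.sum_cons, LinearMap.add_apply, ih]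

/-- The row sums of the matrix `B_l`. -/
noncomputable def rowSum (Q : List ℤ) : S.SymbolSpace →ₗ[ZMod 2] ZMod 2 :=
  S.gram Q S.total + S.listFun Q

/-- The symbol `(-1/·)₊`. -/
def negFun : S.SymbolSpace →ₗ[ZMod 2] ZMod 2 := LinearMap.fst _ _ _

/-- The pairing of the border space with the first block. -/
noncomputable def border₁ : S.BorderSpace →ₗ[ZMod 2] S.SymbolSpace →ₗ[ZMod 2] ZMod 2 :=
  (LinearMap.fst _ _ _).smulRight (S.rowSum S.Q₁) +
    ((LinearMap.fst _ _ _).comp (LinearMap.snd _ _ _)).smulRight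
      ((S.negFun S.total + 1) • S.negFun + S.divFun S.dDiag) +
    ∑ k, ((LinearMap.proj k).comp ((LinearMap.snd _ _ _).comp (LinearMap.snd _ _ _))).smulRight
      (S.divFun (S.T₁ k))

/-- The pairing of the border space with the second block. -/
noncomputable def border₂ : S.BorderSpace →ₗ[ZMod 2] S.SymbolSpace →ₗ[ZMod 2] ZMod 2 :=
  (LinearMap.fst _ _ _).smulRight (S.divFun S.dDiag) +
    ((LinearMap.fst _ _ _).comp (LinearMap.snd _ _ _)).smulRight (S.rowSum S.Q₂) +
    ∑ k, ((LinearMap.proj k).comp ((LinearMap.snd _ _ _).comp (LinearMap.snd _ _ _))).smulRight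
      (S.divFun (S.T₂ k))

theorem border₁_apply (z : S.BorderSpace) (x : S.SymbolSpace) :
    S.border₁ z x = z.1 * S.rowSum S.Q₁ x +
      z.2.1 * ((S.negFun S.total + 1) * S.negFun x + S.divFun S.dDiag x) +
      ∑ k, z.2.2 k * S.divFun (S.T₁ k) x := by
  simp [border₁, LinearMap.sum_apply, mul_add]

theorem border₂_apply (z : S.BorderSpace) (x : S.SymbolSpace) :
    S.border₂ z x = z.1 * S.divFun S.dDiag x + z.2.1 * S.rowSum S.Q₂ x +
      ∑ k, z.2.2 k * S.divFun (S.T₂ k) x := by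
  simp [border₂, LinearMap.sum_apply]

/-- The last `t` coordinates of the image of a border vector. -/
noncomputable def cornerVector : S.BorderSpace →ₗ[ZMod 2] (Fin S.t → ZMod 2) :=
  LinearMap.pi fun k =>
    (S.divFun (S.T₁ k) S.total) • LinearMap.fst _ _ _ +
      (S.divFun (S.T₂ k) S.total) • (LinearMap.fst _ _ _).comp (LinearMap.snd _ _ _) +
      (LinearMap.proj k).comp (S.B.mulVecLin.comp ((LinearMap.snd _ _ _).comp (LinearMap.snd _ _ _)))

theorem cornerVector_apply (z : S.BorderSpace) (k : Fin S.t) :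
    S.cornerVector z k = S.divFun (S.T₁ k) S.total * z.1 + S.divFun (S.T₂ k) S.total * z.2.1 +
      ∑ l, S.B k l * z.2.2 l := rfl

/-- The form on the border space. -/
noncomputable def corner : S.BorderSpace →ₗ[ZMod 2] S.BorderSpace →ₗ[ZMod 2] ZMod 2 :=
  LinearMap.mk₂ (ZMod 2)
    (fun z z' => z'.1 * S.border₁ z S.total + z'.2.1 * S.border₂ z S.total +
      ∑ k, z'.2.2 k * S.cornerVector z k)
    (fun a b c => by
      simp only [map_add, LinearMap.add_apply, Pi.add_apply, mul_add, Finset.sum_add_distrib]; ring)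
    (fun c a b => by
      simp only [map_smul, LinearMap.smul_apply, Pi.smul_apply, smul_eq_mul, mul_add,
        Finset.mul_sum, mul_left_comm])
    (fun a b c => by
      simp only [Prod.fst_add, Prod.snd_add, Pi.add_apply, add_mul, Finset.sum_add_distrib]; ring)
    (fun c a b => by
      simp only [Prod.smul_fst, Prod.smul_snd, Pi.smul_apply, smul_eq_mul, mul_add, Finset.mul_sum,
        mul_assoc])

theorem corner_apply (z z' : S.BorderSpace) :
    S.corner z z' = z'.1 * S.border₁ z S.total + z'.2.1 * S.border₂ z S.total +
      ∑ k, z'.2.2 k * S.cornerVector z k := rfl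

theorem zmod_two_mul_self (a : ZMod 2) : a * a = a := by
  revert a; decide

theorem gram_self (Q : List ℤ) (x : S.SymbolSpace) : S.gram Q x x = S.listFun Q x := by
  simp only [gram_apply, listFun_apply, zmod_two_mul_self]

theorem gram_symm (Q : List ℤ) (x y : S.SymbolSpace) : S.gram Q x y = S.gram Q y x := by
  simp only [gram_apply, mul_comm]

theorem rowSum_total (Q : List ℤ) : S.rowSum Q S.total = 0 := by
  rw [rowSum, LinearMap.add_apply, gram_self, CharTwo.add_self_eq_zero]

theorem sum_mul_B_mul (ζ : Fin S.t → ZMod 2) : ∑ k, ζ k * ∑ l, S.B k l * ζ l = 0 := by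
  have h : ∀ n (B : Matrix (Fin n) (Fin n) (ZMod 2)) (_ : ∀ i j, B i j = B j i)
      (_ : ∀ i, B i i = 0) (ζ : Fin n → ZMod 2), ∑ k, ζ k * ∑ l, B k l * ζ l = 0 := by
    intro n
    induction n with
    | zero => intros; simp
    | succ n ih =>
      intro B hs hd ζ
      have e : ∑ i : Fin n, ζ i.succ * (B i.succ 0 * ζ 0) = ζ 0 * ∑ i : Fin n, B 0 i.succ * ζ i.succ := by
        rw [Finset.mul_sum]
        exact Finset.sum_congr rfl fun i _ => by rw [hs]; ring
      simp only [Fin.sum_univ_succ, mul_add, Finset.sum_add_distrib, hd, zero_mul, mul_zero,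
        zero_add, e]
      rw [← add_assoc, CharTwo.add_self_eq_zero, zero_add]
      exact ih (fun i j => B i.succ j.succ) (fun i j => hs _ _) (fun i => hd _) fun i => ζ i.succ
  exact h _ S.B S.symm_B S.diag_B ζ

/-- Cross terms occur twice and cancel. What is left is `rowSum` at `total`, which vanishes, a
product `(a + 1) * a`, and the alternating matrix `B`. -/
theorem corner_self (z : S.BorderSpace) : S.corner z z = 0 := by
  have h1 := S.sum_mul_B_mul z.2.2
  have h2 : (S.negFun S.total + 1) * S.negFun S.total = 0 := by
    rw [add_mul, zmod_two_mul_self, one_mul, CharTwo.add_self_eq_zero]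
  rw [corner_apply, border₁_apply, border₂_apply, rowSum_total, rowSum_total, h2]
  simp only [cornerVector_apply, mul_add, Finset.sum_add_distrib, h1]
  have e1 : ∑ k, z.2.2 k * (S.divFun (S.T₁ k) S.total * z.1) =
      z.1 * ∑ k, z.2.2 k * S.divFun (S.T₁ k) S.total := by
    rw [Finset.mul_sum]; exact Finset.sum_congr rfl fun _ _ => by ring
  have e2 : ∑ k, z.2.2 k * (S.divFun (S.T₂ k) S.total * z.2.1) =
      z.2.1 * ∑ k, z.2.2 k * S.divFun (S.T₂ k) S.total := by
    rw [Finset.mul_sum]; exact Finset.sum_congr rfl fun _ _ => by ring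
  rw [e1, e2]
  have two : (2 : ZMod 2) = 0 := rfl
  linear_combination (z.1 * z.2.1 * S.divFun S.dDiag S.total +
    z.1 * ∑ k, z.2.2 k * S.divFun (S.T₁ k) S.total +
    z.2.1 * ∑ k, z.2.2 k * S.divFun (S.T₂ k) S.total) * two

/-- The form data attached to the input data. -/
noncomputable def formData : FormData S.SymbolSpace S.BorderSpace where
  χ := S.negFun
  b₁ := S.listFun S.Q₁
  b₂ := S.listFun S.Q₂
  β₁ := S.gram S.Q₁
  β₂ := S.gram S.Q₂
  l₁ := S.border₁
  l₂ := S.border₂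
  C := S.corner
  β₁_symm := S.gram_symm _
  β₂_symm := S.gram_symm _
  β₁_diag := S.gram_self _
  β₂_diag := S.gram_self _
  C_alt := S.corner_self

end Data

/-! ### The matrix of a bit assignment as a form -/

namespace BitAssignment

variable {S : Data} {r : ℕ} (β : BitAssignment S r)

/-- The symbol vectors of a bit assignment. -/
def vec (i : Fin r) : S.SymbolSpace := (β.negOne i, fun q => β.prime q i)

theorem divisor_eq (d : ℤ) (i : Fin r) : β.symbols.divisor d i = S.divFun d (β.vec i) := by
  rw [S.divFun_apply]; rfl

theorem sum_vec : ∑ i, β.vec i = S.total := by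
  refine Prod.ext ?_ (funext fun q => ?_)
  · rw [Prod.fst_sum]; exact β.sum_negOne
  · rw [Prod.snd_sum, Finset.sum_apply]; exact β.sum_prime q

theorem pair_add_pair {i j : Fin r} (h : i ≠ j) :
    β.symbols.pair j i + β.symbols.pair i j = β.negOne i * β.negOne j := by
  simp only [symbols]
  rcases lt_or_gt_of_ne h with h | h
  · rw [dif_neg h.not_gt, dif_pos h, dif_pos h, add_right_comm, CharTwo.add_self_eq_zero, zero_add]
  · rw [dif_pos h, dif_neg h.not_gt, dif_pos h, ← add_assoc, CharTwo.add_self_eq_zero, zero_add,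
      mul_comm]

/-- The matrix `A + D_diag` of a bit assignment. -/
def matAD : Matrix (Fin r) (Fin r) (ZMod 2) := β.symbols.matA + β.symbols.matDiag S.dDiag

theorem matAD_of_ne {i j : Fin r} (h : i ≠ j) : β.matAD i j = β.symbols.pair j i := by
  simp [matAD, Symbols.matA, Symbols.matDiag, h]

theorem matAD_self (i : Fin r) :
    β.matAD i i = ∑ l ∈ Finset.univ.erase i, β.symbols.pair l i + S.divFun S.dDiag (β.vec i) := by
  simp [matAD, Symbols.matA, Symbols.matDiag, divisor_eq]

theorem matAD_add {i j : Fin r} (h : i ≠ j) :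
    β.matAD i j + β.matAD j i = S.negFun (β.vec i) * S.negFun (β.vec j) := by
  rw [β.matAD_of_ne h, β.matAD_of_ne h.symm, β.pair_add_pair h]; rfl

theorem sum_matAD_row (i : Fin r) : ∑ j, β.matAD i j = S.divFun S.dDiag (β.vec i) := by
  rw [← Finset.add_sum_erase _ _ (Finset.mem_univ i), matAD_self,
    Finset.sum_congr rfl fun j hj => β.matAD_of_ne (Finset.ne_of_mem_erase hj).symm,
    add_right_comm, CharTwo.add_self_eq_zero, zero_add]

/-- Passing from row to column sums adds, by reciprocity, the terms `χ(x_j) χ(x_i)` for `j ≠ i`.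
Since the symbol vectors have the fixed sum `total`, these add up to `(χ(total) + 1) χ(x_i)`. -/
theorem sum_matAD_col (i : Fin r) : ∑ j, β.matAD j i =
    (S.negFun S.total + 1) * S.negFun (β.vec i) + S.divFun S.dDiag (β.vec i) := by
  have h : ∀ j, β.matAD j i = β.matAD i j + (S.negFun (β.vec j) * S.negFun (β.vec i) +
      if i = j then S.negFun (β.vec i) else 0) := by
    intro j
    split_ifs with hij
    · subst hij
      rw [Data.zmod_two_mul_self, CharTwo.add_self_eq_zero, add_zero]
    · rw [add_zero, mul_comm, ← β.matAD_add hij, ← add_assoc, CharTwo.add_self_eq_zero, zero_add]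
  simp only [h, Finset.sum_add_distrib, sum_matAD_row, ← Finset.sum_mul, ← map_sum, sum_vec,
    Finset.sum_ite_eq, Finset.mem_univ, if_true]
  ring

theorem matB_eq (Q : List ℤ) (i j : Fin r) :
    β.symbols.matB Q i j = FormData.offDiag (S.gram Q) β.vec i j := by
  simp only [Symbols.matB, FormData.offDiag, S.gram_apply, divisor_eq]

theorem sum_matB (Q : List ℤ) (i : Fin r) :
    ∑ j, β.symbols.matB Q i j = S.rowSum Q (β.vec i) := by
  have := FormData.sum_offDiag (S.gram_self Q) β.vec (fun _ => 1) i
  simp only [mul_one, one_smul, sum_vec] at this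
  simp only [matB_eq, this, Data.rowSum, LinearMap.add_apply]
  rw [S.gram_symm]

theorem malt_transpose : β.malt.transpose = β.malt := by
  have hB : ∀ Q, (β.symbols.matB Q).transpose = β.symbols.matB Q := by
    intro Q
    ext i j
    rw [Matrix.transpose_apply, matB_eq, matB_eq]
    simp only [FormData.offDiag, S.gram_symm Q (β.vec j), eq_comm (a := j)]
  have hD : (β.symbols.matDiag S.dDiag).transpose = β.symbols.matDiag S.dDiag :=
    Matrix.diagonal_transpose _
  have hBB : S.B.transpose = S.B := by ext i j; exact S.symm_B j i
  simp only [malt, Symbols.malt, Matrix.fromBlocks_transpose, hB, Matrix.transpose_add, hD,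
    Matrix.transpose_transpose, hBB, Matrix.transpose_fromRows, Matrix.transpose_fromCols]

/-- The border space inside the space of `malt`. -/
def borderEmb (S : Data) (r : ℕ) : S.BorderSpace →ₗ[ZMod 2] ((Fin r ⊕ Fin r) ⊕ Fin S.t → ZMod 2) where
  toFun z := Sum.elim (Sum.elim (fun _ => z.1) fun _ => z.2.1) z.2.2
  map_add' z z' := by ext ((i | i) | i) <;> rfl
  map_smul' c z := by ext ((i | i) | i) <;> rfl

/-- Summation over all primes replaces the random entries by values at `total`, so at each prime
only a linear functional of its own symbol vector remains. This puts `v` and `v'` on the same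
footing as the last `t` columns. -/
theorem malt_mulVec_borderEmb (z : S.BorderSpace) :
    β.malt.mulVec (borderEmb S r z) =
      Sum.elim (Sum.elim (fun i => S.border₁ z (β.vec i)) fun i => S.border₂ z (β.vec i))
        (S.cornerVector z) := by
  have hAD : ∀ i j, β.matAD i j = β.symbols.matA i j + β.symbols.matDiag S.dDiag i j :=
    fun _ _ => rfl
  have hD : ∀ i j, β.symbols.matDiag S.dDiag i j = β.symbols.matDiag S.dDiag j i := by
    intro i j
    exact congrFun (congrFun (Matrix.diagonal_transpose (β.symbols.divisor S.dDiag)) j) i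
  ext ((i | i) | k)
  · simp only [malt, Symbols.malt, borderEmb, LinearMap.coe_mk, AddHom.coe_mk, Matrix.mulVec,
      dotProduct, Fintype.sum_sum_type, Matrix.fromBlocks_apply₁₁, Matrix.fromBlocks_apply₁₂,
      Matrix.fromRows_apply_inl, Sum.elim_inl, Sum.elim_inr, Matrix.transpose_apply,
      Matrix.add_apply, ← Finset.sum_mul, sum_matB, Symbols.matR, divisor_eq]
    simp only [hD i, ← hAD, sum_matAD_col, S.border₁_apply]
    simp only [mul_comm]
  · simp only [malt, Symbols.malt, borderEmb, LinearMap.coe_mk, AddHom.coe_mk, Matrix.mulVec,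
      dotProduct, Fintype.sum_sum_type, Matrix.fromBlocks_apply₁₁, Matrix.fromBlocks_apply₁₂,
      Matrix.fromBlocks_apply₂₁, Matrix.fromBlocks_apply₂₂,
      Matrix.fromRows_apply_inr, Sum.elim_inl, Sum.elim_inr, Matrix.transpose_apply,
      Matrix.add_apply, ← Finset.sum_mul, sum_matB, Symbols.matR, divisor_eq]
    simp only [← hAD, sum_matAD_row, S.border₂_apply]
    simp only [mul_comm]
  · simp only [malt, Symbols.malt, borderEmb, LinearMap.coe_mk, AddHom.coe_mk, Matrix.mulVec,
      dotProduct, Fintype.sum_sum_type, Matrix.fromBlocks_apply₂₁, Matrix.fromBlocks_apply₂₂,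
      Matrix.fromCols_apply_inl, Matrix.fromCols_apply_inr, Sum.elim_inl, Sum.elim_inr,
      ← Finset.sum_mul, Symbols.matR, divisor_eq, ← map_sum, sum_vec, S.cornerVector_apply]

end BitAssignment

/-! ### The corank of the matrix as the dimension of a radical -/

section MulForm

variable {n : Type*} [Fintype n]

/-- The bilinear form of a square matrix. -/
def mulForm (M : Matrix n n (ZMod 2)) : (n → ZMod 2) →ₗ[ZMod 2] (n → ZMod 2) →ₗ[ZMod 2] ZMod 2 :=
  LinearMap.mk₂ (ZMod 2) (fun p q => q ⬝ᵥ M.mulVec p)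
    (fun p p' q => by rw [Matrix.mulVec_add, dotProduct_add])
    (fun c p q => by rw [Matrix.mulVec_smul, dotProduct_smul])
    (fun p q q' => by rw [add_dotProduct])
    (fun c p q => by rw [smul_dotProduct])

theorem mulForm_apply (M : Matrix n n (ZMod 2)) (p q : n → ZMod 2) :
    mulForm M p q = q ⬝ᵥ M.mulVec p := rfl

theorem mulForm_symm {M : Matrix n n (ZMod 2)} (hM : M.transpose = M) (p q : n → ZMod 2) :
    mulForm M p q = mulForm M q p := by
  rw [mulForm_apply, mulForm_apply, Matrix.dotProduct_mulVec, ← Matrix.mulVec_transpose, hM,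
    dotProduct_comm]

theorem corank_eq_radDim (M : Matrix n n (ZMod 2)) : corank M = radDim (mulForm M) := by
  classical
  have hk : LinearMap.ker (mulForm M) = LinearMap.ker M.mulVecLin := by
    ext p
    simp only [LinearMap.mem_ker, Matrix.mulVecLin_apply]
    constructor
    · intro h
      ext i
      simpa [mulForm_apply] using LinearMap.congr_fun h (Pi.single i 1)
    · intro h
      ext q
      simp [mulForm_apply, h]
  rw [corank, radDim, hk]
  have := LinearMap.finrank_range_add_finrank_ker M.mulVecLin
  rw [Module.finrank_fintype_fun_eq_card] at this
  rw [Matrix.rank]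
  omega

end MulForm

/-! ### Bit assignments as free configurations of one prime fewer -/

namespace BitAssignment

variable {S : Data} {m : ℕ}

/-- The interior part of the space of `malt`, spanned by the basis vectors of all but the first
prime. -/
def interiorEmb (S : Data) (m : ℕ) : ((Fin m → ZMod 2) × (Fin m → ZMod 2)) →ₗ[ZMod 2]
    ((Fin (m + 1) ⊕ Fin (m + 1)) ⊕ Fin S.t → ZMod 2) where
  toFun p := Sum.elim (Sum.elim (Fin.cons 0 p.1) (Fin.cons 0 p.2)) 0
  map_add' p q := by
    ext ((i | i) | i)
    · refine Fin.cases ?_ (fun i => ?_) i <;> simp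
    · refine Fin.cases ?_ (fun i => ?_) i <;> simp
    · simp
  map_smul' c p := by
    ext ((i | i) | i)
    · refine Fin.cases ?_ (fun i => ?_) i <;> simp
    · refine Fin.cases ?_ (fun i => ?_) i <;> simp
    · simp

/-- The space of `malt` as the space of a random form. -/
def spaceEquiv (S : Data) (m : ℕ) : FormSpace S.BorderSpace m ≃ₗ[ZMod 2]
    ((Fin (m + 1) ⊕ Fin (m + 1)) ⊕ Fin S.t → ZMod 2) :=
  { toFun := fun p => interiorEmb S m (p.1, p.2.1) + borderEmb S (m + 1) p.2.2
    map_add' := fun p q => by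
      rw [Prod.fst_add, Prod.snd_add, Prod.fst_add, Prod.snd_add, ← Prod.mk_add_mk, map_add, map_add]
      abel
    map_smul' := fun c p => by
      rw [Prod.smul_fst, Prod.smul_snd, Prod.smul_fst, Prod.smul_snd, ← Prod.smul_mk, map_smul,
        map_smul, smul_add, RingHom.id_apply]
    invFun := fun U => (fun i => U (.inl (.inl i.succ)) + U (.inl (.inl 0)),
      fun i => U (.inl (.inr i.succ)) + U (.inl (.inr 0)),
      U (.inl (.inl 0)), U (.inl (.inr 0)), fun k => U (.inr k))
    left_inv := by
      rintro ⟨u, v, s, s', ζ⟩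
      simp [interiorEmb, borderEmb, add_assoc, CharTwo.add_self_eq_zero]
    right_inv := by
      intro U
      ext ((i | i) | i)
      · refine Fin.cases ?_ (fun i => ?_) i <;>
          simp [interiorEmb, borderEmb, add_assoc, CharTwo.add_self_eq_zero]
      · refine Fin.cases ?_ (fun i => ?_) i <;>
          simp [interiorEmb, borderEmb, add_assoc, CharTwo.add_self_eq_zero]
      · simp [interiorEmb, borderEmb] }

theorem spaceEquiv_apply (p : FormSpace S.BorderSpace m) :
    spaceEquiv S m p = interiorEmb S m (p.1, p.2.1) + borderEmb S (m + 1) p.2.2 := rfl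

variable (β : BitAssignment S (m + 1))

/-- The symbol vectors of all but the first prime. -/
def tailVec (i : Fin m) : S.SymbolSpace := β.vec i.succ

/-- The part of `A + D_diag` belonging to all but the first prime. -/
def tailMat : Matrix (Fin m) (Fin m) (ZMod 2) := fun i j => β.matAD i.succ j.succ

theorem mulForm_interior_interior (p q : (Fin m → ZMod 2) × (Fin m → ZMod 2)) :
    mulForm β.malt (interiorEmb S m p) (interiorEmb S m q) =
      ∑ i, q.1 i * (∑ j, FormData.offDiag S.formData.β₁ β.tailVec i j * p.1 j +
        ∑ j, β.tailMat j i * p.2 j) +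
      ∑ i, q.2 i * (∑ j, β.tailMat i j * p.1 j +
        ∑ j, FormData.offDiag S.formData.β₂ β.tailVec i j * p.2 j) := by
  have hAD : ∀ i j, β.symbols.matA i j + β.symbols.matDiag S.dDiag i j = β.matAD i j :=
    fun _ _ => rfl
  have hAD' : ∀ i j, β.symbols.matA j i + β.symbols.matDiag S.dDiag i j = β.matAD j i := by
    intro i j
    rw [← hAD]
    exact congrArg _ (congrFun (congrFun (Matrix.diagonal_transpose (β.symbols.divisor S.dDiag)) j) i)
  simp only [mulForm_apply, malt, Symbols.malt, interiorEmb, LinearMap.coe_mk, AddHom.coe_mk,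
    Matrix.mulVec, dotProduct, Fintype.sum_sum_type, Matrix.fromBlocks_apply₁₁,
    Matrix.fromBlocks_apply₁₂, Matrix.fromBlocks_apply₂₁, Matrix.fromBlocks_apply₂₂,
    Sum.elim_inl, Sum.elim_inr, Matrix.transpose_apply, Matrix.add_apply, Pi.zero_apply, zero_mul,
    mul_zero, Finset.sum_const_zero, add_zero, Fin.sum_univ_succ, Fin.cons_zero, Fin.cons_succ,
    zero_add, matB_eq]
  simp only [hAD, hAD', tailMat, Data.formData, FormData.offDiag, Fin.succ_inj, tailVec]

theorem mulForm_border_interior (z : S.BorderSpace) (q : (Fin m → ZMod 2) × (Fin m → ZMod 2)) :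
    mulForm β.malt (borderEmb S (m + 1) z) (interiorEmb S m q) =
      ∑ i, q.1 i * S.border₁ z (β.tailVec i) + ∑ i, q.2 i * S.border₂ z (β.tailVec i) := by
  simp [mulForm_apply, malt_mulVec_borderEmb, interiorEmb, dotProduct, Fin.sum_univ_succ, tailVec]

theorem mulForm_border_border (z z' : S.BorderSpace) :
    mulForm β.malt (borderEmb S (m + 1) z) (borderEmb S (m + 1) z') = S.corner z z' := by
  rw [S.corner_apply, mulForm_apply, malt_mulVec_borderEmb]
  simp only [borderEmb, LinearMap.coe_mk, AddHom.coe_mk, dotProduct, Fintype.sum_sum_type,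
    Sum.elim_inl, Sum.elim_inr, ← Finset.mul_sum, ← map_sum, sum_vec]

theorem mulForm_spaceEquiv (p q : FormSpace S.BorderSpace m) :
    mulForm β.malt (spaceEquiv S m p) (spaceEquiv S m q) =
      S.formData.form β.tailVec β.tailMat p q := by
  rw [spaceEquiv_apply, spaceEquiv_apply, FormData.form_apply]
  simp only [map_add, LinearMap.add_apply]
  rw [mulForm_symm β.malt_transpose (interiorEmb S m (p.1, p.2.1)) (borderEmb S (m + 1) q.2.2),
    mulForm_interior_interior, mulForm_border_interior, mulForm_border_interior,
    mulForm_border_border]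
  simp only [mul_add, Finset.sum_add_distrib, Data.formData, mul_comm (p.1 _), mul_comm (p.2.1 _)]
  ring

theorem corank_malt : corank β.malt = radDim (S.formData.form β.tailVec β.tailMat) := by
  rw [corank_eq_radDim]
  exact (radDim_congr (spaceEquiv S m) (β.mulForm_spaceEquiv)).symm

/-- The random configuration of a bit assignment. -/
def config : S.formData.Config m :=
  ⟨(β.tailVec, β.tailMat), fun _ _ h => β.matAD_add fun h' => h (Fin.succ_injective _ h')⟩

/-- Nothing is lost by discarding the first prime: its symbol vector is recovered from the
prescribed total, and its pair symbol with `p_i` from the diagonal entry at `i`, which is the sum of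
the other entries of the full row of `A` plus a known symbol. -/
theorem config_injective : Function.Injective (config (S := S) (m := m)) := by
  intro β γ h
  have hv : β.tailVec = γ.tailVec := congrArg (fun ω => ω.1.1) h
  have hM : β.tailMat = γ.tailMat := congrArg (fun ω => ω.1.2) h
  have hvec : β.vec = γ.vec := by
    ext1 i
    refine Fin.cases ?_ (fun i => congrFun hv i) i
    have h1 := β.sum_vec
    rw [← γ.sum_vec, Fin.sum_univ_succ, Fin.sum_univ_succ] at h1
    have h2 : ∑ i : Fin m, β.vec i.succ = ∑ i : Fin m, γ.vec i.succ :=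
      Finset.sum_congr rfl fun i _ => congrFun hv i
    rwa [h2, add_left_inj] at h1
  have hlow : ∀ i j : Fin m, ∀ h : j < i, β.upper ⟨(j.succ, i.succ), Fin.succ_lt_succ_iff.2 h⟩ =
      γ.upper ⟨(j.succ, i.succ), Fin.succ_lt_succ_iff.2 h⟩ := by
    intro i j h
    have := congrFun (congrFun hM i) j
    have hne : i.succ ≠ j.succ := fun h' => h.ne' (Fin.succ_injective _ h')
    rw [tailMat, tailMat, matAD_of_ne _ hne, matAD_of_ne _ hne] at this
    simpa [symbols, h] using this
  have hneg : β.negOne = γ.negOne := funext fun i => congrArg Prod.fst (congrFun hvec i)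
  have hpair : ∀ i j : Fin m, β.symbols.pair j.succ i.succ = γ.symbols.pair j.succ i.succ := by
    intro i j
    simp only [symbols, Fin.succ_lt_succ_iff, hneg]
    split_ifs with h1 h2
    · exact hlow i j h1
    · rw [hlow j i h2]
    · rfl
  have hzero : ∀ i : Fin m, β.upper ⟨(0, i.succ), Fin.succ_pos _⟩ =
      γ.upper ⟨(0, i.succ), Fin.succ_pos _⟩ := by
    intro i
    have h1 := congrFun (congrFun hM i) i
    rw [tailMat, tailMat, matAD_self, matAD_self, hvec, add_left_inj,
      ← Finset.add_sum_erase _ _ (Finset.mem_erase.2 ⟨(Fin.succ_ne_zero i).symm, Finset.mem_univ _⟩),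
      ← Finset.add_sum_erase _ (fun l => γ.symbols.pair l i.succ)
        (Finset.mem_erase.2 ⟨(Fin.succ_ne_zero i).symm, Finset.mem_univ _⟩)] at h1
    have h2 : ∑ l ∈ (Finset.univ.erase i.succ).erase 0, β.symbols.pair l i.succ =
        ∑ l ∈ (Finset.univ.erase i.succ).erase 0, γ.symbols.pair l i.succ := by
      refine Finset.sum_congr rfl fun l hl => ?_
      obtain ⟨l, rfl⟩ := Fin.exists_succ_eq.2 (Finset.ne_of_mem_erase hl)
      exact hpair i l
    rw [h2, add_left_inj] at h1
    simpa [symbols] using h1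
  refine BitAssignment.ext hneg (funext fun q => funext fun i => ?_) (funext fun ⟨⟨i, j⟩, hij⟩ => ?_)
  · exact congrFun (congrArg Prod.snd (congrFun hvec i)) q
  · induction j using Fin.cases with
    | zero => exact absurd hij (Fin.not_lt_zero _)
    | succ j =>
      induction i using Fin.cases with
      | zero => exact hzero j
      | succ i => exact hlow j i (Fin.succ_lt_succ_iff.1 hij)

theorem config_surjective : Function.Surjective (config (S := S) (m := m)) := by
  rintro ⟨⟨x, A⟩, hA⟩
  let y : Fin (m + 1) → S.SymbolSpace := Fin.cons (S.total + ∑ i, x i) x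
  have hy : ∑ i, y i = S.total := by
    have h : ∀ a : S.SymbolSpace, a + a = 0 := fun a =>
      Prod.ext (CharTwo.add_self_eq_zero _) (funext fun _ => CharTwo.add_self_eq_zero _)
    simp only [y, Fin.sum_univ_succ, Fin.cons_zero, Fin.cons_succ]
    rw [add_assoc, h, add_zero]
  -- The bit of the pair `(0, j)` is chosen to produce the diagonal entry `A j j`. The value at `j =
  -- 0` is irrelevant, as only pairs with `i < j` are used.
  let up : ∀ i : Fin (m + 1), Fin (m + 1) → ZMod 2 := fun i j =>
    Fin.cases 0 (fun j => Fin.cases (A j j + S.divFun S.dDiag (x j) + ∑ l ∈ Finset.univ.erase j, A j l)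
      (fun i => A j i) i) j
  let β : BitAssignment S (m + 1) :=
    { negOne := fun i => (y i).1
      prime := fun q i => (y i).2 q
      upper := fun ij => up ij.1.1 ij.1.2
      sum_negOne := by
        have := congrArg Prod.fst hy
        rwa [Prod.fst_sum] at this
      sum_prime := fun q => by
        have := congrFun (congrArg Prod.snd hy) q
        rwa [Prod.snd_sum, Finset.sum_apply] at this }
  have hvec : β.vec = y := rfl
  have hoff : ∀ i j : Fin m, i ≠ j → β.symbols.pair j.succ i.succ = A i j := by
    intro i j h
    simp only [symbols, Fin.succ_lt_succ_iff]
    rcases lt_or_gt_of_ne h with h' | h'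
    · rw [dif_neg h'.not_gt, dif_pos h']
      have := hA i j h
      have e : β.upper ⟨(i.succ, j.succ), Fin.succ_lt_succ_iff.2 h'⟩ = A j i := rfl
      have e' : β.negOne i.succ * β.negOne j.succ = A i j + A j i := this.symm
      rw [e, e', add_left_comm, CharTwo.add_self_eq_zero, add_zero]
    · rw [dif_pos h']; rfl
  refine ⟨β, Subtype.ext (Prod.ext rfl (funext fun i => funext fun j => ?_))⟩
  change β.matAD i.succ j.succ = A i j
  by_cases h : i = j
  · subst h
    rw [matAD_self, ← Finset.add_sum_erase _ _
      (Finset.mem_erase.2 ⟨(Fin.succ_ne_zero i).symm, Finset.mem_univ _⟩)]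
    have h1 : β.symbols.pair 0 i.succ =
        A i i + S.divFun S.dDiag (x i) + ∑ l ∈ Finset.univ.erase i, A i l := by
      simp only [symbols, Fin.succ_pos, dif_pos]
      rfl
    have h2 : ∑ l ∈ (Finset.univ.erase i.succ).erase 0, β.symbols.pair l i.succ =
        ∑ l ∈ Finset.univ.erase i, A i l := by
      have : (Finset.univ.erase i.succ).erase 0 =
          (Finset.univ.erase i).map (Fin.succEmb m) := by
        ext l
        refine Fin.cases ?_ (fun l => ?_) l
        · simp
        · simp
      rw [this, Finset.sum_map]
      exact Finset.sum_congr rfl fun l hl => hoff i l (Finset.ne_of_mem_erase hl).symm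
    have h3 : S.divFun S.dDiag (β.vec i.succ) = S.divFun S.dDiag (x i) := rfl
    rw [h1, h2, h3]
    have two : (2 : ZMod 2) = 0 := rfl
    linear_combination (S.divFun S.dDiag (x i) + ∑ l ∈ Finset.univ.erase i, A i l) * two
  · rw [matAD_of_ne _ fun h' => h (Fin.succ_injective _ h')]
    exact hoff i j h

/-- Bit assignments are configurations. -/
noncomputable def configEquiv (S : Data) (m : ℕ) : BitAssignment S (m + 1) ≃ S.formData.Config m :=
  Equiv.ofBijective config ⟨config_injective, config_surjective⟩

theorem corank_malt_eq_rad : corank β.malt = S.formData.rad (configEquiv S m β) := β.corank_malt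

end BitAssignment

/-! ### The number of bit assignments -/

namespace FormData

variable {X Z : Type*} [AddCommGroup X] [Module (ZMod 2) X] [AddCommGroup Z] [Module (ZMod 2) Z]

/-- A further prime brings a symbol vector, `m` free pair symbols and one free diagonal entry. -/
theorem card_config [Finite X] (𝓕 : FormData X Z) (m : ℕ) :
    Nat.card (𝓕.Config m) = 2 ^ ((m + 1) * m / 2) * Nat.card X ^ m := by
  induction m with
  | zero =>
    have : Unique (𝓕.Config 0) :=
      { default := ⟨(Fin.elim0, Fin.elim0), fun i => i.elim0⟩
        uniq := fun a => Subtype.ext (Subsingleton.elim _ _) }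
    simp
  | succ m ih =>
    rw [← Nat.card_congr (𝓕.consConfig m), Nat.card_prod, Nat.card_prod, Nat.card_prod, ih]
    have h1 : Nat.card (Fin m → ZMod 2) = 2 ^ m := by simp
    have h2 : Nat.card (ZMod 2) = 2 := by simp
    have h3 : (m + 1 + 1) * (m + 1) / 2 = (m + 1) * m / 2 + (m + 1) := by
      rw [show (m + 1 + 1) * (m + 1) = (m + 1) * m + (m + 1) * 2 by ring,
        Nat.add_mul_div_right _ _ two_pos]
    rw [h1, h2, h3]
    ring

end FormData

theorem Data.card_symbolSpace (S : Data) : Nat.card S.SymbolSpace = 2 ^ (S.c + 2) := by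
  have h : (2 * S.D).primeFactors.card = S.c + 1 := by
    rw [Nat.Coprime.primeFactors_mul (Nat.coprime_two_left.2 S.odd_D),
      Finset.card_union_of_disjoint (Nat.Coprime.disjoint_primeFactors (Nat.coprime_two_left.2 S.odd_D)),
      Nat.prime_two.primeFactors, Finset.card_singleton, Data.c, add_comm]
  have h' : Nat.card ((2 * S.D).primeFactors → ZMod 2) = 2 ^ (S.c + 1) := by
    rw [Nat.card_fun, Nat.card_zmod, Nat.card_eq_finsetCard, h]
  rw [Nat.card_prod, h', Nat.card_zmod]
  ring

theorem BitAssignment.card (S : Data) (m : ℕ) :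
    Nat.card (BitAssignment S (m + 1)) = 2 ^ ((m + 1 + 2 * S.c + 4) * (m + 1 - 1) / 2) := by
  rw [Nat.card_congr (configEquiv S m), FormData.card_config, S.card_symbolSpace, ← pow_mul,
    ← pow_add]
  congr 1
  rw [show (m + 1 + 2 * S.c + 4) * (m + 1 - 1) = (m + 1) * m + (S.c + 2) * m * 2 by
    rw [Nat.add_sub_cancel]; ring, Nat.add_mul_div_right _ _ two_pos]


namespace FormData

variable {X Z : Type*} [AddCommGroup X] [Module (ZMod 2) X] [AddCommGroup Z] [Module (ZMod 2) Z]
  (𝓕 : FormData X Z) {m : ℕ}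

/-! ### Splitting off a common kernel of the border -/

/-- The form data with border restricted to a subspace. -/
def restrict (Y : Submodule (ZMod 2) Z) : FormData X Y where
  χ := 𝓕.χ
  b₁ := 𝓕.b₁
  b₂ := 𝓕.b₂
  β₁ := 𝓕.β₁
  β₂ := 𝓕.β₂
  l₁ := 𝓕.l₁.comp Y.subtype
  l₂ := 𝓕.l₂.comp Y.subtype
  C := 𝓕.C.compl₁₂ Y.subtype Y.subtype
  β₁_symm := 𝓕.β₁_symm
  β₂_symm := 𝓕.β₂_symm
  β₁_diag := 𝓕.β₁_diag
  β₂_diag := 𝓕.β₂_diag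
  C_alt z := 𝓕.C_alt z

/-- The border vectors pairing trivially with everything. -/
def borderKer : Submodule (ZMod 2) Z :=
  LinearMap.ker 𝓕.l₁ ⊓ LinearMap.ker 𝓕.l₂ ⊓ LinearMap.ker 𝓕.C

theorem mem_borderKer {z : Z} : z ∈ 𝓕.borderKer ↔ 𝓕.l₁ z = 0 ∧ 𝓕.l₂ z = 0 ∧ 𝓕.C z = 0 := by
  simp [borderKer, and_assoc]

/-- Splitting the space of the form along a decomposition of the border space. -/
noncomputable def splitSpace {Y K : Submodule (ZMod 2) Z} (h : IsCompl Y K) (m : ℕ) :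
    (FormSpace Y m × K) ≃ₗ[ZMod 2] FormSpace Z m :=
  (LinearEquiv.prodAssoc (ZMod 2) (Fin m → ZMod 2) ((Fin m → ZMod 2) × Y) K).trans <|
    (LinearEquiv.refl _ _).prodCongr <| (LinearEquiv.prodAssoc (ZMod 2) (Fin m → ZMod 2) Y K).trans <|
      (LinearEquiv.refl _ _).prodCongr (Submodule.prodEquivOfIsCompl Y K h)

theorem splitSpace_apply {Y K : Submodule (ZMod 2) Z} (h : IsCompl Y K)
    (p : FormSpace Y m × K) :
    splitSpace h m p = (p.1.1, p.1.2.1, (p.1.2.2 : Z) + p.2) := by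
  refine Prod.ext rfl (Prod.ext rfl ?_)
  exact Submodule.coe_prodEquivOfIsCompl' Y K h _

theorem form_splitSpace {Y : Submodule (ZMod 2) Z} (h : IsCompl Y 𝓕.borderKer) (x : Fin m → X)
    (A : Matrix (Fin m) (Fin m) (ZMod 2)) (p q : FormSpace Y m × 𝓕.borderKer) :
    𝓕.form x A (splitSpace h m p) (splitSpace h m q) = (𝓕.restrict Y).form x A p.1 q.1 := by
  obtain ⟨hp₁, hp₂, hp⟩ := 𝓕.mem_borderKer.1 p.2.2
  obtain ⟨hq₁, hq₂, hq⟩ := 𝓕.mem_borderKer.1 q.2.2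
  have hC : 𝓕.C p.1.2.2 (q.2 : Z) = 0 := by
    rw [alt_symm 𝓕.C_alt, hq]; rfl
  simp only [splitSpace_apply, form_apply, map_add, hp₁, hp₂, hp, hq₁, hq₂, hC, add_zero]
  rfl

end FormData

theorem radDim_of_fst {V W : Type*} [AddCommGroup V] [Module (ZMod 2) V] [AddCommGroup W]
    [Module (ZMod 2) W] [Finite V] [Finite W] {ω : V →ₗ[ZMod 2] V →ₗ[ZMod 2] ZMod 2}
    {ω' : (V × W) →ₗ[ZMod 2] (V × W) →ₗ[ZMod 2] ZMod 2} (h : ∀ p q, ω' p q = ω p.1 q.1) :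
    radDim ω' = radDim ω + finrank (ZMod 2) W := by
  have hk : LinearMap.ker ω' = (LinearMap.ker ω).prod ⊤ := by
    ext p
    simp only [LinearMap.mem_ker, Submodule.mem_prod, Submodule.mem_top, and_true]
    constructor
    · intro hp
      ext v
      have := LinearMap.congr_fun hp (v, 0)
      rwa [h] at this
    · intro hp
      ext q
      · simp [h, hp]
      · simp [h, hp]
  let e : ((LinearMap.ker ω).prod (⊤ : Submodule (ZMod 2) W)) ≃ₗ[ZMod 2] LinearMap.ker ω × W :=
    { toFun := fun p => (⟨p.1.1, p.2.1⟩, p.1.2)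
      invFun := fun p => ⟨(p.1.1, p.2), p.1.2, trivial⟩
      left_inv := fun _ => rfl
      right_inv := fun _ => rfl
      map_add' := fun _ _ => rfl
      map_smul' := fun _ _ => rfl }
  rw [radDim, hk, e.finrank_eq, finrank_prod, radDim]

namespace FormData

variable {X Z : Type*} [AddCommGroup X] [Module (ZMod 2) X] [AddCommGroup Z] [Module (ZMod 2) Z]
  (𝓕 : FormData X Z) {m : ℕ}

/-- The common kernel pairs to zero with the whole space in every configuration, so it lies in each
radical and contributes a constant; a complement carries the rest of the form. -/
theorem rad_eq_rad_restrict [Finite Z] {Y : Submodule (ZMod 2) Z} (h : IsCompl Y 𝓕.borderKer)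
    (ω : 𝓕.Config m) :
    𝓕.rad ω = (𝓕.restrict Y).rad (m := m) ω + finrank (ZMod 2) 𝓕.borderKer := by
  rw [rad, ← radDim_congr (splitSpace h m)
    (ω := (𝓕.form ω.1.1 ω.1.2).compl₁₂ (splitSpace h m).toLinearMap (splitSpace h m).toLinearMap)
    fun _ _ => rfl]
  exact radDim_of_fst (𝓕.form_splitSpace h ω.1.1 ω.1.2)

/-- A vector of the complement that pairs trivially there also pairs trivially with the kernel,
hence lies in the kernel itself. This supplies the nondegeneracy hypothesis of
`negligible_not_good`. -/
theorem eq_zero_of_restrict {Y : Submodule (ZMod 2) Z} (h : IsCompl Y 𝓕.borderKer) (y : Y)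
    (h₁ : (𝓕.restrict Y).l₁ y = 0) (h₂ : (𝓕.restrict Y).l₂ y = 0)
    (hC : (𝓕.restrict Y).C y = 0) : y = 0 := by
  have hk : (y : Z) ∈ 𝓕.borderKer := by
    refine 𝓕.mem_borderKer.2 ⟨h₁, h₂, ?_⟩
    ext z
    obtain ⟨⟨y', k⟩, rfl⟩ := (Submodule.prodEquivOfIsCompl _ _ h).surjective z
    have e1 : 𝓕.C y y' = 0 := LinearMap.congr_fun hC y'
    have e2 : 𝓕.C y k = 0 := by
      rw [alt_symm 𝓕.C_alt, (𝓕.mem_borderKer.1 k.2).2.2]; rfl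
    rw [Submodule.coe_prodEquivOfIsCompl', map_add, e1, e2, add_zero]; rfl
  exact Subtype.ext (Submodule.disjoint_def.1 h.disjoint _ y.2 hk)

/-- The limiting corank distribution, shifted by the dimension of the common kernel. -/
theorem tendsto_frac_rad_add [Finite X] [Finite Z] (hχ : 𝓕.χ ≠ 0) (hb₁ : 𝓕.b₁ ≠ 0) (hb₂ : 𝓕.b₂ ≠ 0)
    (hsum : 𝓕.b₁ + 𝓕.χ + 𝓕.b₂ ≠ 0) (hne : 𝓕.b₁ ≠ 𝓕.χ ∨ 𝓕.b₂ ≠ 𝓕.χ) (k : ℤ) :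
    Tendsto (fun m => frac fun ω : 𝓕.Config m =>
        (𝓕.rad ω : ℤ) = k + (finrank (ZMod 2) 𝓕.borderKer : ℤ)) atTop
      (𝓝 (if 0 ≤ k ∧ k ≡ (finrank (ZMod 2) Z : ℤ) + (finrank (ZMod 2) 𝓕.borderKer : ℤ) [ZMOD 2]
        then alpha k.toNat else 0)) := by
  obtain ⟨Y, hY⟩ := 𝓕.borderKer.exists_isCompl
  replace hY := hY.symm
  have hdim : finrank (ZMod 2) Y + finrank (ZMod 2) 𝓕.borderKer = finrank (ZMod 2) Z :=
    Submodule.finrank_add_eq_of_isCompl hY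
  have hiff : ∀ m (ω : 𝓕.Config m),
      (𝓕.rad ω : ℤ) = k + (finrank (ZMod 2) 𝓕.borderKer : ℤ) ↔
        ((𝓕.restrict Y).rad (m := m) ω : ℤ) = k := by
    intro m ω
    rw [𝓕.rad_eq_rad_restrict hY ω]
    push_cast
    omega
  split_ifs with hk
  · obtain ⟨C, hC⟩ := (𝓕.restrict Y).negligible_not_good hχ hb₁ hb₂ hsum hne
      (𝓕.eq_zero_of_restrict hY)
    have hpar : k.toNat % 2 = finrank (ZMod 2) Y % 2 := by
      have := hk.2
      unfold Int.ModEq at this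
      omega
    refine ((𝓕.restrict Y).tendsto_frac_rad hC k.toNat hpar).congr fun m => ?_
    refine frac_congr fun ω => Iff.trans ?_ (hiff m ω).symm
    omega
  · refine tendsto_const_nhds.congr fun m => (frac_of_forall_not fun ω => ?_).symm
    rw [hiff]
    intro h
    have := (𝓕.restrict Y).rad_mod_two ω
    apply hk
    unfold Int.ModEq
    omega

end FormData

/-! ### The corank correction -/

namespace BitAssignment

variable {S : Data} {r : ℕ} (β : BitAssignment S r)

/-- The columns `v, v', v₁, …, v_t` as a linear map. -/
noncomputable def columnMap :
    S.BorderSpace →ₗ[ZMod 2] ((Fin r ⊕ Fin r) ⊕ Fin S.t → ZMod 2) :=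
  β.malt.mulVecLin.comp (borderEmb S r)

theorem mem_ker_columnMap {z : S.BorderSpace} : z ∈ LinearMap.ker β.columnMap ↔
    (∀ i, S.border₁ z (β.vec i) = 0) ∧ (∀ i, S.border₂ z (β.vec i) = 0) ∧ S.cornerVector z = 0 := by
  rw [LinearMap.mem_ker, columnMap, LinearMap.comp_apply, Matrix.mulVecLin_apply,
    malt_mulVec_borderEmb]
  constructor
  · intro h
    exact ⟨fun i => congrFun h (.inl (.inl i)), fun i => congrFun h (.inl (.inr i)),
      funext fun k => congrFun h (.inr k)⟩
  · rintro ⟨h₁, h₂, h⟩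
    ext ((i | i) | k)
    · exact h₁ i
    · exact h₂ i
    · exact congrFun h k

theorem columnRank_add_finrank_ker :
    S.columnRank β.malt + finrank (ZMod 2) (LinearMap.ker β.columnMap) = S.t + 2 := by
  have hz : ∀ z : S.BorderSpace, β.columnMap z =
      z.1 • (fun x => ∑ j, β.malt x (.inl (.inl j))) +
      z.2.1 • (fun x => ∑ j, β.malt x (.inl (.inr j))) +
      ∑ k, z.2.2 k • fun x => β.malt x (.inr k) := by
    intro z
    ext x
    simp [columnMap, borderEmb, Matrix.mulVec, dotProduct, Fintype.sum_sum_type, Finset.mul_sum,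
      mul_comm]
  have hr : Submodule.span (ZMod 2)
      ({(fun x => ∑ j, β.malt x (.inl (.inl j))), (fun x => ∑ j, β.malt x (.inl (.inr j)))} ∪
        Set.range fun (i : Fin S.t) x => β.malt x (.inr i)) = LinearMap.range β.columnMap := by
    apply le_antisymm
    · rw [Submodule.span_le]
      rintro _ ((rfl | rfl) | ⟨k, rfl⟩)
      · exact ⟨(1, 0, 0), by simp [hz]⟩
      · exact ⟨(0, 1, 0), by simp [hz]⟩
      · exact ⟨(0, 0, Pi.single k 1), by simp [hz, Pi.single_apply]⟩
    · rintro _ ⟨z, rfl⟩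
      rw [hz]
      refine add_mem (add_mem ?_ ?_) (sum_mem fun k _ => ?_)
      · exact Submodule.smul_mem _ _ (Submodule.subset_span (.inl (.inl rfl)))
      · exact Submodule.smul_mem _ _ (Submodule.subset_span (.inl (.inr rfl)))
      · exact Submodule.smul_mem _ _ (Submodule.subset_span (.inr ⟨k, rfl⟩))
  have h := LinearMap.finrank_range_add_finrank_ker β.columnMap
  rw [← hr] at h
  have hd : finrank (ZMod 2) S.BorderSpace = S.t + 2 := by simp; ring
  rw [hd] at h
  exact h

theorem borderKer_le_ker_columnMap : S.formData.borderKer ≤ LinearMap.ker β.columnMap := by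
  intro z hz
  obtain ⟨h₁, h₂, h⟩ := S.formData.mem_borderKer.1 hz
  refine β.mem_ker_columnMap.2 ⟨fun i => LinearMap.congr_fun h₁ _, fun i => LinearMap.congr_fun h₂ _,
    funext fun k => ?_⟩
  have := LinearMap.congr_fun h (0, 0, Pi.single k 1)
  change S.corner z _ = 0 at this
  simpa [S.corner_apply, Pi.single_apply] using this

/-- If the primes realise every symbol vector, vanishing at the primes is vanishing as a functional;
`corner` then has no term left. -/
theorem ker_columnMap_of_surjective (hβ : Function.Surjective β.vec) :
    LinearMap.ker β.columnMap = S.formData.borderKer := by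
  refine le_antisymm (fun z hz => ?_) β.borderKer_le_ker_columnMap
  obtain ⟨h₁, h₂, h⟩ := β.mem_ker_columnMap.1 hz
  have e₁ : S.border₁ z = 0 := LinearMap.ext fun x => by obtain ⟨i, rfl⟩ := hβ x; exact h₁ i
  have e₂ : S.border₂ z = 0 := LinearMap.ext fun x => by obtain ⟨i, rfl⟩ := hβ x; exact h₂ i
  refine S.formData.mem_borderKer.2 ⟨e₁, e₂, LinearMap.ext fun z' => ?_⟩
  change S.corner z z' = 0
  simp [S.corner_apply, e₁, e₂, h]

end BitAssignment

/-- Border vectors in the common kernel give column relations valid for every `n`, and so bound the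
rank defect from below. -/
theorem Data.finrank_borderKer_le_delta (S : Data) :
    finrank (ZMod 2) S.formData.borderKer ≤ S.delta := by
  obtain ⟨r, p, hp, h⟩ := S.isLeast_delta.1
  rw [← BitAssignment.malt_ofPrimes hp] at h
  have h1 := (BitAssignment.ofPrimes p hp).columnRank_add_finrank_ker
  have h2 := Submodule.finrank_mono (BitAssignment.ofPrimes p hp).borderKer_le_ker_columnMap
  omega

theorem Data.delta_eq_of_surjective {S : Data} {r : ℕ} {p : Fin r → ℕ} (hp : S.IsPrimeTuple p)
    (hs : Function.Surjective fun i => S.symbolVector (p i)) :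
    S.delta = finrank (ZMod 2) S.formData.borderKer := by
  refine le_antisymm (S.isLeast_delta.2 ⟨r, p, hp, ?_⟩) S.finrank_borderKer_le_delta
  rw [← BitAssignment.malt_ofPrimes hp,
    ← (BitAssignment.ofPrimes p hp).ker_columnMap_of_surjective hs]
  exact (BitAssignment.ofPrimes p hp).columnRank_add_finrank_ker


/-! ### Primes with prescribed symbols -/

theorem addSym_congr {a b : ℤ} {m : ℕ} (h : a ≡ b [ZMOD m]) : addSym a m = addSym b m := by
  rw [addSym, addSym, jacobiSym.mod_left a, jacobiSym.mod_left b, h]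

theorem addSym_neg_one {m : ℕ} (h : Odd m) : addSym (-1) m = if m % 4 = 3 then 1 else 0 := by
  have := Nat.odd_iff.1 h
  split_ifs with h3
  · exact addSym_of_neg_one (by rw [jacobiSym.at_neg_one h, ZMod.χ₄_nat_three_mod_four h3])
  · exact addSym_of_one (by rw [jacobiSym.at_neg_one h, ZMod.χ₄_nat_one_mod_four (by omega)])

theorem addSym_two {m : ℕ} (h : Odd m) :
    addSym 2 m = if m % 8 = 1 ∨ m % 8 = 7 then 0 else 1 := by
  have := Nat.odd_iff.1 h
  have h2 := jacobiSym.at_two h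
  rw [ZMod.χ₈_nat_eq_if_mod_eight, if_neg (by omega)] at h2
  split_ifs with h7
  · exact addSym_of_one (by rw [h2, if_pos h7])
  · exact addSym_of_neg_one (by rw [h2, if_neg h7])

/-- Quadratic reciprocity for additive symbols. -/
theorem addSym_reciprocity {a b : ℕ} (ha : Odd a) (hb : Odd b) (hab : a.Coprime b) :
    addSym a b = addSym b a + addSym (-1) a * addSym (-1) b := by
  have hq := jacobiSym.quadratic_reciprocity_if (Nat.odd_iff.1 ha) (Nat.odd_iff.1 hb)
  have h1 : (a : ℤ).gcd b = 1 := by simpa using hab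
  have h2 : (b : ℤ).gcd a = 1 := by simpa using hab.symm
  rw [addSym_neg_one ha, addSym_neg_one hb]
  rcases jacobiSym.eq_one_or_neg_one h1 with h1 | h1 <;>
  rcases jacobiSym.eq_one_or_neg_one h2 with h2 | h2 <;>
  by_cases h3 : a % 4 = 3 <;> by_cases h4 : b % 4 = 3 <;>
  simp [h1, h2, h3, h4] at hq <;>
  simp [addSym_of_one, addSym_of_neg_one, h1, h2, h3, h4] <;> decide

theorem exists_addSym_eq {q : ℕ} (hq : q.Prime) (h2 : q ≠ 2) (g : ZMod 2) :
    ∃ a : ℕ, a.Coprime q ∧ addSym a q = g := by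
  have : Fact q.Prime := ⟨hq⟩
  rcases zmod_two_cases g with rfl | rfl
  · exact ⟨1, Nat.coprime_one_left q, addSym_of_one (by simp)⟩
  · obtain ⟨x, hx⟩ := FiniteField.exists_nonsquare (F := ZMod q)
      (by rwa [ZMod.ringChar_zmod_n])
    have hx' : ¬ IsSquare (((x.val : ℕ) : ℤ) : ZMod q) := by simpa using hx
    refine ⟨x.val, ?_, addSym_of_neg_one ?_⟩
    · rw [← ZMod.isUnit_iff_coprime, ZMod.natCast_zmod_val, isUnit_iff_ne_zero]
      rintro rfl
      exact hx (IsSquare.zero)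
    · rw [← jacobiSym.legendreSym.to_jacobiSym, legendreSym.eq_neg_one_iff]
      exact hx'

theorem exists_mod_eight (g h : ZMod 2) : ∃ a : ℕ, a.Coprime 8 ∧
    (if a % 4 = 3 then 1 else 0 : ZMod 2) = g ∧
      (if a % 8 = 1 ∨ a % 8 = 7 then 0 else 1 : ZMod 2) = h := by
  rcases zmod_two_cases g with rfl | rfl <;> rcases zmod_two_cases h with rfl | rfl
  · exact ⟨1, by norm_num⟩
  · exact ⟨5, by norm_num⟩
  · exact ⟨7, by norm_num⟩
  · exact ⟨3, by norm_num⟩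

namespace Data

variable (S : Data)

theorem odd_of_mem_primeFactors {q : ℕ} (hq : q ∈ S.D.primeFactors) : Odd q :=
  S.odd_D.of_dvd_nat (Nat.dvd_of_mem_primeFactors hq)

theorem primeFactors_two_mul : (2 * S.D).primeFactors = {2} ∪ S.D.primeFactors := by
  rw [Nat.Coprime.primeFactors_mul (Nat.coprime_two_left.2 S.odd_D), Nat.prime_two.primeFactors]

/-- Every symbol vector is the symbol vector of arbitrarily large primes. -/
theorem exists_prime_symbolVector_eq (x : S.SymbolSpace) (n : ℕ) :
    ∃ p > n, p.Prime ∧ S.symbolVector p = x := by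
  classical
  have hD : S.D ≠ 0 := S.squarefree_D.ne_zero
  let f : ℕ → ZMod 2 := fun q => if h : q ∈ (2 * S.D).primeFactors then x.2 ⟨q, h⟩ else 0
  have hf : ∀ q : (2 * S.D).primeFactors, f q = x.2 q := fun q => dif_pos q.2
  -- The residue `a q` is meant for the prime modulo `q`. The summand `(-1/q)₊ (-1/p)₊`, with
  -- `(-1/p)₊ = x.1`, anticipates the correction that reciprocity makes when `(p/q)₊` is turned into
  -- `(q/p)₊`.
  have hex : ∀ q : ℕ, ∃ a : ℕ, q ∈ S.D.primeFactors →
      a.Coprime q ∧ addSym a q = f q + addSym (-1) q * x.1 := by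
    intro q
    by_cases hq : q ∈ S.D.primeFactors
    · have hodd := S.odd_of_mem_primeFactors hq
      obtain ⟨a, ha⟩ := exists_addSym_eq (Nat.prime_of_mem_primeFactors hq)
        (by rintro rfl; exact absurd hodd (by decide)) (f q + addSym (-1) q * x.1)
      exact ⟨a, fun _ => ha⟩
    · exact ⟨0, fun h => absurd h hq⟩
  choose a ha using hex
  have hpair : (S.D.primeFactors : Set ℕ).Pairwise (Function.onFun Nat.Coprime id) := by
    intro p hp q hq hpq
    exact (Nat.coprime_primes (Nat.prime_of_mem_primeFactors hp)
      (Nat.prime_of_mem_primeFactors hq)).2 hpq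
  obtain ⟨k, hk⟩ := Nat.chineseRemainderOfFinset a id S.D.primeFactors
    (fun q hq => (Nat.prime_of_mem_primeFactors hq).ne_zero) hpair
  -- The class modulo 8 governs the symbols of -1 and 2.
  obtain ⟨e, he8, he1, he2⟩ := exists_mod_eight x.1 (f 2)
  have hc8 : Nat.Coprime 8 S.D := by
    have := (Nat.coprime_two_left.2 S.odd_D).pow_left 3
    simpa using this
  obtain ⟨l, hl8, hlD⟩ := Nat.chineseRemainder hc8 e k
  have hlq : ∀ q ∈ S.D.primeFactors, l ≡ a q [MOD q] := fun q hq =>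
    (hlD.of_dvd (Nat.dvd_of_mem_primeFactors hq)).trans (hk q hq)
  have hlco : l.Coprime (8 * S.D) := by
    refine Nat.Coprime.mul_right ?_ ?_
    · rw [Nat.Coprime, hl8.gcd_eq]; exact he8
    · refine Nat.coprime_of_dvd fun q hq hql hqD => ?_
      have hqm : q ∈ S.D.primeFactors := Nat.mem_primeFactors.2 ⟨hq, hqD, hD⟩
      have := (ha q hqm).1
      rw [Nat.Coprime, ← (hlq q hqm).gcd_eq, Nat.gcd_eq_right hql] at this
      exact hq.one_lt.ne' this
  have : NeZero (8 * S.D) := ⟨by omega⟩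
  -- The bound `2 * S.D` makes `p` odd and distinct from the primes dividing `D`.
  obtain ⟨p, hpn, hp, hpe⟩ := Nat.forall_exists_prime_gt_and_eq_mod
    ((ZMod.isUnit_iff_coprime l (8 * S.D)).2 hlco) (max n (2 * S.D))
  have hpl : p ≡ l [MOD 8 * S.D] := (ZMod.natCast_eq_natCast_iff _ _ _).1 hpe
  have hp8 : p % 8 = e % 8 := (hpl.of_mul_right _).trans hl8
  have hpodd : Odd p := hp.odd_of_ne_two (by have := Nat.pos_of_ne_zero hD; omega)
  have hneg : addSym (-1) p = x.1 := by
    rw [addSym_neg_one hpodd, ← he1, show p % 4 = e % 4 by omega]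
  refine ⟨p, by omega, hp, Prod.ext hneg (funext fun q => ?_)⟩
  rw [← hf]
  change addSym ((q : ℕ) : ℤ) p = f q
  have hqm : (q : ℕ) ∈ {2} ∪ S.D.primeFactors :=
    (Finset.ext_iff.1 S.primeFactors_two_mul _).1 q.2
  rw [Finset.mem_union, Finset.mem_singleton] at hqm
  rcases hqm with h2 | hqm
  · rw [h2]
    exact (addSym_two hpodd).trans (by rw [hp8]; exact he2)
  · have hqp : (q : ℕ).Coprime p := by
      refine (Nat.coprime_primes (Nat.prime_of_mem_primeFactors hqm) hp).2 ?_
      have := Nat.le_of_dvd (Nat.pos_of_ne_zero hD) (Nat.dvd_of_mem_primeFactors hqm)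
      omega
    rw [addSym_reciprocity (S.odd_of_mem_primeFactors hqm) hpodd hqp, hneg,
      addSym_congr (b := a q) (Int.natCast_modEq_iff.2 (((hpl.of_dvd
        (Dvd.dvd.mul_left (Nat.dvd_of_mem_primeFactors hqm) 8))).trans (hlq q hqm))),
      (ha q hqm).2, add_assoc, CharTwo.add_self_eq_zero, add_zero]

/-- Distinct primes whose product has absolute value congruent to `|n₀|` list the prime factors of
an element of `X`. -/
theorem isPrimeTuple_of_modEq {r : ℕ} {p : Fin r → ℕ} (hp : ∀ i, (p i).Prime)
    (hinj : Function.Injective p) (hmod : ∏ i, p i ≡ S.n₀.natAbs [MOD 8 * S.D]) :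
    S.IsPrimeTuple p := by
  have h0 : S.n₀ ≠ 0 := by
    rintro h; have := S.odd_n₀; simp [h] at this
  have hs : S.n₀.sign.natAbs = 1 := Int.natAbs_sign_of_ne_zero h0
  have hsu : IsUnit S.n₀.sign := Int.isUnit_iff_natAbs_eq.2 hs
  have hcast : (∏ i, (p i : ℤ)) = ((∏ i, p i : ℕ) : ℤ) := by push_cast; rfl
  refine ⟨hp, ?_, ?_, ?_, 1, ?_⟩ <;> rw [hcast]
  · rw [← Int.squarefree_natAbs, Int.natAbs_mul, hs, one_mul, Int.natAbs_natCast]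
    refine Finset.squarefree_prod_of_pairwise_isCoprime (fun i _ j _ hij => ?_)
      fun i _ => (hp i).prime.squarefree
    exact Nat.coprime_iff_isRelPrime.1 ((Nat.coprime_primes (hp i) (hp j)).2 (hinj.ne hij))
  · rw [isCoprime_mul_unit_left_left hsu, Int.isCoprime_iff_gcd_eq_one]
    have h1 : S.n₀.natAbs.gcd (2 * S.D) = 1 := by
      have := Int.isCoprime_iff_gcd_eq_one.1 S.coprime_natAbs
      simpa [Int.gcd, Int.natAbs_mul] using this
    have h2 : (∏ i, p i).gcd (2 * S.D) = 1 := by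
      rw [← h1]
      exact (hmod.of_dvd ⟨4, by ring⟩).gcd_eq
    rw [Int.gcd, Int.natAbs_natCast]
    simpa [Int.natAbs_mul] using h2
  · have hq0 : (0 : ℚ) < (∏ i, p i : ℕ) := by
      exact_mod_cast Finset.prod_pos fun i _ => (hp i).pos
    push_cast at hq0 ⊢
    rcases lt_or_gt_of_ne h0 with h | h
    · rw [Int.sign_eq_neg_one_of_neg h]
      have : (S.n₀ : ℚ) < 0 := by exact_mod_cast h
      exact div_pos_of_neg_of_neg (by push_cast; linarith) this
    · rw [Int.sign_eq_one_of_pos h]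
      have : (0 : ℚ) < S.n₀ := by exact_mod_cast h
      exact div_pos (by push_cast; linarith) this
  · have := (Int.natCast_modEq_iff.2 hmod).mul_left S.n₀.sign
    rw [Int.sign_mul_natAbs] at this
    simpa using this

/-- Some prime tuple realises all symbol vectors. -/
theorem exists_isPrimeTuple_surjective : ∃ (r : ℕ) (p : Fin r → ℕ), S.IsPrimeTuple p ∧
    Function.Surjective fun i => S.symbolVector (p i) := by
  have hD : S.D ≠ 0 := S.squarefree_D.ne_zero
  have : NeZero (8 * S.D) := ⟨by omega⟩
  obtain ⟨x, hx⟩ := exists_surjective_nat S.SymbolSpace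
  -- Each symbol vector belongs to infinitely many primes, so a strictly increasing sequence of
  -- primes can follow the enumeration `x`.
  obtain ⟨φ, hφ, hφP⟩ := extraction_forall_of_frequently
    (P := fun n k => 2 * S.D < k ∧ k.Prime ∧ S.symbolVector k = x n) fun n => by
      rw [frequently_atTop']
      intro b
      obtain ⟨p, h1, h2, h3⟩ := S.exists_prime_symbolVector_eq (x n) (max b (2 * S.D))
      exact ⟨p, by omega, by omega, h2, h3⟩
  choose g hg using hx
  -- `N` bounds the index at which each symbol vector is attained, so the first `N + 1` primes of
  -- the sequence already realise all of them.
  obtain ⟨N, hN⟩ := (Set.finite_range g).bddAbove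
  have hco : ∀ n, (φ n).Coprime (8 * S.D) := by
    intro n
    refine (Nat.Prime.coprime_iff_not_dvd (hφP n).2.1).2 fun h => ?_
    have h2 : φ n ∣ 2 ^ 2 * (2 * S.D) := by convert h using 1; ring
    have hle : ∀ d, d ∣ φ n → d ≠ 1 → 2 * S.D < d := by
      intro d hd h1
      rw [((hφP n).2.1.eq_one_or_self_of_dvd d hd).resolve_left h1]
      exact (hφP n).1
    rcases (hφP n).2.1.dvd_mul.1 h2 with h' | h'
    · have := Nat.le_of_dvd two_pos ((hφP n).2.1.dvd_of_dvd_pow h')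
      have := (hφP n).1
      omega
    · exact absurd (Nat.le_of_dvd (by omega) h') (by have := (hφP n).1; omega)
  have hP : IsUnit ((∏ i : Fin (N + 1), φ i : ℕ) : ZMod (8 * S.D)) :=
    (ZMod.isUnit_iff_coprime _ _).2 (Nat.Coprime.prod_left fun i _ => hco i)
  have hn : IsUnit ((S.n₀.natAbs : ℕ) : ZMod (8 * S.D)) := by
    refine (ZMod.isUnit_iff_coprime _ _).2 ?_
    have := Int.isCoprime_iff_gcd_eq_one.1 S.coprime_natAbs
    have h1 : S.n₀.natAbs.Coprime (2 * S.D) := by simpa [Int.gcd, Int.natAbs_mul] using this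
    have := ((h1.coprime_mul_right_right).pow_right 3).mul_right h1.coprime_mul_left_right
    simpa using this
  obtain ⟨u, hu⟩ := hP
  -- One last prime moves the product into the class of `|n₀|`. Taken beyond `φ (N + 1)`, it differs
  -- from all the others.
  obtain ⟨p, hpn, hp, hpe⟩ := Nat.forall_exists_prime_gt_and_eq_mod
    (hn.mul (u⁻¹).isUnit) (φ (N + 1))
  refine ⟨N + 2, Fin.snoc (α := fun _ => ℕ) (fun i : Fin (N + 1) => φ i) p,
    S.isPrimeTuple_of_modEq ?_ ?_ ?_, ?_⟩
  · intro i
    refine Fin.lastCases ?_ (fun i => ?_) i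
    · simpa using hp
    · simpa using (hφP i).2.1
  · refine Fin.snoc_injective_iff.2 ⟨fun i j h => Fin.ext (hφ.injective h), ?_⟩
    rintro ⟨i, hi⟩
    exact absurd (hi.symm.trans_lt (hφ i.2)) hpn.not_gt
  · rw [← ZMod.natCast_eq_natCast_iff, Fin.prod_univ_castSucc]
    simp only [Fin.snoc_castSucc, Fin.snoc_last]
    rw [Nat.cast_mul, hpe, ← hu, mul_left_comm, Units.mul_inv, mul_one]
  · intro y
    have hy : g y < N + 1 := Nat.lt_succ_of_le (hN ⟨y, rfl⟩)
    refine ⟨Fin.castSucc ⟨g y, hy⟩, ?_⟩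
    simp only [Fin.snoc_castSucc]
    rw [(hφP (g y)).2.2, hg]

theorem delta_eq_finrank_borderKer : S.delta = finrank (ZMod 2) S.formData.borderKer := by
  obtain ⟨r, p, hp, hs⟩ := S.exists_isPrimeTuple_surjective
  exact delta_eq_of_surjective hp hs

end Data

namespace Data

variable (S : Data)

/-! ### Squares and vanishing symbols -/

theorem eq_sign_mul_prod {d : ℤ} (hd : d ∣ 2 * (S.D : ℤ)) :
    d = (-1) ^ (if d < 0 then 1 else 0) *
      ∏ q : (2 * S.D).primeFactors, ((q : ℕ) : ℤ) ^ (if ((q : ℕ) : ℤ) ∣ d then 1 else 0) := by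
  have hsq : Squarefree (2 * S.D) := by
    rw [Nat.squarefree_mul_iff]
    exact ⟨Nat.coprime_two_left.2 S.odd_D, Nat.prime_two.prime.squarefree, S.squarefree_D⟩
  have hdn : d.natAbs ∣ 2 * S.D := by
    have := Int.natAbs_dvd_natAbs.2 hd
    simpa [Int.natAbs_mul] using this
  have hd0 : d.natAbs ≠ 0 := by
    intro h
    rw [h, zero_dvd_iff] at hdn
    exact hsq.ne_zero hdn
  have hfac : (d.natAbs : ℤ) = ∏ q : (2 * S.D).primeFactors,
      ((q : ℕ) : ℤ) ^ (if ((q : ℕ) : ℤ) ∣ d then 1 else 0) := by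
    rw [Finset.prod_coe_sort (2 * S.D).primeFactors
      (fun q => (q : ℤ) ^ (if (q : ℤ) ∣ d then 1 else 0))]
    simp only [pow_ite, pow_one, pow_zero]
    rw [← Finset.prod_filter]
    conv_lhs => rw [← Nat.prod_primeFactors_of_squarefree (hsq.squarefree_of_dvd hdn)]
    rw [Nat.cast_prod]
    refine Finset.prod_congr ?_ fun _ _ => rfl
    ext q
    simp only [Finset.mem_filter, Nat.mem_primeFactors, Int.natCast_dvd]
    exact ⟨fun ⟨h1, h2, _⟩ => ⟨⟨h1, h2.trans hdn, hsq.ne_zero⟩, h2⟩, fun ⟨⟨h1, _⟩, h2⟩ =>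
      ⟨h1, h2, hd0⟩⟩
  rw [← hfac]
  split_ifs <;> simp only [pow_one, pow_zero] <;> omega

theorem exists_exponents {Q : List ℤ} (hQ : ∀ d ∈ Q, d ∣ 2 * (S.D : ℤ)) :
    ∃ (N : ℕ) (e : (2 * S.D).primeFactors → ℕ),
      Q.prod = (-1) ^ N * ∏ q : (2 * S.D).primeFactors, ((q : ℕ) : ℤ) ^ e q ∧
        ∀ x, S.listFun Q x = N * x.1 + ∑ q, (e q : ZMod 2) * x.2 q := by
  induction Q with
  | nil => exact ⟨0, fun _ => 0, by simp, fun x => by simp [S.listFun_apply]⟩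
  | cons d Q ih =>
    simp only [List.forall_mem_cons] at hQ
    obtain ⟨N, e, h1, h2⟩ := ih hQ.2
    refine ⟨(if d < 0 then 1 else 0) + N, fun q => (if ((q : ℕ) : ℤ) ∣ d then 1 else 0) + e q, ?_,
      fun x => ?_⟩
    · rw [List.prod_cons, h1]
      conv_lhs => rw [S.eq_sign_mul_prod hQ.1]
      simp only [pow_add, Finset.prod_mul_distrib]
      ring
    · rw [S.listFun_apply, List.map_cons, List.sum_cons, ← S.listFun_apply, h2, S.divFun_apply]
      simp only [Nat.cast_add, Nat.cast_ite, Nat.cast_one, Nat.cast_zero, add_mul, ite_mul, one_mul,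
        zero_mul, Finset.sum_add_distrib]
      ring

/-- Evaluation at the coordinate vectors of `SymbolSpace` reads off the parities of the exponents of
-1 and of each prime dividing `2D`. -/
theorem isSquare_prod_of_listFun_eq_zero {Q : List ℤ} (hQ : ∀ d ∈ Q, d ∣ 2 * (S.D : ℤ))
    (h : S.listFun Q = 0) : IsSquare Q.prod := by
  classical
  obtain ⟨N, e, h1, h2⟩ := S.exists_exponents hQ
  have hN : Even N := by
    rw [← ZMod.natCast_eq_zero_iff_even]
    simpa [h] using (h2 (1, 0)).symm
  have he : ∀ q, Even (e q) := by
    intro q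
    rw [← ZMod.natCast_eq_zero_iff_even]
    simpa [h, Pi.single_apply] using (h2 (0, Pi.single q 1)).symm
  rw [h1, hN.neg_one_pow, one_mul]
  exact Finset.isSquare_prod _ fun q _ => (he q).isSquare_pow _

theorem divFun_neg_one : S.divFun (-1) = S.negFun := by
  refine LinearMap.ext fun x => ?_
  rw [divFun_apply, if_pos (by norm_num), Finset.sum_eq_zero fun q _ => if_neg ?_, add_zero]
  · rfl
  · rw [dvd_neg, ← Nat.cast_one, Int.natCast_dvd_natCast, Nat.dvd_one]
    exact (Nat.prime_of_mem_primeFactors q.2).ne_one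

theorem listFun_cons (d : ℤ) (Q : List ℤ) : S.listFun (d :: Q) = S.divFun d + S.listFun Q := by
  simp [listFun]

theorem listFun_append (Q R : List ℤ) : S.listFun (Q ++ R) = S.listFun Q + S.listFun R := by
  simp [listFun]

theorem neg_one_cons_dvd {Q : List ℤ} (hQ : ∀ d ∈ Q, d ∣ 2 * (S.D : ℤ)) :
    ∀ d ∈ (-1) :: Q, d ∣ 2 * (S.D : ℤ) :=
  List.forall_mem_cons.2 ⟨by simp, hQ⟩

/-- Prepending -1 to `Q` adds `negFun` to the functional, so equality would make `-Q.prod` a square.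
-/
theorem listFun_ne_negFun {Q : List ℤ} (hQ : ∀ d ∈ Q, d ∣ 2 * (S.D : ℤ)) (h : ¬ IsSquare (-Q.prod)) :
    S.listFun Q ≠ S.negFun := by
  intro he
  have := S.isSquare_prod_of_listFun_eq_zero (S.neg_one_cons_dvd hQ) (by
    rw [listFun_cons, divFun_neg_one, he]
    exact LinearMap.ext fun x => CharTwo.add_self_eq_zero _)
  rw [List.prod_cons, neg_one_mul] at this
  exact h this

theorem listFun_add_negFun_add_listFun_ne_zero :
    S.listFun S.Q₁ + S.negFun + S.listFun S.Q₂ ≠ 0 := by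
  intro h
  have := S.isSquare_prod_of_listFun_eq_zero (S.neg_one_cons_dvd (Q := S.Q₁ ++ S.Q₂) fun d hd =>
    (List.mem_append.1 hd).elim (S.dvd_Q₁ d) (S.dvd_Q₂ d)) (by
      rw [listFun_cons, divFun_neg_one, listFun_append, ← h]
      abel)
  rw [List.prod_cons, List.prod_append, neg_one_mul] at this
  exact S.neg_b₁b₂_not_sq this

theorem negFun_ne_zero : S.negFun ≠ 0 := by
  intro h
  have : (1 : ZMod 2) = 0 := LinearMap.congr_fun h (1, 0)
  exact one_ne_zero this

/-- The non-square hypotheses are the nonvanishing conditions on the form data. The border dimension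
`t + 2` has the parity of `t`. -/
theorem tendsto_frac_corank (k : ℤ) :
    Tendsto (fun m => frac fun β : BitAssignment S (m + 1) =>
        (corank β.malt : ℤ) = k + (S.delta : ℤ)) atTop
      (𝓝 (if 0 ≤ k ∧ k ≡ (S.t : ℤ) + (S.delta : ℤ) [ZMOD 2] then alpha k.toNat else 0)) := by
  have hd : finrank (ZMod 2) S.BorderSpace = S.t + 2 := by simp; ring
  have h := S.formData.tendsto_frac_rad_add S.negFun_ne_zero
    (fun h => S.b₁_not_sq (S.isSquare_prod_of_listFun_eq_zero S.dvd_Q₁ h))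
    (fun h => S.b₂_not_sq (S.isSquare_prod_of_listFun_eq_zero S.dvd_Q₂ h))
    S.listFun_add_negFun_add_listFun_ne_zero
    (S.not_both_neg_sq.imp (S.listFun_ne_negFun S.dvd_Q₁) (S.listFun_ne_negFun S.dvd_Q₂)) k
  rw [← S.delta_eq_finrank_borderKer, hd] at h
  have hiff : k ≡ ((S.t + 2 : ℕ) : ℤ) + (S.delta : ℤ) [ZMOD 2] ↔
      k ≡ (S.t : ℤ) + (S.delta : ℤ) [ZMOD 2] := by
    unfold Int.ModEq
    push_cast
    omega
  simp only [hiff] at h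
  refine h.congr fun m => ?_
  rw [← frac_equiv (BitAssignment.configEquiv S m)]
  simp only [BitAssignment.corank_malt_eq_rad]

end Data

end AltMatrix

theorem mainTheorem8 (S : AltMatrix.Data) :
    (∀ r : ℕ, 1 ≤ r →
      Nat.card (AltMatrix.BitAssignment S r) = 2 ^ ((r + 2 * S.c + 4) * (r - 1) / 2)) ∧
    ∀ k : ℤ,
      Tendsto
        (fun r : ℕ =>
          (Nat.card {β : AltMatrix.BitAssignment S r //
            (AltMatrix.corank β.malt : ℤ) = k + (S.delta : ℤ)} : ℝ) /
            2 ^ ((r + 2 * S.c + 4) * (r - 1) / 2))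
        atTop
        (𝓝 (if 0 ≤ k ∧ k ≡ (S.t : ℤ) + (S.delta : ℤ) [ZMOD 2]
          then AltMatrix.alpha k.toNat else 0)) := by
  refine ⟨fun r hr => ?_, fun k => ?_⟩
  · obtain ⟨m, rfl⟩ := Nat.exists_eq_add_of_le' hr
    exact AltMatrix.BitAssignment.card S m
  -- Bit assignments for `r = m + 1` are configurations of `m` primes; the term `r = 0` does not
  -- affect the limit.
  · rw [← tendsto_add_atTop_iff_nat 1]
    refine (S.tendsto_frac_corank k).congr fun m => ?_
    rw [AltMatrix.frac, AltMatrix.BitAssignment.card, Nat.cast_pow, Nat.cast_ofNat]
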